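/- Let $\mathbb K\in\{\mathbb R,\mathbb C\}$, let $M$ be a (Hausdorff, finite-dimensional) smooth manifold, and let $\mathrm{UConf}(M)=\bigsqcup_{k\ge 0}\mathrm{UConf}_k(M)$ be the manifold (of non-pure dimension) of finite subsets of $M$, where $\mathrm{UConf}_k(M)$ is the quotient by $S_k$ of the open submanifold $\mathrm{OConf}_k(M)\subset M^k$ of $k$-tuples of distinct points. Write $\mathcal{VB}(X)$ for the category of smooth $\mathbb K$-vector bundles over $X$ (of finite, locally constant rank) and smooth bundle maps over $\mathrm{id}_X$. For $\mathbf V,\mathbf W\in\mathcal{VB}(\mathrm{UConf}(M))$, the Cauchy tensor product $\mathbf V\boxtimes\mathbf W$ has fibres $$(\mathbf V\boxtimes\mathbf W)_{\underline x}=\bigoplus_{\underline x=\underline x'\sqcup\underline x''}\mathbf V_{\underline x'}\otimes\mathbf W_{\underline x''}$$ (sum over ordered splits), with the smooth structure of the external tensor product locally on ordered configurations; its unit $\mathbf I_\boxtimes$ is $\mathbb K$ over $\emptyset$ and $0$ elsewhere, and its braiding is $v\otimes w\mapsto w\otimes v$, respectively $v\otimes w\mapsto(-1)^{\deg v\deg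 w}w\otimes v$ for $\mathbb Z$-graded bundles. A (commutative, graded-commutative) $\boxtimes$-algebra bundle is a (commutative, graded-commutative) monoid in $\mathcal{VB}(\mathrm{UConf}(M))$ for $\boxtimes$; in the graded case the multiplication and the unit preserve degrees. For $V\in\mathcal{VB}(M)$ let $i_*V\in\mathcal{VB}(\mathrm{UConf}(M))$ be $V$ over $M=\mathrm{UConf}_1(M)$ and $0$ elsewhere, and let $\mathbf T^\boxtimes(V)=\bigoplus_{n\ge0}(i_*V)^{\boxtimes n}$, which is a $\boxtimes$-algebra bundle with the concatenation of tensors as multiplication and the inclusion of $\mathbf I_\boxtimes=(i_*V)^{\boxtimes 0}$ as unit. For $\sigma\in S_n$ put $\sigma(v_1\otimes\cdots\otimes v_n)=v_{\sigma(1)}\otimes\cdots\otimes v_{\sigma(n)}$ on $(i_*V)^{\boxtimes n}$. Let $\mathbf S^\boxtimes(V)$ and $\mathbf\Lambda^\boxtimes(V)$ be the fibrewise quotients of $\mathbf T^\boxtimes(V)$ by the subspaces spanned, for $n\ge0$ and $\sigma\in S_n$, by the $v-\sigma(v)$, respectively by the $v-\mathrm{sgn}(\sigma)\,\sigma(v)$,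 with the quotient smooth structures. **Theorem.** (1) $\mathbf S^\boxtimes(V)$ is a smooth vector bundle over $\mathrm{UConf}(M)$ and a commutative $\boxtimes$-algebra bundle, with multiplication and unit induced by those of $\mathbf T^\boxtimes(V)$ (that is, the projection $\mathbf T^\boxtimes(V)\to\mathbf S^\boxtimes(V)$ is a morphism of $\boxtimes$-algebras). Moreover it is the free commutative $\boxtimes$-algebra bundle generated by $V$: the canonical map $\iota:i_*V\to\mathbf S^\boxtimes(V)$ is a smooth bundle map, and for every commutative $\boxtimes$-algebra bundle $\mathbf A$ and every bundle map $f:i_*V\to\mathbf A$ there is a unique morphism of $\boxtimes$-algebra bundles $\varphi:\mathbf S^\boxtimes(V)\to\mathbf A$ with $\varphi\circ\iota=f$. (2) $\mathbf\Lambda^\boxtimes(V)$, graded by tensor length $n$, is a smooth vector bundle over $\mathrm{UConf}(M)$ and a graded-commutative $\boxtimes$-algebra bundle, with multiplication and unit induced by those of $\mathbf T^\boxtimes(V)$. Moreover it is the free graded-commutative $\boxtimes$-algebra bundle generated by $V$ placed in degree $1$: the canonical map $\iota:i_*V\to\mathbf\Lambda^\boxtimes(V)$ is a smooth bundle map into degree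 $1$, and for every $\mathbb Z$-graded graded-commutative $\boxtimes$-algebra bundle $\mathbf A$ and every bundle map $f:i_*V\to\mathbf A$ with values in degree $1$ there is a unique degree-preserving morphism of $\boxtimes$-algebra bundles $\varphi:\mathbf\Lambda^\boxtimes(V)\to\mathbf A$ with $\varphi\circ\iota=f$. -/

import Mathlib

open scoped Manifold ContDiff TensorProduct Topology DirectSum

universe u

noncomputable section

/-! ### Configuration spaces -/

/-- The set of unordered configurations of distinct points of `M`, that is, of finite subsets. -/
abbrev UConf (M : Type u) : Type u := Finset M

/-- Ordered configurations of `k` distinct points of `M`, a subspace of `M ^ k`. -/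
abbrev OConf (M : Type u) (k : ℕ) : Type u := {w : Fin k → M // Function.Injective w}

/-- The map `(x₁, …, xₖ) ↦ {x₁, …, xₖ}`; on `OConf M k` it is the quotient map by `Sₖ`. -/
def unorder {M : Type u} {k : ℕ} (w : Fin k → M) : UConf M := (Set.finite_range w).toFinset

/-- `UConf M` is the disjoint union over `k` of the quotients of `OConf M k` by `Sₖ`. -/
instance UConf.topology {M : Type u} [TopologicalSpace M] : TopologicalSpace (UConf M) :=
  TopologicalSpace.coinduced (fun w : Σ k, OConf M k => unorder w.2.1) inferInstance

/-- Smoothness at `x` of a scalar function on a manifold `M` of dimension `d`. -/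
def MSmoothAt {𝕜 : Type u} [RCLike 𝕜] (d : ℕ) {M : Type u} [TopologicalSpace M]
    [ChartedSpace (EuclideanSpace ℝ (Fin d)) M] (g : M → 𝕜) (x : M) : Prop :=
  ContMDiffAt (𝓡 d) 𝓘(ℝ, 𝕜) ∞ g x

/-- Smoothness at `x` of a scalar function on `UConf M`: the pullback to ordered configurations
(an open subset of `M ^ k`) is smooth at the points above `x`. -/
def USmoothAt {𝕜 : Type u} [RCLike 𝕜] (d : ℕ) {M : Type u} [TopologicalSpace M]
    [ChartedSpace (EuclideanSpace ℝ (Fin d)) M] (g : UConf M → 𝕜) (x : UConf M) : Prop :=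
  ∀ (k : ℕ) (w : OConf M k), unorder w.1 = x →
    ContMDiffAt (ModelWithCorners.pi fun _ : Fin k => 𝓡 d) 𝓘(ℝ, 𝕜) ∞
      (fun w' : Fin k → M => g (unorder w')) w.1

/-! ### Vector bundles -/

/-- A family of `𝕜`-vector spaces over `X` together with a notion of smoothness at a point for
(arbitrary, set-theoretic) sections. It is a smooth vector bundle when `IsVectorBundle` holds. -/
structure PreBundle (𝕜 : Type u) [RCLike 𝕜] (X : Type u) where
  Fib : X → Type u
  [addCommGroup : ∀ x, AddCommGroup (Fib x)]
  [module : ∀ x, Module 𝕜 (Fib x)]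
  SmoothAt : (∀ x, Fib x) → X → Prop

attribute [instance] PreBundle.addCommGroup PreBundle.module

/-- Local triviality, `C` being the smoothness of scalar functions on `X`: around every point there
is a finite frame, i.e. sections `e₁, …, eₙ` that form a basis of each nearby fibre, such that the
smooth sections are exactly the combinations of the `eᵢ` with smooth coefficients. The rank `n`
may vary from one connected component of `X` to another. -/
def PreBundle.IsVectorBundle {𝕜 : Type u} [RCLike 𝕜] {X : Type u} [TopologicalSpace X]
    (V : PreBundle 𝕜 X) (C : (X → 𝕜) → X → Prop) : Prop :=
  ∀ x, ∃ (n : ℕ) (e : Fin n → ∀ y, V.Fib y), ∀ᶠ y in 𝓝 x,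
    (LinearIndependent 𝕜 (fun i => e i y) ∧ Submodule.span 𝕜 (Set.range fun i => e i y) = ⊤) ∧
    ∀ s, V.SmoothAt s y ↔
      ∃ c : Fin n → X → 𝕜, (∀ i, C (c i) y) ∧ ∀ᶠ z in 𝓝 y, s z = ∑ i, c i z • e i z

/-- Smooth bundle maps over the identity of `X`. -/
structure BundleHom {𝕜 : Type u} [RCLike 𝕜] {X : Type u} (V W : PreBundle 𝕜 X) where
  toFun : ∀ x, V.Fib x →ₗ[𝕜] W.Fib x
  smooth : ∀ s x, V.SmoothAt s x → W.SmoothAt (fun y => toFun y (s y)) x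

/-- The direct sum of a sequence of bundles. -/
def PreBundle.dsum {𝕜 : Type u} [RCLike 𝕜] {X : Type u} (P : ℕ → PreBundle 𝕜 X) :
    PreBundle 𝕜 X where
  Fib x := ⨁ n, (P n).Fib x
  SmoothAt s x := ∀ n, (P n).SmoothAt (fun y => s y n) x

/-- The fibrewise quotient: smooth sections are those that lift locally to smooth sections. -/
def PreBundle.quotient {𝕜 : Type u} [RCLike 𝕜] {X : Type u} [TopologicalSpace X]
    (V : PreBundle 𝕜 X) (N : ∀ x, Submodule 𝕜 (V.Fib x)) : PreBundle 𝕜 X where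
  Fib x := V.Fib x ⧸ N x
  SmoothAt s x := ∃ t, V.SmoothAt t x ∧ ∀ᶠ y in 𝓝 x, s y = (N y).mkQ (t y)

/-- A `ℤ`-grading of a bundle: a decomposition of every fibre such that the projections to the
homogeneous components are smooth, i.e. a direct sum decomposition into subbundles. -/
structure BundleGrading {𝕜 : Type u} [RCLike 𝕜] {X : Type u} (A : PreBundle 𝕜 X) where
  part : ℤ → ∀ x, Submodule 𝕜 (A.Fib x)
  isInternal : ∀ x, DirectSum.IsInternal fun n => part n x
  smooth : ∀ n s x, A.SmoothAt s x → A.SmoothAt (fun y =>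
    (((LinearEquiv.ofBijective (DirectSum.coeLinearMap fun n => part n y)
      (isInternal y)).symm (s y) n : part n y) : A.Fib y)) x

/-! ### The Cauchy tensor product -/

/-- `x = a ⊔ b` is a split of the configuration `x` into two disjoint configurations. -/
def IsSplit {M : Type u} (x a b : UConf M) : Prop :=
  Disjoint a b ∧ ∀ y, y ∈ x ↔ y ∈ a ∨ y ∈ b

theorem IsSplit.symm {M : Type u} {x a b : UConf M} (h : IsSplit x a b) : IsSplit x b a :=
  ⟨h.1.symm, fun y => (h.2 y).trans or_comm⟩

theorem IsSplit.left_empty {M : Type u} (x : UConf M) : IsSplit x ∅ x :=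
  ⟨Finset.disjoint_empty_left x, fun y => by simp⟩

/-- The ordered splits of `x` into two disjoint configurations. -/
abbrev Split {M : Type u} (x : UConf M) : Type u :=
  {p : UConf M × UConf M // IsSplit x p.1 p.2}

section Cauchy

variable {𝕜 : Type u} [RCLike 𝕜] (d : ℕ) {M : Type u} [TopologicalSpace M]
  [ChartedSpace (EuclideanSpace ℝ (Fin d)) M]

/-- The Cauchy tensor product, with fibres `(V ⊠ W)ₓ = ⨁_{x = x' ⊔ x''} V_{x'} ⊗ W_{x''}`.
A section is smooth at `x` when, for every split `x = x' ⊔ x''`, its component at the nearby splits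
`y = y' ⊔ y''` with `y'` close to `x'` and `y''` close to `x''` is a smooth section of the external
tensor product, i.e. a finite sum of terms `g(y) v(y') ⊗ w(y'')` with `g`, `v`, `w` smooth. -/
def cauchy (V W : PreBundle 𝕜 (UConf M)) : PreBundle 𝕜 (UConf M) where
  Fib x := ⨁ p : Split x, V.Fib p.1.1 ⊗[𝕜] W.Fib p.1.2
  SmoothAt s x := ∀ p : Split x, ∃ U' U'' : Set M,
    IsOpen U' ∧ IsOpen U'' ∧ Disjoint U' U'' ∧ ↑p.1.1 ⊆ U' ∧ ↑p.1.2 ⊆ U'' ∧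
    ∃ (n : ℕ) (g : Fin n → UConf M → 𝕜) (v : Fin n → ∀ y, V.Fib y) (w : Fin n → ∀ y, W.Fib y),
      (∀ j, USmoothAt d (g j) x ∧ V.SmoothAt (v j) p.1.1 ∧ W.SmoothAt (w j) p.1.2) ∧
      ∀ᶠ y in 𝓝 x, ∀ q : Split y, ↑q.1.1 ⊆ U' → ↑q.1.2 ⊆ U'' →
        s y q = ∑ j, g j y • (v j q.1.1 ⊗ₜ[𝕜] w j q.1.2)

open Classical in
/-- The element `v ⊗ w` in the summand of `(V ⊠ W)ₓ` at the split `x = a ⊔ b`. -/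
def cauchyTmul {V W : PreBundle 𝕜 (UConf M)} {x a b : UConf M} (h : IsSplit x a b)
    (v : V.Fib a) (w : W.Fib b) : (cauchy d V W).Fib x :=
  DirectSum.lof 𝕜 (Split x) (fun p => V.Fib p.1.1 ⊗[𝕜] W.Fib p.1.2) ⟨(a, b), h⟩ (v ⊗ₜ[𝕜] w)

/-- The unit of the Cauchy tensor product: `𝕜` over the vacuum `∅`, zero elsewhere. -/
def cauchyUnit : PreBundle 𝕜 (UConf M) where
  Fib x := PLift (x = ∅) → 𝕜
  SmoothAt s x := ∃ g : UConf M → 𝕜, USmoothAt d g x ∧ ∀ᶠ y in 𝓝 x, s y = fun _ => g y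

/-- The extension `i_* V` of a bundle `V` on `M` by zero to `UConf M`, where `M` is identified with
the one-point configurations: its fibre is `V_y` over `{y}`, and zero elsewhere. -/
def extendZero (V : PreBundle 𝕜 M) : PreBundle 𝕜 (UConf M) where
  Fib x := ∀ y : {y : M // x = {y}}, V.Fib y.1
  SmoothAt s x := ∀ y : M, x = {y} → V.SmoothAt (fun z => s {z} ⟨z, rfl⟩) y

/-- The iterated Cauchy tensor power `W ⊠ (W ⊠ (⋯ ⊠ I))` with `n` factors `W`. -/
def cauchyPower (W : PreBundle 𝕜 (UConf M)) : ℕ → PreBundle 𝕜 (UConf M)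
  | 0 => cauchyUnit d
  | n + 1 => cauchy d W (cauchyPower W n)

/-! ### Monoids for the Cauchy tensor product -/

/-- The product `a • b` of two elements over disjoint configurations given by `m : A ⊠ A → A`. -/
def mulAt {A : PreBundle 𝕜 (UConf M)} (m : BundleHom (cauchy d A A) A) {x a b : UConf M}
    (h : IsSplit x a b) (u : A.Fib a) (v : A.Fib b) : A.Fib x :=
  m.toFun x (cauchyTmul d h u v)

/-- The element `1_∅` given by `e : I → A`. -/
def oneAt {A : PreBundle 𝕜 (UConf M)} (e : BundleHom (cauchyUnit d) A) : A.Fib ∅ :=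
  e.toFun ∅ (fun _ => (1 : 𝕜))

/-- The structure of a `⊠`-algebra (a monoid for the Cauchy tensor product) on `A`. -/
structure CauchyAlgebra (A : PreBundle 𝕜 (UConf M)) where
  mul : BundleHom (cauchy d A A) A
  one : BundleHom (cauchyUnit d) A
  assoc : ∀ {x a b c ab bc : UConf M} (hab : IsSplit ab a b) (hx : IsSplit x ab c)
    (hbc : IsSplit bc b c) (hx' : IsSplit x a bc) (u : A.Fib a) (v : A.Fib b) (w : A.Fib c),
    mulAt d mul hx (mulAt d mul hab u v) w = mulAt d mul hx' u (mulAt d mul hbc v w)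
  one_mul : ∀ {x : UConf M} (u : A.Fib x),
    mulAt d mul (IsSplit.left_empty x) (oneAt d one) u = u
  mul_one : ∀ {x : UConf M} (u : A.Fib x),
    mulAt d mul (IsSplit.left_empty x).symm u (oneAt d one) = u

variable {d}

/-- Commutativity with respect to the braiding `v ⊗ w ↦ w ⊗ v`. -/
def CauchyAlgebra.IsComm {A : PreBundle 𝕜 (UConf M)} (m : CauchyAlgebra d A) : Prop :=
  ∀ {x a b : UConf M} (h : IsSplit x a b) (u : A.Fib a) (v : A.Fib b),
    mulAt d m.mul h u v = mulAt d m.mul h.symm v u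

/-- The multiplication and the unit preserve the grading. -/
def CauchyAlgebra.IsGraded {A : PreBundle 𝕜 (UConf M)} (m : CauchyAlgebra d A)
    (G : BundleGrading A) : Prop :=
  oneAt d m.one ∈ G.part 0 ∅ ∧
  ∀ {x a b : UConf M} (h : IsSplit x a b) (i j : ℤ) (u : A.Fib a) (v : A.Fib b),
    u ∈ G.part i a → v ∈ G.part j b → mulAt d m.mul h u v ∈ G.part (i + j) x

/-- Commutativity with respect to the braiding `v ⊗ w ↦ (-1) ^ (deg v * deg w) w ⊗ v`. -/
def CauchyAlgebra.IsGradedComm {A : PreBundle 𝕜 (UConf M)} (m : CauchyAlgebra d A)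
    (G : BundleGrading A) : Prop :=
  m.IsGraded G ∧
  ∀ {x a b : UConf M} (h : IsSplit x a b) (i j : ℤ) (u : A.Fib a) (v : A.Fib b),
    u ∈ G.part i a → v ∈ G.part j b →
      mulAt d m.mul h u v = ((Int.negOnePow (i * j) : ℤˣ) : ℤ) • mulAt d m.mul h.symm v u

/-- Morphisms of `⊠`-algebra bundles. -/
def IsAlgebraHom {A B : PreBundle 𝕜 (UConf M)} (mA : CauchyAlgebra d A) (mB : CauchyAlgebra d B)
    (φ : BundleHom A B) : Prop :=
  (∀ {x a b : UConf M} (h : IsSplit x a b) (u : A.Fib a) (v : A.Fib b),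
    φ.toFun x (mulAt d mA.mul h u v) = mulAt d mB.mul h (φ.toFun a u) (φ.toFun b v)) ∧
  φ.toFun ∅ (oneAt d mA.one) = oneAt d mB.one

/-- `S`, with the bundle map `ι : W → S`, is the free commutative `⊠`-algebra bundle on `W`. -/
def IsFreeComm {W S : PreBundle 𝕜 (UConf M)} (mS : CauchyAlgebra d S) (ι : BundleHom W S) : Prop :=
  mS.IsComm ∧
  ∀ (A : PreBundle 𝕜 (UConf M)) (mA : CauchyAlgebra d A),
    A.IsVectorBundle (USmoothAt d) → mA.IsComm → ∀ f : BundleHom W A,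
      ∃! φ : BundleHom S A, IsAlgebraHom mS mA φ ∧
        ∀ (x : UConf M) (v : W.Fib x), φ.toFun x (ι.toFun x v) = f.toFun x v

/-- `S`, graded by `G`, with the bundle map `ι : W → S`, is the free graded-commutative
`⊠`-algebra bundle on `W`, where `W` is placed in degree one. -/
def IsFreeGradedComm {W S : PreBundle 𝕜 (UConf M)} (mS : CauchyAlgebra d S) (G : BundleGrading S)
    (ι : BundleHom W S) : Prop :=
  mS.IsGradedComm G ∧ (∀ (x : UConf M) (v : W.Fib x), ι.toFun x v ∈ G.part 1 x) ∧
  ∀ (A : PreBundle 𝕜 (UConf M)) (mA : CauchyAlgebra d A) (GA : BundleGrading A),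
    A.IsVectorBundle (USmoothAt d) → mA.IsGradedComm GA → ∀ f : BundleHom W A,
      (∀ (x : UConf M) (v : W.Fib x), f.toFun x v ∈ GA.part 1 x) →
      ∃! φ : BundleHom S A, IsAlgebraHom mS mA φ ∧
        (∀ (n : ℤ) (x : UConf M) (u : S.Fib x), u ∈ G.part n x → φ.toFun x u ∈ GA.part n x) ∧
        ∀ (x : UConf M) (v : W.Fib x), φ.toFun x (ι.toFun x v) = f.toFun x v

/-! ### The Cauchy tensor, symmetric and exterior bundles -/

/-- `x = p₁ ⊔ ⋯ ⊔ pₙ` is an ordered split of `x` into pairwise disjoint configurations. -/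
def IsMultisplit {M : Type u} {n : ℕ} (p : Fin n → UConf M) (x : UConf M) : Prop :=
  (Pairwise fun i j => Disjoint (p i) (p j)) ∧ ∀ y, y ∈ x ↔ ∃ i, y ∈ p i

theorem IsMultisplit.perm {M : Type u} {n : ℕ} {p : Fin n → UConf M} {x : UConf M}
    (h : IsMultisplit p x) (σ : Equiv.Perm (Fin n)) : IsMultisplit (fun i => p (σ i)) x :=
  ⟨fun _ _ hij => h.1 fun e => hij (σ.injective e), fun y => (h.2 y).trans
    ⟨fun ⟨i, hi⟩ => ⟨σ.symm i, by simpa using hi⟩, fun ⟨i, hi⟩ => ⟨σ i, hi⟩⟩⟩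

theorem IsMultisplit.single {M : Type u} (x : UConf M) :
    IsMultisplit (fun _ : Fin 1 => x) x :=
  ⟨fun i j hij => absurd (Subsingleton.elim i j) hij, fun y => by simp⟩

open Classical in
/-- The union of a finite family of configurations. -/
def unionOf {M : Type u} {n : ℕ} (p : Fin n → UConf M) : UConf M := Finset.univ.biUnion p

theorem IsMultisplit.head {M : Type u} {n : ℕ} {p : Fin (n + 1) → UConf M} {x : UConf M}
    (h : IsMultisplit p x) : IsSplit x (p 0) (unionOf fun i => p i.succ) := by
  refine ⟨?_, fun y => ?_⟩
  · simp only [unionOf, Finset.disjoint_biUnion_right]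
    exact fun i _ => h.1 (Fin.succ_ne_zero i).symm
  · simp [unionOf, h.2 y, Fin.exists_fin_succ]

theorem IsMultisplit.tail {M : Type u} {n : ℕ} {p : Fin (n + 1) → UConf M} {x : UConf M}
    (h : IsMultisplit p x) :
    IsMultisplit (fun i => p i.succ) (unionOf fun i : Fin n => p i.succ) :=
  ⟨fun _ _ hij => h.1 fun e => hij (Fin.succ_injective n e), fun y => by simp [unionOf]⟩

variable (d)

/-- The element `v₁ ⊗ ⋯ ⊗ vₙ` of the `n`-th Cauchy power of `W`, at the split
`x = p₁ ⊔ ⋯ ⊔ pₙ`, where `vᵢ ∈ W_{pᵢ}`. Such elements span the fibre. -/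
def word {W : PreBundle 𝕜 (UConf M)} : {n : ℕ} → {p : Fin n → UConf M} → {x : UConf M} →
    IsMultisplit p x → (∀ i, W.Fib (p i)) → (cauchyPower d W n).Fib x
  | 0, _, _, _, _ => fun _ => (1 : 𝕜)
  | _ + 1, _, _, h, v => cauchyTmul d h.head (v 0) (word h.tail fun i => v i.succ)

/-- The subspace of `(W^{⊠ n})ₓ` spanned by the `v - ε(σ) σ(v)`, where `σ ∈ Sₙ` and
`σ(v₁ ⊗ ⋯ ⊗ vₙ) = v_{σ(1)} ⊗ ⋯ ⊗ v_{σ(n)}`. -/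
def permRelations (W : PreBundle 𝕜 (UConf M)) {n : ℕ} (ε : Equiv.Perm (Fin n) →* ℤˣ)
    (x : UConf M) : Submodule 𝕜 ((cauchyPower d W n).Fib x) :=
  Submodule.span 𝕜 {u | ∃ (p : Fin n → UConf M) (h : IsMultisplit p x) (v : ∀ i, W.Fib (p i))
    (σ : Equiv.Perm (Fin n)),
    u = word d h v - ((ε σ : ℤˣ) : ℤ) • word d (h.perm σ) fun i => v (σ i)}

/-- The Cauchy tensor bundle `⨁ₙ (i_* V)^{⊠ n}`. -/
def cauchyTensorBundle (V : PreBundle 𝕜 M) : PreBundle 𝕜 (UConf M) :=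
  PreBundle.dsum fun n => cauchyPower d (extendZero V) n

/-- The quotient `⨁ₙ (i_* V)^{⊠ n} / Sₙ` by the actions of the symmetric groups twisted by `ε`. -/
def cauchyCoinvariants (ε : ∀ n, Equiv.Perm (Fin n) →* ℤˣ) (V : PreBundle 𝕜 M) :
    PreBundle 𝕜 (UConf M) :=
  PreBundle.dsum fun n =>
    (cauchyPower d (extendZero V) n).quotient (permRelations d (extendZero V) (ε n))

/-- The character of the permutation action: trivial. -/
def trivialCharacter (n : ℕ) : Equiv.Perm (Fin n) →* ℤˣ := 1

/-- The character of the signature action: the sign. -/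
def signCharacter (n : ℕ) : Equiv.Perm (Fin n) →* ℤˣ := Equiv.Perm.sign

/-- The Cauchy symmetric bundle. -/
abbrev cauchySymmetricBundle (V : PreBundle 𝕜 M) : PreBundle 𝕜 (UConf M) :=
  cauchyCoinvariants d trivialCharacter V

/-- The Cauchy exterior bundle. -/
abbrev cauchyExteriorBundle (V : PreBundle 𝕜 M) : PreBundle 𝕜 (UConf M) :=
  cauchyCoinvariants d signCharacter V

/-- The canonical projection of the Cauchy tensor bundle to its coinvariants. -/
def toCoinvariants (ε : ∀ n, Equiv.Perm (Fin n) →* ℤˣ) (V : PreBundle 𝕜 M) :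
    BundleHom (cauchyTensorBundle d V) (cauchyCoinvariants d ε V) where
  toFun x := DirectSum.lmap fun n => (permRelations d (extendZero V) (ε n) x).mkQ
  smooth s _ hs n :=
    ⟨fun y => DFunLike.coe (F := ⨁ n, (cauchyPower d (extendZero V) n).Fib y) (s y) n, hs n,
      Filter.Eventually.of_forall fun _ => rfl⟩

/-- The inclusion of the `n`-th Cauchy power in the Cauchy tensor bundle. -/
def ofPower (V : PreBundle 𝕜 M) (n : ℕ) (x : UConf M) :
    (cauchyPower d (extendZero V) n).Fib x →ₗ[𝕜] (cauchyTensorBundle d V).Fib x :=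
  DirectSum.lof 𝕜 ℕ (fun n => (cauchyPower d (extendZero V) n).Fib x) n

/-- The inclusion `i_* V → T(V)` onto the words of length one. -/
def generator (V : PreBundle 𝕜 M) (x : UConf M) (v : (extendZero V).Fib x) :
    (cauchyTensorBundle d V).Fib x :=
  ofPower d V 1 x (word d (IsMultisplit.single x) fun _ => v)

variable {d}

/-- The algebra structure on the Cauchy tensor bundle whose multiplication is the concatenation
`(v₁ ⊗ ⋯ ⊗ vₖ) • (vₖ₊₁ ⊗ ⋯ ⊗ vₖ₊ₗ) = v₁ ⊗ ⋯ ⊗ vₖ₊ₗ` and whose unit is the inclusion of the unit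
bundle as the `0`-th power. -/
def CauchyAlgebra.IsConcatenation {V : PreBundle 𝕜 M}
    (m : CauchyAlgebra d (cauchyTensorBundle d V)) : Prop :=
  (∀ (k l : ℕ) (p : Fin (k + l) → UConf M) (v : ∀ i, (extendZero V).Fib (p i)) (x a b : UConf M)
    (h : IsSplit x a b) (hx : IsMultisplit p x)
    (ha : IsMultisplit (fun i => p (Fin.castAdd l i)) a)
    (hb : IsMultisplit (fun j => p (Fin.natAdd k j)) b),
    mulAt d m.mul h (ofPower d V k a (word d ha fun i => v (Fin.castAdd l i)))
        (ofPower d V l b (word d hb fun j => v (Fin.natAdd k j))) =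
      ofPower d V (k + l) x (word d hx v)) ∧
  ∀ (x : UConf M) (c : (cauchyUnit (𝕜 := 𝕜) d).Fib x), m.one.toFun x c = ofPower d V 0 x c

end Cauchy

end

/-! The bundle `extendZero V` is supported on one-point configurations, so its `n`-th Cauchy power
vanishes over `x` unless `x` has `n` points (`power_eq_zero`). Over an `n`-point configuration only
words of length `n` survive: the fibre is the sum, over the `n!` orderings of the points, of the
tensor products of the fibres of `V`. The symmetric group permutes these summands simply
transitively, so its coinvariants, twisted by a character or not, are isomorphic to any one summand.
Disjoint neighbourhoods `Uᵢ` of the points order all nearby configurations consistently. Frames of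
`V` over the `Uᵢ` then give a local frame (`coinvFrame`), and the sums over permutations
`twistedCoef` descend to dual coordinates (`coinvCoord`). This yields `isVectorBundle_coinv`.

The symmetric and the exterior case are treated together. `IsCharacterFamily ε e` keeps the two
facts about the character that matter: its value `e` on adjacent transpositions and its
multiplicativity on block permutations. The latter makes the relations a two-sided ideal, so that
concatenation descends (`coinvMul`).

For the universal property, a bundle map extends to tensors by multiplying the images of letters
(`tensorHom`), and it must be seen to kill the relations. The product is only defined over disjoint
configurations, so elements are replaced by left multiplication operators on the space of all
set-theoretic sections. The image of a word is then a product in an ordinary ring, applied to the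
unit (`map_listWord`), and the sign rule for reordering such a product reduces to adjacent
transpositions (`IsCharacterFamily.prod_ofFn_perm`). The same argument, applied to the projection
from tensors, deduces the commutativity of the coinvariants from words of two letters
(`map_mul_eq`).

Smoothness of maps out of a Cauchy product rests on `exists_eq_sum_csec`: near `x`, smooth sections
are combinations of products of a section at `y ∩ U` with a section at `y \ U`, where the frontier
of `U` avoids `x`. Since the number of points is locally constant, only one tensor length matters
near `x`, and the grading projections are locally the identity or zero. -/

noncomputable section

/-! ### Topology and smooth functions on configuration spaces -/

section Topology

variable {M : Type u}

theorem mem_unorder {k : ℕ} {w : Fin k → M} {y : M} : y ∈ unorder w ↔ ∃ i, w i = y := by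
  simp [unorder]

theorem card_unorder {k : ℕ} {w : Fin k → M} (hw : Function.Injective w) :
    (unorder w).card = k := by
  classical
  have : unorder w = Finset.univ.map ⟨w, hw⟩ := by
    ext y; simp [mem_unorder]
  rw [this]; simp

theorem exists_unorder_eq (x : UConf M) :
    ∃ w : Fin x.card → M, Function.Injective w ∧ unorder w = x := by
  refine ⟨fun i => (x.equivFin.symm i : M), fun i j h => ?_, ?_⟩
  · exact x.equivFin.symm.injective (Subtype.ext h)
  · ext y
    simp only [mem_unorder]
    constructor
    · rintro ⟨i, rfl⟩; exact (x.equivFin.symm i).2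
    · intro hy; exact ⟨x.equivFin ⟨y, hy⟩, by simp⟩

theorem exists_perm_of_unorder_eq {k : ℕ} {w w' : Fin k → M}
    (hw' : Function.Injective w') (h : unorder w' = unorder w) :
    ∃ σ : Equiv.Perm (Fin k), w' = w ∘ σ := by
  have h1 : ∀ i, ∃ j, w j = w' i := fun i => by
    rw [← mem_unorder, ← h, mem_unorder]; exact ⟨i, rfl⟩
  choose f hf using h1
  have hinj : Function.Injective f := fun i j hij => hw' (by rw [← hf, ← hf, hij])
  exact ⟨Equiv.ofBijective f (Finite.injective_iff_bijective.mp hinj), by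
    ext i; simp [hf]⟩

open Classical in
/-- The part of a configuration inside `U`. -/
def restr (U : Set M) (x : UConf M) : UConf M := x.filter (· ∈ U)

@[simp] theorem mem_restr {U : Set M} {x : UConf M} {a : M} : a ∈ restr U x ↔ a ∈ x ∧ a ∈ U := by
  simp [restr]

theorem restr_subset (U : Set M) (x : UConf M) : restr U x ⊆ x := fun _ ha => (mem_restr.1 ha).1

theorem isSplit_restr (U : Set M) (x : UConf M) : IsSplit x (restr U x) (restr Uᶜ x) := by
  refine ⟨Finset.disjoint_left.2 fun a ha hb => ?_, fun y => ?_⟩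
  · exact (mem_restr.1 hb).2 (mem_restr.1 ha).2
  · simp only [mem_restr, ← and_or_left, Set.mem_compl_iff]
    exact ⟨fun h => ⟨h, em _⟩, fun h => h.1⟩

variable [TopologicalSpace M]

/-- The saturation of an open set is the union of its translates under the symmetric group, each of
which is open. -/
theorem isOpenMap_unorder :
    IsOpenMap (fun w : Σ k, OConf M k => (unorder w.2.1 : UConf M)) := by
  intro O hO
  rw [isOpen_coinduced, isOpen_sigma_iff]
  intro k
  have : ((Sigma.mk k : OConf M k → Σ k, OConf M k) ⁻¹'
      ((fun w : Σ k, OConf M k => (unorder w.2.1 : UConf M)) ⁻¹'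
      ((fun w : Σ k, OConf M k => (unorder w.2.1 : UConf M)) '' O))) =
      ⋃ σ : Equiv.Perm (Fin k), (fun w : OConf M k =>
        (⟨w.1 ∘ σ, w.2.comp σ.injective⟩ : OConf M k)) ⁻¹'
          ((Sigma.mk k : OConf M k → Σ k, OConf M k) ⁻¹' O) := by
    ext w
    simp only [Set.mem_preimage, Set.mem_image, Set.mem_iUnion]
    constructor
    · rintro ⟨⟨l, w'⟩, hw'O, h⟩
      have hl : l = k := by rw [← card_unorder w'.2, ← card_unorder w.2]; exact congrArg _ h
      subst hl
      obtain ⟨σ, hσ⟩ := exists_perm_of_unorder_eq w'.2 h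
      refine ⟨σ, ?_⟩
      convert hw'O
      exact hσ.symm
    · rintro ⟨σ, hσ⟩
      refine ⟨_, hσ, ?_⟩
      ext y
      simp only [mem_unorder, Function.comp]
      exact ⟨fun ⟨i, hi⟩ => ⟨σ i, hi⟩, fun ⟨i, hi⟩ => ⟨σ.symm i, by simpa using hi⟩⟩
  rw [this]
  refine isOpen_iUnion fun σ => (hO.preimage continuous_sigmaMk).preimage ?_
  have hv : Continuous fun w : OConf M k => w.1 := continuous_subtype_val
  exact Continuous.subtype_mk (continuous_pi fun i => (continuous_apply (σ i)).comp hv) _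

theorem isOpen_injective [T2Space M] (k : ℕ) : IsOpen {w : Fin k → M | Function.Injective w} := by
  have : {w : Fin k → M | Function.Injective w} =
      ⋂ (i : Fin k) (j : Fin k) (_ : i ≠ j), {w | w i ≠ w j} := by
    ext w
    simp only [Set.mem_ofPred_eq, Set.mem_iInter, Function.Injective]
    exact ⟨fun h i j hij e => hij (h e), fun h i j e => by_contra fun hij => h i j hij e⟩
  rw [this]
  refine isOpen_iInter_of_finite fun i => isOpen_iInter_of_finite fun j =>
    isOpen_iInter_of_finite fun _ => ?_
  exact isOpen_ne_fun (continuous_apply i) (continuous_apply j)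

/-- Turns eventual statements about configurations into statements about tuples. Injective tuples
form an open set because `M` is Hausdorff, so the filter can be taken in the whole power of `M`. -/
theorem nhds_unorder [T2Space M] {k : ℕ} {w : Fin k → M} (hw : Function.Injective w) :
    𝓝 (unorder w : UConf M) = Filter.map unorder (𝓝 w) := by
  have h1 := isOpenMap_unorder.map_nhds_eq
    (f := fun w : Σ k, OConf M k => (unorder w.2.1 : UConf M)) (x := ⟨k, ⟨w, hw⟩⟩)
    (Continuous.continuousAt continuous_coinduced_rng)
  have h2 : Filter.map Subtype.val (𝓝 (⟨w, hw⟩ : OConf M k)) = 𝓝 w :=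
    (isOpen_injective k).isOpenEmbedding_subtypeVal.map_nhds_eq _
  rw [← h2, ← h1, Sigma.nhds_mk, Filter.map_map, Filter.map_map]
  rfl

theorem eventually_card_eq [T2Space M] (x : UConf M) : ∀ᶠ y in 𝓝 x, y.card = x.card := by
  obtain ⟨w, hw, hx⟩ := exists_unorder_eq x
  rw [← hx, nhds_unorder hw, Filter.eventually_map, hx]
  filter_upwards [(isOpen_injective _).mem_nhds hw] with w' hw'
  exact card_unorder hw'

theorem eventually_forall_mem [T2Space M] {x : UConf M} {U : Set M}
    (hU : ∀ a ∈ x, U ∈ 𝓝 a) :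
    ∀ᶠ y in 𝓝 x, ∀ a ∈ y, a ∈ U := by
  obtain ⟨w, hw, hx⟩ := exists_unorder_eq x
  rw [← hx, nhds_unorder hw, Filter.eventually_map]
  have : ∀ᶠ w' in 𝓝 w, ∀ i, w' i ∈ U := Filter.eventually_all.2 fun i =>
    (continuous_apply i).continuousAt (hU _ (by rw [← hx, mem_unorder]; exact ⟨i, rfl⟩))
  filter_upwards [this] with w' hw' a ha
  obtain ⟨i, rfl⟩ := mem_unorder.1 ha
  exact hw' i

theorem eventually_exists_mem [T2Space M] {x : UConf M} {a : M} (ha : a ∈ x) {U : Set M}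
    (hU : U ∈ 𝓝 a) :
    ∀ᶠ y in 𝓝 x, ∃ b ∈ y, b ∈ U := by
  obtain ⟨w, hw, hx⟩ := exists_unorder_eq x
  rw [← hx, mem_unorder] at ha
  obtain ⟨i, rfl⟩ := ha
  rw [← hx, nhds_unorder hw, Filter.eventually_map]
  filter_upwards [(continuous_apply i).continuousAt hU] with w' hw'
  exact ⟨_, mem_unorder.2 ⟨i, rfl⟩, hw'⟩

/-- Matches the points of a nearby `y` with those of `x`; this transports splits between them in
`exists_eq_sum_csec`. -/
theorem eventually_existsUnique_mem [T2Space M] {x : UConf M} {U : M → Set M}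
    (hU : ∀ a ∈ x, U a ∈ 𝓝 a)
    (hd : ∀ a ∈ x, ∀ b ∈ x, a ≠ b → Disjoint (U a) (U b)) :
    ∀ᶠ y in 𝓝 x, (∀ b ∈ y, ∃ a ∈ x, b ∈ U a) ∧ ∀ a ∈ x, ∃! b, b ∈ y ∧ b ∈ U a := by
  obtain ⟨w, hw, hx⟩ := exists_unorder_eq x
  have hwx : ∀ i, w i ∈ x := fun i => by rw [← hx, mem_unorder]; exact ⟨i, rfl⟩
  suffices h : ∀ᶠ y in 𝓝 (unorder w), (∀ b ∈ y, ∃ a ∈ x, b ∈ U a) ∧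
      ∀ a ∈ x, ∃! b, b ∈ y ∧ b ∈ U a by rwa [hx] at h
  rw [nhds_unorder hw, Filter.eventually_map]
  have : ∀ᶠ w' in 𝓝 w, ∀ i, w' i ∈ U (w i) := Filter.eventually_all.2 fun i =>
    (continuous_apply i).continuousAt (hU _ (hwx i))
  filter_upwards [this] with w' hw'
  refine ⟨fun b hb => ?_, fun a ha => ?_⟩
  · obtain ⟨i, rfl⟩ := mem_unorder.1 hb
    exact ⟨w i, hwx i, hw' i⟩
  · obtain ⟨i, rfl⟩ := mem_unorder.1 (hx.symm ▸ ha : a ∈ unorder w)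
    refine ⟨w' i, ⟨mem_unorder.2 ⟨i, rfl⟩, hw' i⟩, ?_⟩
    rintro b ⟨hb, hbU⟩
    obtain ⟨j, rfl⟩ := mem_unorder.1 hb
    by_contra hne
    have hij : w i ≠ w j := fun e => hne (by rw [hw e])
    exact (Set.disjoint_left.1 (hd _ (hwx i) _ (hwx j) hij)) hbU (hw' j)

/-- The finite set `x` is disjoint from the frontier of `U`. -/
def CleanAt (U : Set M) (x : UConf M) : Prop := ∀ a ∈ x, U ∈ 𝓝 a ∨ Uᶜ ∈ 𝓝 a

theorem CleanAt.compl {U : Set M} {x : UConf M} (h : CleanAt U x) : CleanAt Uᶜ x :=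
  fun a ha => (h a ha).symm.imp_right fun h => by rwa [compl_compl]

theorem CleanAt.mono {U : Set M} {x y : UConf M} (h : CleanAt U x) (hy : y ⊆ x) : CleanAt U y :=
  fun a ha => h a (hy ha)

/-- Near a point where `U` is clean, the part in `U` is given by forgetting some of the points. -/
theorem exists_restr_unorder {k : ℕ} {w : Fin k → M} {U : Set M} (hU : CleanAt U (unorder w)) :
    ∃ (j : ℕ) (f : Fin j → Fin k), Function.Injective f ∧
      ∀ᶠ w' in 𝓝 w, restr U (unorder w') = unorder (w' ∘ f) := by
  classical
  let s : Finset (Fin k) := Finset.univ.filter fun i => w i ∈ U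
  obtain ⟨f, hf, hs⟩ := exists_unorder_eq s
  refine ⟨_, f, hf, ?_⟩
  have hmem : ∀ i, (∃ j, f j = i) ↔ w i ∈ U := fun i => by
    rw [← mem_unorder, hs]; simp [s]
  have : ∀ᶠ w' in 𝓝 w, ∀ i, (w' i ∈ U ↔ w i ∈ U) := Filter.eventually_all.2 fun i => by
    rcases hU (w i) (mem_unorder.2 ⟨i, rfl⟩) with h | h
    · filter_upwards [(continuous_apply i).continuousAt h] with w' hw'
      exact ⟨fun _ => mem_of_mem_nhds h, fun _ => hw'⟩
    · filter_upwards [(continuous_apply i).continuousAt h] with w' hw'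
      exact ⟨fun h1 => absurd h1 hw', fun h1 => absurd h1 (mem_of_mem_nhds h)⟩
  filter_upwards [this] with w' hw'
  ext y
  simp only [mem_restr, mem_unorder, Function.comp]
  constructor
  · rintro ⟨⟨i, rfl⟩, hi⟩
    obtain ⟨j, rfl⟩ := (hmem i).2 ((hw' i).1 hi)
    exact ⟨j, rfl⟩
  · rintro ⟨j, rfl⟩
    exact ⟨⟨_, rfl⟩, (hw' _).2 ((hmem _).1 ⟨j, rfl⟩)⟩

theorem tendsto_restr [T2Space M] {x : UConf M} {U : Set M} (hU : CleanAt U x) :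
    Filter.Tendsto (restr U) (𝓝 x) (𝓝 (restr U x)) := by
  obtain ⟨w, hw, hx⟩ := exists_unorder_eq x
  -- The length of the tuple depends on `x`, so it is generalized before `x` is replaced by `unorder
  -- w`.
  revert w
  generalize x.card = k
  rintro w hw rfl
  obtain ⟨j, f, hf, he⟩ := exists_restr_unorder hU
  rw [he.self_of_nhds, nhds_unorder hw, nhds_unorder (hw.comp hf), Filter.tendsto_map'_iff]
  refine Filter.Tendsto.congr' (f₁ := unorder ∘ (· ∘ f)) (he.mono fun _ h => h.symm) ?_
  refine Filter.Tendsto.comp Filter.tendsto_map ?_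
  exact Continuous.tendsto (continuous_pi fun i => continuous_apply _) w

theorem eventually_restr [T2Space M] {x : UConf M} {U : Set M} (hU : CleanAt U x)
    {P : UConf M → Prop}
    (h : ∀ᶠ y in 𝓝 (restr U x), P y) : ∀ᶠ y in 𝓝 x, P (restr U y) :=
  tendsto_restr hU h

theorem exists_separating [T2Space M] (x : UConf M) : ∃ U : M → Set M,
    (∀ a, a ∈ U a ∧ IsOpen (U a)) ∧
    ∀ a ∈ x, ∀ b ∈ x, a ≠ b → Disjoint (U a) (U b) := by
  obtain ⟨U, hU, hd⟩ := x.finite_toSet.t2_separation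
  exact ⟨U, hU, fun a ha b hb hab => hd ha hb hab⟩

end Topology

/-! ### Smooth scalar functions on configurations. -/

section Smooth

variable {𝕜 : Type u} [RCLike 𝕜] {d : ℕ} {M : Type u} [TopologicalSpace M]
  [ChartedSpace (EuclideanSpace ℝ (Fin d)) M]

/-- In product charts, reindexing is a linear map wherever all coordinates lie in the targets of the
charts. -/
theorem contMDiffAt_pi_comp {k j : ℕ} (f : Fin j → Fin k) (w : Fin k → M) :
    ContMDiffAt (ModelWithCorners.pi fun _ : Fin k => 𝓡 d)
      (ModelWithCorners.pi fun _ : Fin j => 𝓡 d) ∞ (fun w' : Fin k → M => w' ∘ f) w := by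
  rw [contMDiffAt_iff]
  refine ⟨(continuous_pi fun i => continuous_apply _).continuousAt, ?_⟩
  have hlin : ContDiff ℝ ∞ (fun v : Fin k → EuclideanSpace ℝ (Fin d) => v ∘ f) :=
    contDiff_pi.2 fun i => contDiff_apply ℝ _ (f i)
  refine hlin.contDiffAt.contDiffWithinAt.congr_of_eventuallyEq_of_mem ?_ ⟨_, rfl⟩
  have : ∀ᶠ v in 𝓝 (extChartAt (ModelWithCorners.pi fun _ : Fin k => 𝓡 d) w w),
      ∀ i, v i ∈ (extChartAt (𝓡 d) (w i)).target := by
    refine Filter.eventually_all.2 fun i => (continuous_apply i).continuousAt ?_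
    exact extChartAt_target_mem_nhds (I := 𝓡 d) (w i)
  refine Filter.Eventually.filter_mono nhdsWithin_le_nhds ?_
  filter_upwards [this] with v hv
  ext1 i
  exact (extChartAt (𝓡 d) (w (f i))).right_inv (hv (f i))

theorem contMDiffAt_pi_apply {k : ℕ} (i : Fin k) (w : Fin k → M) :
    ContMDiffAt (ModelWithCorners.pi fun _ : Fin k => 𝓡 d) (𝓡 d) ∞
      (fun w' : Fin k → M => w' i) w := by
  rw [contMDiffAt_iff]
  refine ⟨(continuous_apply _).continuousAt, ?_⟩
  have hlin : ContDiff ℝ ∞ (fun v : Fin k → EuclideanSpace ℝ (Fin d) => v i) :=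
    contDiff_apply ℝ _ i
  refine hlin.contDiffAt.contDiffWithinAt.congr_of_eventuallyEq_of_mem ?_ ⟨_, rfl⟩
  have : ∀ᶠ v in 𝓝 (extChartAt (ModelWithCorners.pi fun _ : Fin k => 𝓡 d) w w),
      v i ∈ (extChartAt (𝓡 d) (w i)).target :=
    (continuous_apply i).continuousAt (extChartAt_target_mem_nhds (I := 𝓡 d) (w i))
  refine Filter.Eventually.filter_mono nhdsWithin_le_nhds ?_
  filter_upwards [this] with v hv
  exact (extChartAt (𝓡 d) (w i)).right_inv hv

theorem USmoothAt.const (c : 𝕜) (x : UConf M) : USmoothAt d (fun _ => c) x :=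
  fun _ _ _ => contMDiffAt_const

theorem USmoothAt.add {f g : UConf M → 𝕜} {x : UConf M} (hf : USmoothAt d f x)
    (hg : USmoothAt d g x) : USmoothAt d (fun y => f y + g y) x :=
  fun k w h => (hf k w h).add (hg k w h)

theorem USmoothAt.mul {f g : UConf M → 𝕜} {x : UConf M} (hf : USmoothAt d f x)
    (hg : USmoothAt d g x) : USmoothAt d (fun y => f y * g y) x := by
  intro k w h
  have := (contDiff_mul (𝕜 := ℝ) (𝔸 := 𝕜) (n := ∞)).contMDiff.contMDiffAt.comp w.1
    ((hf k w h).prodMk_space (hg k w h))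
  exact this

theorem USmoothAt.sum {ι : Type*} (s : Finset ι) {f : ι → UConf M → 𝕜} {x : UConf M}
    (hf : ∀ i ∈ s, USmoothAt d (f i) x) : USmoothAt d (fun y => ∑ i ∈ s, f i y) x := by
  classical
  induction s using Finset.induction_on with
  | empty => simpa using USmoothAt.const 0 x
  | insert a s ha ih =>
    simp only [Finset.sum_insert ha]
    exact (hf a (by simp)).add (ih fun i hi => hf i (by simp [hi]))

theorem USmoothAt.congr [T2Space M] {f g : UConf M → 𝕜} {x : UConf M} (hf : USmoothAt d f x)
    (h : ∀ᶠ y in 𝓝 x, g y = f y) : USmoothAt d g x := by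
  rintro k w rfl
  rw [nhds_unorder w.2, Filter.eventually_map] at h
  exact (hf k w rfl).congr_of_eventuallyEq h

/-- Lifted to tuples, `restr U` locally forgets a fixed set of coordinates, which is smooth by
`contMDiffAt_pi_comp`. -/
theorem USmoothAt.comp_restr [T2Space M] {c : UConf M → 𝕜} {x : UConf M} {U : Set M}
    (hU : CleanAt U x) (hc : USmoothAt d c (restr U x)) : USmoothAt d (fun y => c (restr U y)) x := by
  rintro k ⟨w, hw⟩ rfl
  obtain ⟨j, f, hf, he⟩ := exists_restr_unorder hU
  have h1 := hc j ⟨w ∘ f, hw.comp hf⟩ he.self_of_nhds.symm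
  have h2 := ContMDiffAt.comp w h1 (contMDiffAt_pi_comp (d := d) f w)
  exact h2.congr_of_eventuallyEq (he.mono fun w' hw' => congrArg c hw')

theorem USmoothAt.of_singleton [T2Space M] {c : M → 𝕜} {g : UConf M → 𝕜} {a : M}
    (hc : MSmoothAt d c a)
    (h : ∀ᶠ z in 𝓝 a, g {z} = c z) : USmoothAt d g {a} := by
  rintro k ⟨w, hw⟩ hwa
  have hk : k = 1 := by rw [← card_unorder hw, hwa, Finset.card_singleton]
  subst hk
  have h0 : ∀ w : Fin 1 → M, unorder w = {w 0} := fun w => by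
    ext y; simp [mem_unorder, eq_comm]
  have hw0 : w 0 = a := by rw [h0] at hwa; simpa using hwa
  subst hw0
  have h2 := ContMDiffAt.comp (I' := 𝓡 d) (g := c) (f := fun w' : Fin 1 → M => w' 0) w hc
    (contMDiffAt_pi_apply (d := d) 0 w)
  refine h2.congr_of_eventuallyEq ?_
  filter_upwards [(continuous_apply (0 : Fin 1)).continuousAt h] with w' hw'
  rw [h0]; exact hw'

end Smooth

/-! ### Smooth sections -/

section Splits

variable {M : Type u}

theorem IsSplit.eq_of_left {x a b b' : UConf M} (h : IsSplit x a b) (h' : IsSplit x a b') :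
    b = b' := by
  have key : ∀ {b b' : UConf M}, IsSplit x a b → IsSplit x a b' → b ⊆ b' := fun h h' y hy =>
    (((h'.2 y).1 ((h.2 y).2 (Or.inr hy))).resolve_left
      fun hya => (Finset.disjoint_left.1 h.1 hya hy))
  exact Finset.Subset.antisymm (key h h') (key h' h)

theorem IsSplit.eq_restr {x a b : UConf M} (h : IsSplit x a b) {U : Set M}
    (ha : ∀ y ∈ a, y ∈ U) (hb : ∀ y ∈ b, y ∉ U) : a = restr U x := by
  ext y
  rw [mem_restr, h.2]
  exact ⟨fun hy => ⟨Or.inl hy, ha y hy⟩, fun hy => hy.1.resolve_right fun h' => hb y h' hy.2⟩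

theorem IsSplit.left_subset {x a b : UConf M} (h : IsSplit x a b) : a ⊆ x :=
  fun y hy => (h.2 y).2 (Or.inl hy)

/-- A split is determined by its first part, a subset of `x`. -/
instance (x : UConf M) : Finite (Split x) :=
  Finite.of_injective (β := {a : UConf M // a ∈ x.powerset})
    (fun p => ⟨p.1.1, Finset.mem_powerset.2 p.2.left_subset⟩) fun p q h => by
      have h1 : p.1.1 = q.1.1 := congrArg Subtype.val h
      have h2 := p.2
      rw [h1] at h2
      exact Subtype.ext (Prod.ext h1 (h2.eq_of_left q.2))

end Splits

section Sections

variable {𝕜 : Type u} [RCLike 𝕜] {d : ℕ} {M : Type u} [TopologicalSpace M]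
  [ChartedSpace (EuclideanSpace ℝ (Fin d)) M]

/-- Smooth sections form a sheaf of modules over the smooth functions. -/
structure IsSmoothModule (d : ℕ) {M : Type u} [TopologicalSpace M]
    [ChartedSpace (EuclideanSpace ℝ (Fin d)) M] (V : PreBundle 𝕜 (UConf M)) : Prop where
  zero : ∀ x, V.SmoothAt (fun _ => 0) x
  add : ∀ {s t x}, V.SmoothAt s x → V.SmoothAt t x → V.SmoothAt (fun y => s y + t y) x
  smul : ∀ {g : UConf M → 𝕜} {s x}, USmoothAt d g x → V.SmoothAt s x →
    V.SmoothAt (fun y => g y • s y) x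
  congr : ∀ {s t x}, V.SmoothAt s x → (∀ᶠ y in 𝓝 x, t y = s y) → V.SmoothAt t x

theorem IsSmoothModule.sum {V : PreBundle 𝕜 (UConf M)} (hV : IsSmoothModule d V) {ι : Type*}
    (t : Finset ι) {s : ι → ∀ y, V.Fib y} {x : UConf M} (hs : ∀ i ∈ t, V.SmoothAt (s i) x) :
    V.SmoothAt (fun y => ∑ i ∈ t, s i y) x := by
  classical
  induction t using Finset.induction_on with
  | empty => simpa using hV.zero x
  | insert a t ha ih =>
    simp only [Finset.sum_insert ha]
    exact hV.add (hs a (by simp)) (ih fun i hi => hs i (by simp [hi]))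

/-- The only consequence of local triviality that the universal properties use about the target
algebra. -/
theorem PreBundle.IsVectorBundle.isSmoothModule [T2Space M] {V : PreBundle 𝕜 (UConf M)}
    (hV : V.IsVectorBundle (USmoothAt d)) : IsSmoothModule d V := by
  refine ⟨fun x => ?_, fun {s t x} hs ht => ?_, fun {g s x} hg hs => ?_, fun {s t x} hs h => ?_⟩
  all_goals
    obtain ⟨n, e, he⟩ := hV x
    have h2 := he.self_of_nhds.2
  · exact (h2 _).2 ⟨fun _ _ => 0, fun _ => USmoothAt.const 0 x, by simp⟩
  · obtain ⟨c, hc, hc'⟩ := (h2 _).1 hs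
    obtain ⟨b, hb, hb'⟩ := (h2 _).1 ht
    refine (h2 _).2 ⟨fun i y => c i y + b i y, fun i => (hc i).add (hb i), ?_⟩
    filter_upwards [hc', hb'] with z h1 h2
    simp [h1, h2, add_smul, Finset.sum_add_distrib]
  · obtain ⟨c, hc, hc'⟩ := (h2 _).1 hs
    refine (h2 _).2 ⟨fun i y => g y * c i y, fun i => hg.mul (hc i), ?_⟩
    filter_upwards [hc'] with z h1
    simp [h1, mul_smul, Finset.smul_sum]
  · obtain ⟨c, hc, hc'⟩ := (h2 _).1 hs
    refine (h2 _).2 ⟨c, hc, ?_⟩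
    filter_upwards [hc', h] with z h1 h2
    rw [h2, h1]

theorem isSmoothModule_dsum {P : ℕ → PreBundle 𝕜 (UConf M)} (hP : ∀ n, IsSmoothModule d (P n)) :
    IsSmoothModule d (PreBundle.dsum P) where
  zero x n := (hP n).zero x
  add hs ht n := (hP n).add (hs n) (ht n)
  smul hg hs n := (hP n).smul hg (hs n)
  congr hs h n := (hP n).congr (hs n) (h.mono fun y hy => by rw [hy])

theorem isSmoothModule_quotient {V : PreBundle 𝕜 (UConf M)} (hV : IsSmoothModule d V)
    (N : ∀ x, Submodule 𝕜 (V.Fib x)) : IsSmoothModule d (V.quotient N) where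
  zero x := ⟨fun _ => 0, hV.zero x, Filter.Eventually.of_forall fun y => (map_zero _).symm⟩
  add := by
    rintro s t x ⟨s', hs, hs'⟩ ⟨t', ht, ht'⟩
    refine ⟨_, hV.add hs ht, ?_⟩
    filter_upwards [hs', ht'] with y h1 h2
    rw [h1, h2, map_add]
    rfl
  smul := by
    rintro g s x hg ⟨s', hs, hs'⟩
    refine ⟨_, hV.smul hg hs, ?_⟩
    filter_upwards [hs'] with y h1
    rw [h1, map_smul]
    rfl
  congr := by
    rintro s t x ⟨s', hs, hs'⟩ h
    refine ⟨s', hs, ?_⟩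
    filter_upwards [hs', h] with y h1 h2
    rw [h2, h1]

theorem isSmoothModule_cauchyUnit : IsSmoothModule d (cauchyUnit (𝕜 := 𝕜) (M := M) d) where
  zero x := ⟨fun _ => 0, USmoothAt.const 0 x, Filter.Eventually.of_forall fun y => rfl⟩
  add := by
    rintro s t x ⟨s', hs, hs'⟩ ⟨t', ht, ht'⟩
    refine ⟨_, hs.add ht, ?_⟩
    filter_upwards [hs', ht'] with y h1 h2
    rw [h1, h2]; rfl
  smul := by
    rintro g s x hg ⟨s', hs, hs'⟩
    refine ⟨_, hg.mul hs, ?_⟩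
    filter_upwards [hs'] with y h1
    rw [h1]; rfl
  congr := by
    rintro s t x ⟨s', hs, hs'⟩ h
    refine ⟨s', hs, ?_⟩
    filter_upwards [hs', h] with y h1 h2
    rw [h2, h1]

theorem isSmoothModule_cauchy [T2Space M] (V W : PreBundle 𝕜 (UConf M)) :
    IsSmoothModule d (cauchy d V W) where
  zero x p := by
    -- Even the empty sum requires disjoint open sets around the two parts; unions of separating
    -- neighbourhoods serve.
    obtain ⟨O, hO, hd⟩ := exists_separating x
    refine ⟨⋃ e ∈ p.1.1, O e, ⋃ e ∈ p.1.2, O e, isOpen_biUnion fun e _ => (hO e).2,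
      isOpen_biUnion fun e _ => (hO e).2, ?_, fun e he => Set.mem_biUnion he (hO e).1,
      fun e he => Set.mem_biUnion he (hO e).1, 0, nofun, nofun, nofun, nofun,
      Filter.Eventually.of_forall fun y q _ _ => rfl⟩
    simp only [Set.disjoint_iUnion_left, Set.disjoint_iUnion_right]
    exact fun e he e' he' => hd _ (p.2.left_subset he') _ (p.2.symm.left_subset he) fun h =>
      Finset.disjoint_left.1 p.2.1 he' (h ▸ he)
  add := by
    intro s t x hs ht p
    obtain ⟨U₁, U₂, hU₁, hU₂, hd, ha, hb, n, g, v, w, hg, he⟩ := hs p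
    obtain ⟨U₁', U₂', hU₁', hU₂', hd', ha', hb', n', g', v', w', hg', he'⟩ := ht p
    refine ⟨U₁ ∩ U₁', U₂ ∩ U₂', hU₁.inter hU₁', hU₂.inter hU₂',
      hd.mono Set.inter_subset_left Set.inter_subset_left, Set.subset_inter ha ha',
      Set.subset_inter hb hb', n + n', Fin.append g g', Fin.append v v', Fin.append w w',
      fun j => ?_, ?_⟩
    · refine Fin.addCases (fun j => ?_) (fun j => ?_) j
      · simpa using hg j
      · simpa using hg' j
    · filter_upwards [he, he'] with y h1 h2 q hq hq'
      rw [Fin.sum_univ_add]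
      simp only [Fin.append_left, Fin.append_right]
      rw [← h1 q (hq.trans Set.inter_subset_left) (hq'.trans Set.inter_subset_left),
        ← h2 q (hq.trans Set.inter_subset_right) (hq'.trans Set.inter_subset_right)]
      rfl
  smul := by
    intro f s x hf hs p
    obtain ⟨U₁, U₂, hU₁, hU₂, hd, ha, hb, n, g, v, w, hg, he⟩ := hs p
    refine ⟨U₁, U₂, hU₁, hU₂, hd, ha, hb, n, fun j y => f y * g j y, v, w,
      fun j => ⟨hf.mul (hg j).1, (hg j).2⟩, ?_⟩
    filter_upwards [he] with y h1 q hq hq'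
    simp only [mul_smul, ← Finset.smul_sum]
    rw [← h1 q hq hq']
    rfl
  congr := by
    intro s t x hs h p
    obtain ⟨U₁, U₂, hU₁, hU₂, hd, ha, hb, n, g, v, w, hg, he⟩ := hs p
    refine ⟨U₁, U₂, hU₁, hU₂, hd, ha, hb, n, g, v, w, hg, ?_⟩
    filter_upwards [he, h] with y h1 h2 q hq hq'
    rw [← h1 q hq hq', h2]

theorem isSmoothModule_cauchyPower [T2Space M] (W : PreBundle 𝕜 (UConf M)) :
    ∀ n, IsSmoothModule d (cauchyPower d W n)
  | 0 => isSmoothModule_cauchyUnit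
  | _ + 1 => isSmoothModule_cauchy _ _

/-! ### Product sections of the Cauchy tensor product. -/

section
variable {V W : PreBundle 𝕜 (UConf M)}

theorem cauchyTmul_apply_same {x a b : UConf M} (h : IsSplit x a b) (v : V.Fib a) (w : W.Fib b) :
    DFunLike.coe (F := ⨁ p : Split x, V.Fib p.1.1 ⊗[𝕜] W.Fib p.1.2) (cauchyTmul d h v w)
      ⟨(a, b), h⟩ = v ⊗ₜ[𝕜] w := by
  classical
  exact DirectSum.lof_apply (R := 𝕜) (M := fun p : Split x => V.Fib p.1.1 ⊗[𝕜] W.Fib p.1.2) _ _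

theorem cauchyTmul_apply_ne {x a b : UConf M} (h : IsSplit x a b) (v : V.Fib a) (w : W.Fib b)
    (q : Split x) (hq : q.1.1 ≠ a) :
    DFunLike.coe (F := ⨁ p : Split x, V.Fib p.1.1 ⊗[𝕜] W.Fib p.1.2) (cauchyTmul d h v w) q
      = 0 := by
  classical
  exact DirectSum.of_eq_of_ne _ _ _ fun e => hq (by rw [e])

/-- The section of `V ⊠ W` given by the section `v ⊗ w` over the splits of configurations into
their parts inside and outside of `U`. -/
def csec (d : ℕ) {M : Type u} [TopologicalSpace M] [ChartedSpace (EuclideanSpace ℝ (Fin d)) M]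
    {V W : PreBundle 𝕜 (UConf M)} (U : Set M) (v : ∀ y, V.Fib y) (w : ∀ y, W.Fib y)
    (y : UConf M) : (cauchy d V W).Fib y :=
  cauchyTmul d (isSplit_restr U y) (v (restr U y)) (w (restr Uᶜ y))

theorem csec_eq {U : Set M} {v : ∀ y, V.Fib y} {w : ∀ y, W.Fib y} {y a b : UConf M}
    (h : IsSplit y a b) (ha : a = restr U y) :
    csec d U v w y = cauchyTmul d h (v a) (w b) := by
  subst ha
  obtain rfl := h.eq_of_left (isSplit_restr U y)
  rfl

variable [T2Space M]

/-- At the split of `x` cut out by `U`, the single term `v ⊗ w` is a local expression. At any other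
split some point `c` of `x` is on the wrong side of `U`; in nearby splits the point close to `c` is
still on the wrong side, so the component is zero. -/
theorem csec_smoothAt {U : Set M} {v : ∀ y, V.Fib y} {w : ∀ y, W.Fib y} {x : UConf M}
    (hU : CleanAt U x) (hv : V.SmoothAt v (restr U x)) (hw : W.SmoothAt w (restr Uᶜ x)) :
    (cauchy d V W).SmoothAt (csec d U v w) x := by
  rintro ⟨⟨a, b⟩, hab⟩
  by_cases ha : a = restr U x
  · subst ha
    obtain rfl := hab.eq_of_left (isSplit_restr U x)
    refine ⟨interior U, interior Uᶜ, isOpen_interior, isOpen_interior,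
      (disjoint_compl_right (a := U)).mono interior_subset interior_subset,
      fun c hc => ?_, fun c hc => ?_, 1, fun _ _ => 1, fun _ => v, fun _ => w,
      fun _ => ⟨USmoothAt.const 1 x, hv, hw⟩, Filter.Eventually.of_forall ?_⟩
    · obtain ⟨h1, h2⟩ := mem_restr.1 hc
      exact mem_interior_iff_mem_nhds.2
        ((hU c h1).resolve_right fun h => mem_of_mem_nhds h h2)
    · obtain ⟨h1, h2⟩ := mem_restr.1 hc
      exact mem_interior_iff_mem_nhds.2
        ((hU c h1).resolve_left fun h => h2 (mem_of_mem_nhds h))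
    · rintro y ⟨⟨a', b'⟩, hq⟩ h1 h2
      rw [csec_eq hq (hq.eq_restr (fun c hc => interior_subset (h1 hc))
        fun c hc => interior_subset (h2 hc)), cauchyTmul_apply_same]
      simp
  · obtain ⟨O, hO, hd⟩ := exists_separating x
    have hc : ∃ c ∈ x, ¬ (c ∈ a ↔ c ∈ U) := by
      by_contra! hcon
      refine ha ?_
      ext c
      rw [mem_restr]
      exact ⟨fun h => ⟨hab.left_subset h, (hcon c (hab.left_subset h)).1 h⟩,
        fun h => (hcon c h.1).2 h.2⟩
    obtain ⟨c, hcx, hcU⟩ := hc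
    refine ⟨⋃ e ∈ a, O e, ⋃ e ∈ b, O e, isOpen_biUnion fun e _ => (hO e).2,
      isOpen_biUnion fun e _ => (hO e).2, ?_, fun e he => Set.mem_biUnion he (hO e).1,
      fun e he => Set.mem_biUnion he (hO e).1, 0, nofun, nofun, nofun, nofun, ?_⟩
    · simp only [Set.disjoint_iUnion_left, Set.disjoint_iUnion_right]
      exact fun e he e' he' => hd _ (hab.left_subset he') _ (hab.symm.left_subset he) fun h =>
        Finset.disjoint_left.1 hab.1 he' (h ▸ he)
    · have hnot : ∀ e, e ∈ x → e ≠ c → ∀ z ∈ O c, z ∉ O e := fun e he hec z hz hz' =>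
        Set.disjoint_left.1 (hd e he c hcx hec) hz' hz
      rcases hU c hcx with h | h
      · have hca : c ∉ a := fun h' => hcU ⟨fun _ => mem_of_mem_nhds h, fun _ => h'⟩
        filter_upwards [eventually_exists_mem hcx (Filter.inter_mem h
          ((hO c).2.mem_nhds (hO c).1))] with y ⟨z, hzy, hzU, hzO⟩ q h1 h2
        rw [csec, cauchyTmul_apply_ne, Fin.sum_univ_zero]
        intro hq
        have hz : z ∈ q.1.1 := by rw [hq]; exact mem_restr.2 ⟨hzy, hzU⟩
        obtain ⟨e, he, hze⟩ := Set.mem_iUnion₂.1 (h1 hz)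
        exact hnot e (hab.left_subset he) (fun h => hca (h ▸ he)) z hzO hze
      · have hca : c ∈ a := by
          by_contra h'
          exact hcU ⟨fun h'' => absurd h'' h', fun h'' => absurd h'' (mem_of_mem_nhds h)⟩
        filter_upwards [eventually_exists_mem hcx (Filter.inter_mem h
          ((hO c).2.mem_nhds (hO c).1))] with y ⟨z, hzy, hzU, hzO⟩ q h1 h2
        rw [csec, cauchyTmul_apply_ne, Fin.sum_univ_zero]
        intro hq
        rcases (q.2.2 z).1 hzy with hz | hz
        · rw [hq] at hz
          exact hzU (mem_restr.1 hz).2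
        · obtain ⟨e, he, hze⟩ := Set.mem_iUnion₂.1 (h2 hz)
          exact hnot e (hab.symm.left_subset he)
            (fun h => Finset.disjoint_left.1 hab.1 hca (h ▸ he)) z hzO hze

/-- Smooth sections of `V ⊠ W` are locally combinations of the sections `csec`. -/
theorem exists_eq_sum_csec {s : ∀ y, (cauchy d V W).Fib y} {x : UConf M}
    (hs : (cauchy d V W).SmoothAt s x) :
    ∃ (ι : Type u) (_ : Fintype ι) (g : ι → UConf M → 𝕜) (U : ι → Set M)
      (v : ι → ∀ y, V.Fib y) (w : ι → ∀ y, W.Fib y),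
      (∀ j, USmoothAt d (g j) x ∧ CleanAt (U j) x ∧ V.SmoothAt (v j) (restr (U j) x) ∧
        W.SmoothAt (w j) (restr (U j)ᶜ x)) ∧
      ∀ᶠ y in 𝓝 x, s y = ∑ j, g j y • csec d (U j) (v j) (w j) y := by
  classical
  obtain ⟨O, hO, hd⟩ := exists_separating x
  choose U₁ U₂ hU₁ hU₂ hUd ha hb n g v w hg he using hs
  -- `U p` collects the separating neighbourhoods of the first part of `p`. Cutting a nearby `y`
  -- along `U p` follows `p`, and every split of `y` arises in this way from exactly one `p`.
  let U : Split x → Set M := fun p => ⋃ e ∈ p.1.1, O e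
  have hmem : ∀ (p : Split x) (c), c ∈ x → ∀ z ∈ O c, (z ∈ U p ↔ c ∈ p.1.1) := by
    intro p c hc z hz
    refine ⟨fun h => ?_, fun h => Set.mem_biUnion h hz⟩
    obtain ⟨e, he, hze⟩ := Set.mem_iUnion₂.1 h
    by_contra hcp
    exact Set.disjoint_left.1 (hd e (p.2.left_subset he) c hc fun h => hcp (h ▸ he)) hze hz
  have hclean : ∀ p, CleanAt (U p) x := fun p c hc => by
    have hOc := (hO c).2.mem_nhds (hO c).1
    by_cases hcp : c ∈ p.1.1
    · exact Or.inl (Filter.mem_of_superset hOc fun z hz => (hmem p c hc z hz).2 hcp)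
    · exact Or.inr (Filter.mem_of_superset hOc fun z hz h => hcp ((hmem p c hc z hz).1 h))
  have hr1 : ∀ p : Split x, p.1.1 = restr (U p) x := fun p =>
    p.2.eq_restr (fun c hc => (hmem p c (p.2.left_subset hc) c (hO c).1).2 hc)
      fun c hc h => Finset.disjoint_left.1 p.2.1
        ((hmem p c (p.2.symm.left_subset hc) c (hO c).1).1 h) hc
  have hr2 : ∀ p : Split x, p.1.2 = restr (U p)ᶜ x := fun p => by
    have h := p.2
    rw [hr1 p] at h
    exact h.eq_of_left (isSplit_restr _ _)
  let := Fintype.ofFinite (Split x)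
  refine ⟨Σ p : Split x, Fin (n p), inferInstance, fun j => g j.1 j.2, fun j => U j.1,
    fun j => v j.1 j.2, fun j => w j.1 j.2, fun ⟨p, j⟩ => ⟨(hg p j).1, hclean p, ?_, ?_⟩, ?_⟩
  · rw [← hr1]; exact (hg p j).2.1
  · rw [← hr2]; exact (hg p j).2.2
  · have hsub1 : ∀ p : Split x, ∀ᶠ y in 𝓝 x, ∀ z ∈ restr (U p) y, z ∈ U₁ p := fun p =>
      eventually_restr (hclean p) (eventually_forall_mem fun z hz =>
        (hU₁ p).mem_nhds (ha p (by rw [hr1]; exact hz)))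
    have hsub2 : ∀ p : Split x, ∀ᶠ y in 𝓝 x, ∀ z ∈ restr (U p)ᶜ y, z ∈ U₂ p := fun p =>
      eventually_restr (hclean p).compl (eventually_forall_mem fun z hz =>
        (hU₂ p).mem_nhds (hb p (by rw [hr2]; exact hz)))
    filter_upwards [Filter.eventually_all.2 he, Filter.eventually_all.2 hsub1,
      Filter.eventually_all.2 hsub2,
      eventually_existsUnique_mem (fun a _ => (hO a).2.mem_nhds (hO a).1) hd]
      with y he h1 h2 ⟨hy1, hy2⟩
    refine DFinsupp.ext fun q => ?_
    have hq : ∃ p : Split x, q.1.1 = restr (U p) y := by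
      -- The points of `x` whose neighbourhood contains a point of the first part of `q`.
      let O' : Set M := {c | ∃ z ∈ q.1.1, z ∈ O c}
      refine ⟨⟨(restr O' x, restr O'ᶜ x), isSplit_restr O' x⟩, ?_⟩
      refine q.2.eq_restr (fun z hz => ?_) fun z hz h => ?_
      · obtain ⟨c, hc, hzc⟩ := hy1 z (q.2.left_subset hz)
        exact Set.mem_biUnion (mem_restr.2 ⟨hc, z, hz, hzc⟩) hzc
      · obtain ⟨c, hc, hzc⟩ := Set.mem_iUnion₂.1 h
        obtain ⟨hcx, z', hz', hzc'⟩ := mem_restr.1 hc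
        obtain rfl := (hy2 c hcx).unique ⟨q.2.symm.left_subset hz, hzc⟩
          ⟨q.2.left_subset hz', hzc'⟩
        exact Finset.disjoint_left.1 q.2.1 hz' hz
    obtain ⟨p, hp⟩ := hq
    have hp2 : q.1.2 = restr (U p)ᶜ y := by
      have h := q.2
      rw [hp] at h
      exact h.eq_of_left (isSplit_restr _ _)
    refine (he p q (by rw [hp]; exact h1 p) (by rw [hp2]; exact h2 p)).trans ?_
    symm
    refine (DirectSum.sum_apply (β := fun p : Split y => V.Fib p.1.1 ⊗[𝕜] W.Fib p.1.2)
      _ _ q).trans ?_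
    rw [Fintype.sum_sigma, Finset.sum_eq_single p]
    · refine Finset.sum_congr rfl fun j _ => ?_
      refine (DirectSum.smul_apply _ _ _).trans ?_
      rw [csec_eq q.2 hp, cauchyTmul_apply_same]
    · intro p' _ hp'
      refine Finset.sum_eq_zero fun j _ => ?_
      refine (DirectSum.smul_apply _ _ _).trans ?_
      rw [csec, cauchyTmul_apply_ne, smul_zero]
      intro hqp
      refine hp' ?_
      -- The side of `c` in either split is read off from the unique point of `y` near `c`.
      have h1 : p'.1.1 = p.1.1 := by
        ext c
        by_cases hc : c ∈ x
        · obtain ⟨z, ⟨hzy, hz⟩, -⟩ := hy2 c hc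
          rw [← hmem p c hc z hz, ← hmem p' c hc z hz]
          have := hp.symm.trans hqp
          constructor
          · intro h; have h' := mem_restr.2 ⟨hzy, h⟩; rw [← this] at h'; exact (mem_restr.1 h').2
          · intro h; have h' := mem_restr.2 ⟨hzy, h⟩; rw [this] at h'; exact (mem_restr.1 h').2
        · exact ⟨fun h => absurd (p'.2.left_subset h) hc, fun h => absurd (p.2.left_subset h) hc⟩
      exact Subtype.ext (Prod.ext h1 ((h1 ▸ p'.2).eq_of_left p.2))
    · simp

/-- A fibrewise linear map on `V ⊠ W` is smooth if it is smooth on the sections `csec`. -/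
theorem smoothAt_of_csec {C : PreBundle 𝕜 (UConf M)} (hC : IsSmoothModule d C)
    (F : ∀ x, (cauchy d V W).Fib x →ₗ[𝕜] C.Fib x) {x : UConf M}
    (h : ∀ U v w, CleanAt U x → V.SmoothAt v (restr U x) → W.SmoothAt w (restr Uᶜ x) →
      C.SmoothAt (fun y => F y (csec d U v w y)) x)
    {s : ∀ y, (cauchy d V W).Fib y} (hs : (cauchy d V W).SmoothAt s x) :
    C.SmoothAt (fun y => F y (s y)) x := by
  obtain ⟨ι, _, g, U, v, w, hj, he⟩ := exists_eq_sum_csec hs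
  refine hC.congr (hC.sum Finset.univ fun j _ => hC.smul (hj j).1
    (h (U j) (v j) (w j) (hj j).2.1 (hj j).2.2.1 (hj j).2.2.2)) ?_
  filter_upwards [he] with y hy
  rw [hy, map_sum]
  simp

end

open Classical in
/-- The linear map on a fibre of `V ⊠ W` given by bilinear maps on the summands. -/
def cauchyLift (d : ℕ) {M : Type u} [TopologicalSpace M]
    [ChartedSpace (EuclideanSpace ℝ (Fin d)) M] {V W : PreBundle 𝕜 (UConf M)} {x : UConf M}
    {X : Type*} [AddCommGroup X] [Module 𝕜 X]
    (B : ∀ q : Split x, V.Fib q.1.1 →ₗ[𝕜] W.Fib q.1.2 →ₗ[𝕜] X) :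
    (cauchy d V W).Fib x →ₗ[𝕜] X :=
  DirectSum.toModule 𝕜 (Split x) X fun q => TensorProduct.lift (B q)

variable {V W V' W' : PreBundle 𝕜 (UConf M)}

theorem cauchyLift_tmul {x : UConf M} {X : Type*} [AddCommGroup X] [Module 𝕜 X]
    (B : ∀ q : Split x, V.Fib q.1.1 →ₗ[𝕜] W.Fib q.1.2 →ₗ[𝕜] X) {a b : UConf M}
    (h : IsSplit x a b) (v : V.Fib a) (w : W.Fib b) :
    cauchyLift d B (cauchyTmul d h v w) = B ⟨(a, b), h⟩ v w := by
  classical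
  refine (DirectSum.toModule_lof (R := 𝕜)
    (M := fun p : Split x => V.Fib p.1.1 ⊗[𝕜] W.Fib p.1.2) _ _).trans ?_
  exact TensorProduct.lift.tmul _ _

@[elab_as_elim]
theorem cauchy_induction {x : UConf M} {p : (cauchy d V W).Fib x → Prop} (u)
    (zero : p 0) (add : ∀ u v, p u → p v → p (u + v))
    (tmul : ∀ {a b} (h : IsSplit x a b) (v : V.Fib a) (w : W.Fib b), p (cauchyTmul d h v w)) :
    p u := by
  classical
  refine DirectSum.induction_on (motive := p) u zero (fun q t => ?_) add
  induction t using TensorProduct.induction_on with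
  | zero => rw [map_zero]; exact zero
  | add a b ha hb => rw [map_add]; exact add _ _ ha hb
  | tmul v w => exact tmul q.2 v w

/-- Bilinearity of `cauchyTmul`. -/
def cauchyTmulₗ (d : ℕ) {M : Type u} [TopologicalSpace M]
    [ChartedSpace (EuclideanSpace ℝ (Fin d)) M] {V W : PreBundle 𝕜 (UConf M)} {x a b : UConf M}
    (h : IsSplit x a b) : V.Fib a →ₗ[𝕜] W.Fib b →ₗ[𝕜] (cauchy d V W).Fib x := by
  classical
  exact (TensorProduct.mk 𝕜 (V.Fib a) (W.Fib b)).compr₂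
    (DirectSum.lof 𝕜 (Split x) (fun p => V.Fib p.1.1 ⊗[𝕜] W.Fib p.1.2) ⟨(a, b), h⟩)

theorem cauchyTmulₗ_apply {x a b : UConf M} (h : IsSplit x a b) (v : V.Fib a) (w : W.Fib b) :
    cauchyTmulₗ d h v w = cauchyTmul d h v w := by
  simp only [cauchyTmulₗ, cauchyTmul]
  rfl

/-- Functoriality of the Cauchy tensor product. -/
def cauchyMap [T2Space M] (f : BundleHom V V') (g : BundleHom W W') :
    BundleHom (cauchy d V W) (cauchy d V' W') where
  toFun x := cauchyLift d fun q =>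
    (cauchyTmulₗ d q.2).compl₁₂ (f.toFun q.1.1) (g.toFun q.1.2)
  smooth s x hs := by
    refine smoothAt_of_csec (isSmoothModule_cauchy _ _) _ (fun U v w hU hv hw => ?_) hs
    refine (isSmoothModule_cauchy _ _).congr (csec_smoothAt hU (f.smooth v _ hv)
      (g.smooth w _ hw)) (Filter.Eventually.of_forall fun y => ?_)
    rw [csec, cauchyLift_tmul]
    exact cauchyTmulₗ_apply _ _ _

theorem cauchyMap_tmul [T2Space M] (f : BundleHom V V') (g : BundleHom W W') {x a b : UConf M}
    (h : IsSplit x a b) (v : V.Fib a) (w : W.Fib b) :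
    (cauchyMap f g).toFun x (cauchyTmul d h v w) =
      cauchyTmul d h (f.toFun a v) (g.toFun b w) :=
  (cauchyLift_tmul _ _ _ _).trans (cauchyTmulₗ_apply _ _ _)

/-- Composition of bundle maps. -/
def BundleHom.comp {A B C : PreBundle 𝕜 (UConf M)} (g : BundleHom B C) (f : BundleHom A B) :
    BundleHom A C where
  toFun x := g.toFun x ∘ₗ f.toFun x
  smooth s x hs := g.smooth _ x (f.smooth s x hs)

end Sections

/-! ### The Cauchy tensor algebra -/

section Splits

variable {M : Type u}

/-- The complement `y` of `a₁` is a variable rather than an explicit set, so that rebracketing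
applies to a complement in whatever form it appears. -/
theorem IsSplit.assoc_right {x y a b a₁ a₂ : UConf M} (h : IsSplit x a b) (h₁ : IsSplit a a₁ a₂)
    (hy : IsSplit x a₁ y) : IsSplit y a₂ b := by
  refine ⟨Finset.disjoint_of_subset_left h₁.symm.left_subset h.1, fun z => ?_⟩
  have e1 := h.2 z
  have e2 := h₁.2 z
  have e3 := hy.2 z
  have d1 : z ∈ a → z ∉ b := fun h' => Finset.disjoint_left.1 h.1 h'
  have d2 : z ∈ a₁ → z ∉ a₂ := fun h' => Finset.disjoint_left.1 h₁.1 h'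
  have d3 : z ∈ a₁ → z ∉ y := fun h' => Finset.disjoint_left.1 hy.1 h'
  tauto

theorem IsSplit.assoc_left {x y a b b₁ b₂ : UConf M} (h : IsSplit x a b) (h₁ : IsSplit b b₁ b₂)
    (hy : IsSplit x y b₂) : IsSplit y a b₁ :=
  (h.symm.assoc_right h₁.symm hy.symm).symm

theorem isSplit_compl {x a : UConf M} (ha : a ⊆ x) : IsSplit x a (restr (↑a)ᶜ x) := by
  have : a = restr ↑a x := by
    ext z
    simp only [mem_restr, Finset.mem_coe]
    exact ⟨fun h => ⟨ha h, h⟩, fun h => h.2⟩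
  have h := isSplit_restr (↑a) x
  rwa [← this] at h

theorem IsSplit.eq_of_empty {x b : UConf M} (h : IsSplit x ∅ b) : b = x := by
  ext y; simp [h.2 y]

end Splits

/-! ### Letters and the configurations they spell. -/

section Letters

variable {𝕜 : Type u} [RCLike 𝕜] {M : Type u} {V : PreBundle 𝕜 M}

/-- A letter is a vector in some fibre of `i_* V`. -/
abbrev Letter (V : PreBundle 𝕜 M) : Type u := Σ a : UConf M, (extendZero V).Fib a

/-- The letters of a list form an ordered split of `x`. -/
def Spells : List (Letter V) → UConf M → Prop
  | [], x => x = ∅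
  | u :: L, x => ∃ y, IsSplit x u.1 y ∧ Spells L y

theorem IsMultisplit.spells : ∀ {n : ℕ} {z : Fin n → Letter V} {x : UConf M},
    IsMultisplit (fun i => (z i).1) x → Spells (List.ofFn z) x
  | 0, _, x, h => by
    simp only [List.ofFn_zero, Spells]
    ext y
    simp [h.2]
  | n + 1, z, x, h => by
    rw [List.ofFn_succ]
    exact ⟨_, h.head, IsMultisplit.spells h.tail⟩

end Letters

section Tensor

variable {𝕜 : Type u} [RCLike 𝕜] {d : ℕ} {M : Type u} [TopologicalSpace M]
  [ChartedSpace (EuclideanSpace ℝ (Fin d)) M]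

section Power

variable {W : PreBundle 𝕜 (UConf M)}

/-- The element `1` of a fibre of the `0`-th power. -/
def powerOne (W : PreBundle 𝕜 (UConf M)) (x : UConf M) : (cauchyPower d W 0).Fib x :=
  fun _ => (1 : 𝕜)

/-- The coefficient of an element of the `0`-th power. -/
def powerEval (W : PreBundle 𝕜 (UConf M)) {x : UConf M} (hx : x = ∅) :
    (cauchyPower d W 0).Fib x →ₗ[𝕜] 𝕜 :=
  LinearMap.proj (R := 𝕜) (φ := fun _ : PLift (x = ∅) => 𝕜) ⟨hx⟩

theorem powerEval_one {x : UConf M} (hx : x = ∅) : powerEval W hx (powerOne (d := d) W x) = 1 :=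
  rfl

theorem eq_powerEval_smul_one {x : UConf M} (hx : x = ∅) (u : (cauchyPower d W 0).Fib x) :
    u = powerEval W hx u • powerOne W x :=
  funext fun _ => (mul_one _).symm

theorem power_zero_eq_zero {x : UConf M} (hx : x ≠ ∅) (u : (cauchyPower d W 0).Fib x) : u = 0 :=
  funext fun h => absurd h.down hx

/-- The product of a vector with an element of a power. -/
def powerCons {x a b : UConf M} (h : IsSplit x a b) {n : ℕ} : W.Fib a →ₗ[𝕜]
    (cauchyPower d W n).Fib b →ₗ[𝕜] (cauchyPower d W (n + 1)).Fib x :=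
  cauchyTmulₗ d h

theorem powerCons_eq {x a b : UConf M} (h : IsSplit x a b) {n : ℕ} (v : W.Fib a)
    (w : (cauchyPower d W n).Fib b) : powerCons h v w = cauchyTmul d h v w :=
  cauchyTmulₗ_apply h v w

theorem word_succ {n : ℕ} {p : Fin (n + 1) → UConf M} {x : UConf M} (h : IsMultisplit p x)
    (v : ∀ i, W.Fib (p i)) :
    word d h v = powerCons h.head (v 0) (word d h.tail fun i => v i.succ) :=
  (powerCons_eq _ _ _).symm

@[elab_as_elim]
theorem power_induction {n : ℕ} {x : UConf M} {p : (cauchyPower d W (n + 1)).Fib x → Prop} (u)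
    (zero : p 0) (add : ∀ u v, p u → p v → p (u + v))
    (cons : ∀ {a b} (h : IsSplit x a b) (v : W.Fib a) (w : (cauchyPower d W n).Fib b),
      p (powerCons h v w)) : p u :=
  cauchy_induction (p := p) u zero add fun h v w => by rw [← powerCons_eq]; exact cons h v w

/-- The linear map on a power given by bilinear maps on the summands. -/
def powerLift {n : ℕ} {x : UConf M} {X : Type*} [AddCommGroup X] [Module 𝕜 X]
    (B : ∀ q : Split x, W.Fib q.1.1 →ₗ[𝕜] (cauchyPower d W n).Fib q.1.2 →ₗ[𝕜] X) :
    (cauchyPower d W (n + 1)).Fib x →ₗ[𝕜] X :=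
  cauchyLift d B

theorem powerLift_cons {n : ℕ} {x : UConf M} {X : Type*} [AddCommGroup X] [Module 𝕜 X]
    (B : ∀ q : Split x, W.Fib q.1.1 →ₗ[𝕜] (cauchyPower d W n).Fib q.1.2 →ₗ[𝕜] X) {a b : UConf M}
    (h : IsSplit x a b) (v : W.Fib a) (w : (cauchyPower d W n).Fib b) :
    powerLift B (powerCons h v w) = B ⟨(a, b), h⟩ v w := by
  rw [powerCons_eq]
  exact cauchyLift_tmul B h v w

/-- Arbitrary spanning sets `B` are allowed because `coinvFrame_span` needs words in frame vectors;
elsewhere `B` is everything. -/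
theorem word_span (B : ∀ a, Set (W.Fib a))
    (hB : ∀ a, Submodule.span 𝕜 (B a) = ⊤) : ∀ (n : ℕ) (x : UConf M),
    Submodule.span 𝕜 {u | ∃ (p : Fin n → UConf M) (h : IsMultisplit p x) (v : ∀ i, W.Fib (p i)),
      (∀ i, v i ∈ B (p i)) ∧ u = word d h v} = ⊤
  | 0, x => by
    rw [eq_top_iff]
    rintro c -
    by_cases hx : x = ∅
    · rw [eq_powerEval_smul_one hx c]
      refine Submodule.smul_mem _ _ (Submodule.subset_span
        ⟨nofun, ⟨nofun, fun y => ?_⟩, nofun, nofun, rfl⟩)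
      simp [hx]
    · rw [power_zero_eq_zero hx c]
      exact Submodule.zero_mem _
  | n + 1, x => by
    rw [eq_top_iff]
    rintro c -
    induction c using power_induction with
    | zero => exact Submodule.zero_mem _
    | add u v hu hv => exact Submodule.add_mem _ hu hv
    | cons h v w =>
      rename_i a b
      -- A bilinear map sends a pair of spans into the span of the products of the generators.
      have hm := Submodule.apply_mem_map₂ (powerCons h) (Submodule.mem_top (x := v))
        (Submodule.mem_top (x := w))
      rw [← hB a, ← word_span B hB n b, Submodule.map₂_span_span] at hm
      refine Submodule.span_mono ?_ hm
      rintro _ ⟨v, hv, _, ⟨p, hp, w, hw, rfl⟩, rfl⟩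
      have hmul : IsMultisplit (Fin.cons a p : Fin (n + 1) → UConf M) x := by
        refine ⟨fun i j hij => ?_, fun y => ?_⟩
        · refine Fin.cases (fun hij => ?_) (fun i hij => ?_) i hij
          · refine Fin.cases (fun hij => absurd rfl hij) (fun j _ => ?_) j hij
            exact Finset.disjoint_of_subset_right (fun z hz => (hp.2 z).2 ⟨j, hz⟩) h.1
          · refine Fin.cases (fun _ => ?_) (fun j hij => ?_) j hij
            · exact (Finset.disjoint_of_subset_right (fun z hz => (hp.2 z).2 ⟨i, hz⟩) h.1).symm
            · exact hp.1 fun e => hij (congrArg Fin.succ e)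
        · rw [h.2, hp.2, Fin.exists_fin_succ]
          rfl
      refine ⟨_, hmul, Fin.cons (α := fun i => W.Fib ((Fin.cons a p : Fin (n + 1) → UConf M) i))
        v w, Fin.cases hv hw, ?_⟩
      obtain rfl : b = unionOf p := h.eq_of_left hmul.head
      rw [word_succ]
      rfl

end Power

variable {V : PreBundle 𝕜 M}

/-- The linear map on tensors given by linear maps on the powers. -/
def tensorLift {x : UConf M} {X : Type*} [AddCommGroup X] [Module 𝕜 X]
    (F : ∀ n, (cauchyPower d (extendZero V) n).Fib x →ₗ[𝕜] X) :
    (cauchyTensorBundle d V).Fib x →ₗ[𝕜] X :=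
  DirectSum.toModule 𝕜 ℕ X F

theorem tensorLift_ofPower {x : UConf M} {X : Type*} [AddCommGroup X] [Module 𝕜 X]
    (F : ∀ n, (cauchyPower d (extendZero V) n).Fib x →ₗ[𝕜] X) {n : ℕ}
    (t : (cauchyPower d (extendZero V) n).Fib x) : tensorLift F (ofPower d V n x t) = F n t :=
  DirectSum.toModule_lof (R := 𝕜) (M := fun n => (cauchyPower d (extendZero V) n).Fib x)
    (φ := F) n t

@[elab_as_elim]
theorem ofPower_induction {x : UConf M} {p : (cauchyTensorBundle d V).Fib x → Prop} (t)
    (zero : p 0) (add : ∀ s t, p s → p t → p (s + t)) (ofPower : ∀ n t, p (ofPower d V n x t)) :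
    p t :=
  DirectSum.induction_on (motive := p) t zero ofPower add

/-- The product of a letter with a tensor. -/
def lmul {x a b : UConf M} (h : IsSplit x a b) : (extendZero V).Fib a →ₗ[𝕜]
    (cauchyTensorBundle d V).Fib b →ₗ[𝕜] (cauchyTensorBundle d V).Fib x :=
  LinearMap.flip (tensorLift fun n => ((powerCons h).compr₂ (ofPower d V (n + 1) x)).flip)

theorem lmul_ofPower {x a b : UConf M} (h : IsSplit x a b) (u : (extendZero V).Fib a) {n : ℕ}
    (t : (cauchyPower d (extendZero V) n).Fib b) :
    lmul h u (ofPower d V n b t) = ofPower d V (n + 1) x (powerCons h u t) := by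
  rw [lmul, LinearMap.flip_apply, tensorLift_ofPower, LinearMap.flip_apply,
    LinearMap.compr₂_apply]

/-- The unit of the tensor algebra. -/
def tensorOne (V : PreBundle 𝕜 M) (x : UConf M) : (cauchyTensorBundle d V).Fib x :=
  ofPower d V 0 x (powerOne _ x)

-- Left multiplication by letters generates all tensors from the unit over the vacuum. The predicate
-- ranges over all configurations since removing a letter changes the configuration.
@[elab_as_elim]
theorem tensor_induction {p : ∀ x, (cauchyTensorBundle d V).Fib x → Prop}
    {x : UConf M} (t : (cauchyTensorBundle d V).Fib x)
    (zero : ∀ x, p x 0) (add : ∀ x s t, p x s → p x t → p x (s + t))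
    (smul : ∀ x (c : 𝕜) t, p x t → p x (c • t))
    (one : p ∅ (tensorOne V ∅))
    (lmul : ∀ x a b (h : IsSplit x a b) u t, p b t → p x (lmul h u t)) : p x t := by
  have key : ∀ n x t, p x (ofPower d V n x t) := by
    intro n
    induction n with
    | zero =>
      intro x t
      by_cases hx : x = ∅
      · subst hx
        rw [eq_powerEval_smul_one rfl t, map_smul]
        exact smul _ _ _ one
      · rw [power_zero_eq_zero hx t, map_zero]
        exact zero x
    | succ n ih =>
      intro x t
      induction t using power_induction with
      | zero => rw [map_zero]; exact zero x
      | add u v hu hv => rw [map_add]; exact add _ _ _ hu hv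
      | cons h v w => rw [← lmul_ofPower]; exact lmul _ _ _ h _ _ (ih _ _)
  exact ofPower_induction t (zero x) (add x) fun n t => key n x t

/-- Transport of tensors along an equality of configurations. -/
def castTensor {x y : UConf M} (h : x = y) :
    (cauchyTensorBundle d V).Fib x →ₗ[𝕜] (cauchyTensorBundle d V).Fib y :=
  h ▸ LinearMap.id

open Classical in
/-- Concatenation with tensors of length `k`. -/
def concat : ∀ (k : ℕ) {x a b : UConf M}, IsSplit x a b →
    (cauchyPower d (extendZero V) k).Fib a →ₗ[𝕜] (cauchyTensorBundle d V).Fib b →ₗ[𝕜]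
      (cauchyTensorBundle d V).Fib x
  | 0, x, a, b, h =>
    -- A scalar lives over `∅`, which forces `b = x`; over any other `a` the `0`-th power is zero.
    if ha : a = ∅ then
      (powerEval _ ha).smulRight (castTensor (IsSplit.eq_of_empty (ha ▸ h)))
    else 0
  -- `q` splits `a` into a letter and a tail; the tail is multiplied over the complement of the
  -- letter in `x`.
  | k + 1, x, a, b, h => powerLift fun q => LinearMap.mk₂ 𝕜
      (fun u t => lmul (isSplit_compl (q.2.left_subset.trans h.left_subset)) u ∘ₗ
        concat k (h.assoc_right q.2 (isSplit_compl (q.2.left_subset.trans h.left_subset))) t)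
      (fun u u' t => by rw [map_add, LinearMap.add_comp])
      (fun c u t => by rw [map_smul, LinearMap.smul_comp])
      (fun u t t' => by rw [map_add, LinearMap.comp_add])
      (fun c u t => by rw [map_smul, LinearMap.comp_smul])

/-- The product of tensors. -/
def tensorMul {x a b : UConf M} (h : IsSplit x a b) : (cauchyTensorBundle d V).Fib a →ₗ[𝕜]
    (cauchyTensorBundle d V).Fib b →ₗ[𝕜] (cauchyTensorBundle d V).Fib x :=
  tensorLift fun k => concat k h

theorem tensorMul_ofPower {x a b : UConf M} (h : IsSplit x a b) {k : ℕ}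
    (t : (cauchyPower d (extendZero V) k).Fib a) (v : (cauchyTensorBundle d V).Fib b) :
    tensorMul h (ofPower d V k a t) v = concat k h t v := by
  rw [tensorMul, tensorLift_ofPower]

theorem tensorMul_one_left {x : UConf M} (t : (cauchyTensorBundle d V).Fib x) :
    tensorMul (IsSplit.left_empty x) (tensorOne V ∅) t = t := by
  rw [tensorOne, tensorMul_ofPower, concat, dif_pos rfl, LinearMap.smulRight_apply, powerEval_one,
    one_smul]
  rfl

/-- Uniqueness of complements replaces the explicit complement in `concat` by any `y`. -/
theorem concat_succ {x y a b a₁ a₂ : UConf M} (h : IsSplit x a b) (h₁ : IsSplit a a₁ a₂)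
    (hy : IsSplit x a₁ y) (h₂ : IsSplit y a₂ b) {k : ℕ} (u : (extendZero V).Fib a₁)
    (t : (cauchyPower d (extendZero V) k).Fib a₂) (v : (cauchyTensorBundle d V).Fib b) :
    concat (k + 1) h (powerCons h₁ u t) v = lmul hy u (concat k h₂ t v) := by
  obtain rfl : y = _ := hy.eq_of_left (isSplit_compl (h₁.left_subset.trans h.left_subset))
  rw [concat, powerLift_cons]
  rfl

/-- Together with `tensorMul_one_left` this recursion determines the product; associativity and the
right unit follow by induction on the left factor. -/
theorem tensorMul_lmul {x y a b a₁ a₂ : UConf M} (h : IsSplit x a b) (h₁ : IsSplit a a₁ a₂)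
    (hy : IsSplit x a₁ y) (h₂ : IsSplit y a₂ b) (u : (extendZero V).Fib a₁)
    (t : (cauchyTensorBundle d V).Fib a₂) (v : (cauchyTensorBundle d V).Fib b) :
    tensorMul h (lmul h₁ u t) v = lmul hy u (tensorMul h₂ t v) := by
  induction t using ofPower_induction with
  | zero => simp only [map_zero, LinearMap.zero_apply]
  | add s t hs ht => simp only [map_add, LinearMap.add_apply, hs, ht]
  | ofPower k t =>
    rw [lmul_ofPower, tensorMul_ofPower, tensorMul_ofPower, concat_succ h h₁ hy h₂]

theorem tensorMul_assoc {x a b c ab bc : UConf M} (hab : IsSplit ab a b) (hx : IsSplit x ab c)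
    (hbc : IsSplit bc b c) (hx' : IsSplit x a bc) (u : (cauchyTensorBundle d V).Fib a)
    (v : (cauchyTensorBundle d V).Fib b) (w : (cauchyTensorBundle d V).Fib c) :
    tensorMul hx (tensorMul hab u v) w = tensorMul hx' u (tensorMul hbc v w) := by
  induction u using tensor_induction generalizing x ab with
  | zero a => simp only [map_zero, LinearMap.zero_apply]
  | add a s t hs ht =>
    simp only [map_add, LinearMap.add_apply, hs hab hx hx', ht hab hx hx']
  | smul a r t ht =>
    simp only [map_smul, LinearMap.smul_apply, ht hab hx hx']
  | one =>
    obtain rfl := hab.eq_of_empty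
    obtain rfl := hx'.eq_of_empty
    rw [tensorMul_one_left, tensorMul_one_left]
  | lmul a a₁ a₂ h u t ih =>
    have h1 := isSplit_compl (h.left_subset.trans hab.left_subset)
    have h2 := isSplit_compl (h.left_subset.trans hx'.left_subset)
    rw [tensorMul_lmul hab h h1 (hab.assoc_right h h1), tensorMul_lmul hx h1 h2
      (hx.assoc_right h1 h2), tensorMul_lmul hx' h h2 (hx'.assoc_right h h2), ih]

theorem tensorMul_one_right {x : UConf M} (t : (cauchyTensorBundle d V).Fib x) :
    tensorMul (IsSplit.left_empty x).symm t (tensorOne V ∅) = t := by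
  induction t using tensor_induction with
  | zero x => simp only [map_zero, LinearMap.zero_apply]
  | add x s t hs ht => simp only [map_add, LinearMap.add_apply, hs, ht]
  | smul x r t ht => simp only [map_smul, LinearMap.smul_apply, ht]
  | one => exact tensorMul_one_left _
  | lmul x a b h u t ih =>
    rw [tensorMul_lmul _ h h (IsSplit.left_empty b).symm, ih]

/-! ### Words -/

open Classical in
/-- The product of a list of letters. -/
def listWord (d : ℕ) {M : Type u} [TopologicalSpace M] [ChartedSpace (EuclideanSpace ℝ (Fin d)) M]
    {V : PreBundle 𝕜 M} : List (Letter V) → ∀ x, (cauchyTensorBundle d V).Fib x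
  | [], x => tensorOne V x
  | u :: L, x =>
    if h : IsSplit x u.1 (restr (↑u.1)ᶜ x) then lmul h u.2 (listWord d L _) else 0

theorem listWord_cons {x y : UConf M} (u : Letter V) (L : List (Letter V))
    (h : IsSplit x u.1 y) : listWord d (u :: L) x = lmul h u.2 (listWord d L y) := by
  have h' := isSplit_compl h.left_subset
  obtain rfl := h.eq_of_left h'
  rw [listWord, dif_pos h']

/-- Lists of letters replace dependent families: concatenation becomes `++` and permutation becomes
precomposition, without transport between fibres. -/
theorem ofPower_word : ∀ {n : ℕ} {p : Fin n → UConf M} {x : UConf M} (h : IsMultisplit p x)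
    (v : ∀ i, (extendZero V).Fib (p i)),
    ofPower d V n x (word d h v) = listWord d (List.ofFn fun i => (⟨p i, v i⟩ : Letter V)) x
  | 0, _, _, _, _ => rfl
  | n + 1, p, x, h, v => by
    rw [List.ofFn_succ, listWord_cons _ _ h.head, ← ofPower_word h.tail, lmul_ofPower, word_succ]

/-- Only the left list has to fit its configuration: the recursion peels off its letters and never
inspects the right list. -/
theorem tensorMul_listWord {L L' : List (Letter V)} {x a b : UConf M} (h : IsSplit x a b)
    (hL : Spells L a) :
    tensorMul h (listWord d L a) (listWord d L' b) = listWord d (L ++ L') x := by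
  induction L generalizing x a with
  | nil =>
    obtain rfl : a = ∅ := hL
    obtain rfl := h.eq_of_empty
    exact tensorMul_one_left _
  | cons u L ih =>
    obtain ⟨y, hy, hL⟩ := hL
    have h1 := isSplit_compl (hy.left_subset.trans h.left_subset)
    rw [listWord_cons _ _ hy, tensorMul_lmul h hy h1 (h.assoc_right hy h1), ih _ hL,
      List.cons_append, listWord_cons _ _ h1]

theorem listWord_span (x : UConf M) : Submodule.span 𝕜 {t | ∃ (n : ℕ) (z : Fin n → Letter V),
    IsMultisplit (fun i => (z i).1) x ∧ t = listWord d (List.ofFn z) x} = ⊤ := by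
  rw [eq_top_iff]
  rintro t -
  induction t using ofPower_induction with
  | zero => exact Submodule.zero_mem _
  | add _ _ hs ht => exact Submodule.add_mem _ hs ht
  | ofPower n t =>
    have h2 := Submodule.mem_map_of_mem (f := ofPower d V n x) (Submodule.mem_top (x := t))
    rw [← word_span (d := d) (W := extendZero V) (fun _ => Set.univ)
      (fun _ => Submodule.span_univ) n x, Submodule.map_span] at h2
    refine Submodule.span_mono ?_ h2
    rintro _ ⟨_, ⟨p, h, v, -, rfl⟩, rfl⟩
    exact ⟨n, fun i => ⟨p i, v i⟩, h, ofPower_word h v⟩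

end Tensor

/-! ### Smoothness of the multiplication of tensors -/

theorem IsSplit.card_eq {M : Type u} {x a b : UConf M} (h : IsSplit x a b) :
    x.card = a.card + b.card := by
  classical
  rw [← Finset.card_union_of_disjoint h.1]
  congr 1
  ext y
  rw [Finset.mem_union, h.2]

theorem restr_restr {M : Type u} {U U' : Set M} {x : UConf M} :
    restr U' (restr U x) = restr (U ∩ U') x := by
  ext; simp only [mem_restr, Set.mem_inter_iff]; tauto

theorem extendZero_eq_zero {𝕜 : Type u} [RCLike 𝕜] {M : Type u} {V : PreBundle 𝕜 M}
    {x : UConf M} (hx : ∀ y, x ≠ {y}) (v : (extendZero V).Fib x) : v = 0 :=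
  funext fun y => absurd y.2 (hx y.1)

section TensorSmooth

variable {𝕜 : Type u} [RCLike 𝕜] {d : ℕ} {M : Type u} [TopologicalSpace M]
  [ChartedSpace (EuclideanSpace ℝ (Fin d)) M] {V : PreBundle 𝕜 M}

/-- A nonzero letter occupies exactly one point, so `n` of them occupy `n` points. This collapses
the direct sum over lengths to one summand in each fibre. -/
theorem power_eq_zero : ∀ {n : ℕ} {x : UConf M} (_ : x.card ≠ n)
    (u : (cauchyPower d (extendZero V) n).Fib x), u = 0
  | 0, x, h, u => power_zero_eq_zero (fun hx => h (by rw [hx, Finset.card_empty])) u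
  | n + 1, x, h, u => by
    induction u using power_induction with
    | zero => rfl
    | add u v hu hv => rw [hu, hv, add_zero]
    | cons hs v w =>
      rename_i a b
      by_cases ha : ∃ y, a = {y}
      · obtain ⟨y, rfl⟩ := ha
        have hb : b.card ≠ n := fun hb => h (by
          rw [hs.card_eq, hb, Finset.card_singleton, add_comm])
        rw [power_eq_zero hb w, map_zero]
      · rw [extendZero_eq_zero (fun y hy => ha ⟨y, hy⟩) v, map_zero, LinearMap.zero_apply]

/-- The component of length `n` of a tensor. -/
def tensorComp (V : PreBundle 𝕜 M) (n : ℕ) (x : UConf M) :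
    (cauchyTensorBundle d V).Fib x →ₗ[𝕜] (cauchyPower d (extendZero V) n).Fib x :=
  DirectSum.component 𝕜 ℕ (fun n => (cauchyPower d (extendZero V) n).Fib x) n

theorem tensorComp_same {n : ℕ} {x : UConf M} (t : (cauchyPower d (extendZero V) n).Fib x) :
    tensorComp V n x (ofPower d V n x t) = t :=
  DirectSum.component.lof_self (R := 𝕜) (M := fun n => (cauchyPower d (extendZero V) n).Fib x) n t

theorem tensorComp_ne {n m : ℕ} (h : m ≠ n) {x : UConf M}
    (t : (cauchyPower d (extendZero V) m).Fib x) :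
    tensorComp V n x (ofPower d V m x t) = 0 :=
  DirectSum.of_eq_of_ne (β := fun n => (cauchyPower d (extendZero V) n).Fib x) m n t h.symm

theorem tensor_ext {x : UConf M} {s t : (cauchyTensorBundle d V).Fib x}
    (h : ∀ n, tensorComp V n x s = tensorComp V n x t) : s = t :=
  DFinsupp.ext h

theorem eq_ofPower {n : ℕ} {x : UConf M} (h : x.card = n) (t : (cauchyTensorBundle d V).Fib x) :
    t = ofPower d V n x (tensorComp V n x t) := by
  refine tensor_ext fun m => ?_
  by_cases hm : n = m
  · subst hm; rw [tensorComp_same]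
  · rw [tensorComp_ne hm]
    exact power_eq_zero (by rwa [h]) _

theorem smoothAt_tensor_iff {s : ∀ y, (cauchyTensorBundle d V).Fib y} {x : UConf M} :
    (cauchyTensorBundle d V).SmoothAt s x ↔
      ∀ n, (cauchyPower d (extendZero V) n).SmoothAt (fun y => tensorComp V n y (s y)) x :=
  Iff.rfl

theorem tensorComp_lmul_zero {x a b : UConf M} (h : IsSplit x a b) (u : (extendZero V).Fib a)
    (t : (cauchyTensorBundle d V).Fib b) : tensorComp V 0 x (lmul h u t) = 0 := by
  induction t using ofPower_induction with
  | zero => simp only [map_zero]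
  | add s t hs ht => simp only [map_add, hs, ht, add_zero]
  | ofPower n t => rw [lmul_ofPower, tensorComp_ne n.succ_ne_zero]

theorem tensorComp_lmul_succ {n : ℕ} {x a b : UConf M} (h : IsSplit x a b)
    (u : (extendZero V).Fib a) (t : (cauchyTensorBundle d V).Fib b) :
    tensorComp V (n + 1) x (lmul h u t) = powerCons h u (tensorComp V n b t) := by
  induction t using ofPower_induction with
  | zero => simp only [map_zero]
  | add s t hs ht => simp only [map_add, hs, ht]
  | ofPower m t =>
    rw [lmul_ofPower]
    by_cases hm : m = n
    · subst hm; rw [tensorComp_same, tensorComp_same]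
    · rw [tensorComp_ne hm, tensorComp_ne fun e => hm (Nat.succ_injective e), map_zero]

theorem concat_zero {x a b : UConf M} (h : IsSplit x a b) (ha : a = ∅)
    (c : (cauchyPower d (extendZero V) 0).Fib a) (t : ∀ y, (cauchyTensorBundle d V).Fib y) :
    concat 0 h c (t b) = powerEval _ ha c • t x := by
  subst ha
  obtain rfl := h.eq_of_empty
  rw [concat, dif_pos rfl, LinearMap.smulRight_apply]
  rfl

variable [T2Space M]

theorem isSmoothModule_tensor : IsSmoothModule d (cauchyTensorBundle d V) :=
  isSmoothModule_dsum fun n => isSmoothModule_cauchyPower _ n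

theorem smoothAt_ofPower {n : ℕ} {s : ∀ y, (cauchyPower d (extendZero V) n).Fib y} {x : UConf M}
    (hs : (cauchyPower d (extendZero V) n).SmoothAt s x) :
    (cauchyTensorBundle d V).SmoothAt (fun y => ofPower d V n y (s y)) x := by
  rw [smoothAt_tensor_iff]
  intro m
  by_cases hm : n = m
  · subst hm; simpa only [tensorComp_same] using hs
  · simpa only [tensorComp_ne hm] using (isSmoothModule_cauchyPower _ m).zero x

theorem smoothAt_powerCons {W : PreBundle 𝕜 (UConf M)} {n : ℕ} {U : Set M} {v : ∀ y, W.Fib y}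
    {t : ∀ y, (cauchyPower d W n).Fib y} {x : UConf M} (hU : CleanAt U x)
    (hv : W.SmoothAt v (restr U x)) (ht : (cauchyPower d W n).SmoothAt t (restr Uᶜ x)) :
    (cauchyPower d W (n + 1)).SmoothAt
      (fun y => powerCons (isSplit_restr U y) (v (restr U y)) (t (restr Uᶜ y))) x := by
  simp only [powerCons_eq]
  exact csec_smoothAt hU hv ht

theorem exists_eq_sum_powerCons {W : PreBundle 𝕜 (UConf M)} {n : ℕ}
    {s : ∀ y, (cauchyPower d W (n + 1)).Fib y} {x : UConf M}
    (hs : (cauchyPower d W (n + 1)).SmoothAt s x) :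
    ∃ (ι : Type u) (_ : Fintype ι) (g : ι → UConf M → 𝕜) (U : ι → Set M)
      (v : ι → ∀ y, W.Fib y) (w : ι → ∀ y, (cauchyPower d W n).Fib y),
      (∀ j, USmoothAt d (g j) x ∧ CleanAt (U j) x ∧ W.SmoothAt (v j) (restr (U j) x) ∧
        (cauchyPower d W n).SmoothAt (w j) (restr (U j)ᶜ x)) ∧
      ∀ᶠ y in 𝓝 x, s y = ∑ j, g j y •
        powerCons (isSplit_restr (U j) y) (v j (restr (U j) y)) (w j (restr (U j)ᶜ y)) := by
  simp only [powerCons_eq]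
  exact exists_eq_sum_csec hs

theorem smoothAt_lmul {U : Set M} {v : ∀ y, (extendZero V).Fib y}
    {t : ∀ y, (cauchyTensorBundle d V).Fib y} {x : UConf M} (hU : CleanAt U x)
    (hv : (extendZero V).SmoothAt v (restr U x))
    (ht : (cauchyTensorBundle d V).SmoothAt t (restr Uᶜ x)) :
    (cauchyTensorBundle d V).SmoothAt
      (fun y => lmul (isSplit_restr U y) (v (restr U y)) (t (restr Uᶜ y))) x := by
  rw [smoothAt_tensor_iff] at ht ⊢
  rintro (_ | n)
  · simpa only [tensorComp_lmul_zero] using (isSmoothModule_cauchyPower _ 0).zero x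
  · simpa only [tensorComp_lmul_succ] using smoothAt_powerCons hU hv (ht n)

/-- By induction on `k`: if the left factor is itself cut by `U'` into a letter and a tail, the
product is rebracketed so that the letter is cut out by `U ∩ U'` and the rest is cut by `U`. -/
theorem smoothAt_concat : ∀ (k : ℕ) {U : Set M}
    {v : ∀ y, (cauchyPower d (extendZero V) k).Fib y}
    {t : ∀ y, (cauchyTensorBundle d V).Fib y} {x : UConf M} (_ : CleanAt U x)
    (_ : (cauchyPower d (extendZero V) k).SmoothAt v (restr U x))
    (_ : (cauchyTensorBundle d V).SmoothAt t (restr Uᶜ x)),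
    (cauchyTensorBundle d V).SmoothAt
      (fun y => concat k (isSplit_restr U y) (v (restr U y)) (t (restr Uᶜ y))) x
  | 0, U, v, t, x, hU, ⟨g, hg, hv⟩, ht => by
    have hcard := eventually_restr hU (eventually_card_eq (restr U x))
    -- Emptiness of `restr U y` is locally constant, so near `x` the product is a smooth multiple of
    -- `t`, or zero.
    by_cases h : restr U x = ∅
    · have hx : restr Uᶜ x = x := by
        have := isSplit_restr U x
        rw [h] at this
        exact this.eq_of_empty
      rw [hx] at ht
      refine isSmoothModule_tensor.congr (isSmoothModule_tensor.smul
        (USmoothAt.comp_restr hU hg) ht) ?_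
      filter_upwards [hcard, eventually_restr hU hv] with y hy hvy
      rw [h, Finset.card_empty, Finset.card_eq_zero] at hy
      rw [concat_zero _ hy, hvy]
      rfl
    · refine isSmoothModule_tensor.congr (isSmoothModule_tensor.zero x) ?_
      filter_upwards [hcard] with y hy
      have : restr U y ≠ ∅ := fun e => h (by
        rw [e, Finset.card_empty] at hy
        exact Finset.card_eq_zero.1 hy.symm)
      rw [concat, dif_neg this]
      rfl
  | k + 1, U, v, t, x, hU, hv, ht => by
    obtain ⟨ι, _, g, U', v', w', hj, he⟩ := exists_eq_sum_powerCons hv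
    -- `U' j` is only known to be clean at the points of `x` in `U`; at the other points a
    -- neighbourhood already avoids `U`.
    have hUU : ∀ j, CleanAt (U ∩ U' j) x := fun j a ha => by
      rcases hU a ha with h | h
      · rcases (hj j).2.1 a (mem_restr.2 ⟨ha, mem_of_mem_nhds h⟩) with h' | h'
        · exact Or.inl (Filter.inter_mem h h')
        · exact Or.inr (Filter.mem_of_superset h' (Set.compl_subset_compl.2 Set.inter_subset_right))
      · exact Or.inr (Filter.mem_of_superset h (Set.compl_subset_compl.2 Set.inter_subset_left))
    have e1 : ∀ j y, restr U (restr (U ∩ U' j)ᶜ y) = restr (U' j)ᶜ (restr U y) := fun j y => by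
      ext; simp only [mem_restr, Set.mem_inter_iff, Set.mem_compl_iff]; tauto
    have e2 : ∀ j y, restr Uᶜ (restr (U ∩ U' j)ᶜ y) = restr Uᶜ y := fun j y => by
      ext; simp only [mem_restr, Set.mem_inter_iff, Set.mem_compl_iff]; tauto
    have key : ∀ j, (cauchyTensorBundle d V).SmoothAt (fun y =>
        lmul (isSplit_restr (U ∩ U' j) y) (v' j (restr (U ∩ U' j) y))
          ((fun z => concat k (isSplit_restr U z) (w' j (restr U z)) (t (restr Uᶜ z)))
            (restr (U ∩ U' j)ᶜ y))) x := fun j => by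
      refine smoothAt_lmul (hUU j) (by rw [← restr_restr]; exact (hj j).2.2.1)
        (smoothAt_concat k (hU.mono (restr_subset _ _)) ?_ ?_)
      · rw [e1]; exact (hj j).2.2.2
      · rw [e2]; exact ht
    refine isSmoothModule_tensor.congr (isSmoothModule_tensor.sum Finset.univ fun j _ =>
      isSmoothModule_tensor.smul (USmoothAt.comp_restr hU (hj j).1) (key j)) ?_
    filter_upwards [eventually_restr hU he] with y hy
    rw [hy, map_sum, LinearMap.sum_apply]
    refine Finset.sum_congr rfl fun j _ => ?_
    rw [map_smul, LinearMap.smul_apply]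
    congr 1
    have h1 := isSplit_restr (U ∩ U' j) y
    have h2 := isSplit_restr U (restr (U ∩ U' j)ᶜ y)
    have h3 := isSplit_restr (U' j) (restr U y)
    -- The configurations are made variables so that the equalities between them can be substituted
    -- in the dependent fibres.
    have aux : ∀ {a a₁ a₂ b a₁' a₂' b' : UConf M} (h : IsSplit y a b) (h₁ : IsSplit a a₁ a₂)
        {z : UConf M} (hy : IsSplit y a₁' z) (h₂ : IsSplit z a₂' b'), a₁' = a₁ → a₂' = a₂ →
        b' = b → concat (k + 1) h (powerCons h₁ (v' j a₁) (w' j a₂)) (t b) =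
          lmul hy (v' j a₁') (concat k h₂ (w' j a₂') (t b')) := by
      rintro a a₁ a₂ b _ _ _ h h₁ z hy h₂ rfl rfl rfl
      exact concat_succ h h₁ hy h₂ _ _ _
    exact aux _ _ _ _ restr_restr.symm (e1 j y) (e2 j y)

/-- Near `x` the left factor has constant length, so a single `concat` computes the product. -/
theorem smoothAt_tensorMul {U : Set M} {s t : ∀ y, (cauchyTensorBundle d V).Fib y} {x : UConf M}
    (hU : CleanAt U x) (hs : (cauchyTensorBundle d V).SmoothAt s (restr U x))
    (ht : (cauchyTensorBundle d V).SmoothAt t (restr Uᶜ x)) :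
    (cauchyTensorBundle d V).SmoothAt
      (fun y => tensorMul (isSplit_restr U y) (s (restr U y)) (t (restr Uᶜ y))) x := by
  refine isSmoothModule_tensor.congr
    (smoothAt_concat (restr U x).card hU (smoothAt_tensor_iff.1 hs _) ht) ?_
  filter_upwards [eventually_restr hU (eventually_card_eq (restr U x))] with y hy
  conv_lhs => rw [eq_ofPower hy (s (restr U y)), tensorMul_ofPower]

/-- The unit bundle map of the tensor algebra. -/
def tensorUnit (V : PreBundle 𝕜 M) :
    BundleHom (cauchyUnit (𝕜 := 𝕜) d) (cauchyTensorBundle d V) where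
  toFun x := ofPower d V 0 x
  smooth _ _ hs := smoothAt_ofPower (n := 0) hs

/-- The multiplication of the tensor algebra as a bundle map. -/
def tensorMulHom (V : PreBundle 𝕜 M) :
    BundleHom (cauchy d (cauchyTensorBundle d V) (cauchyTensorBundle d V))
      (cauchyTensorBundle d V) where
  toFun x := cauchyLift d fun q => tensorMul q.2
  smooth s x hs := by
    refine smoothAt_of_csec isSmoothModule_tensor _ (fun U v w hU hv hw => ?_) hs
    refine isSmoothModule_tensor.congr (smoothAt_tensorMul hU hv hw)
      (Filter.Eventually.of_forall fun y => ?_)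
    rw [csec, cauchyLift_tmul]

theorem mulAt_tensorMulHom {x a b : UConf M} (h : IsSplit x a b)
    (u : (cauchyTensorBundle d V).Fib a) (v : (cauchyTensorBundle d V).Fib b) :
    mulAt d (tensorMulHom V) h u v = tensorMul h u v :=
  cauchyLift_tmul _ _ _ _

theorem oneAt_tensorUnit : oneAt d (tensorUnit V) = tensorOne V ∅ := rfl

/-- The tensor algebra. -/
def tensorAlgebra (V : PreBundle 𝕜 M) : CauchyAlgebra d (cauchyTensorBundle d V) where
  mul := tensorMulHom V
  one := tensorUnit V
  assoc hab hx hbc hx' u v w := by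
    simp only [mulAt_tensorMulHom, tensorMul_assoc hab hx hbc hx']
  one_mul u := by rw [mulAt_tensorMulHom, oneAt_tensorUnit, tensorMul_one_left]
  mul_one u := by rw [mulAt_tensorMulHom, oneAt_tensorUnit, tensorMul_one_right]

theorem mulAt_tensorAlgebra {x a b : UConf M} (h : IsSplit x a b)
    (u : (cauchyTensorBundle d V).Fib a) (v : (cauchyTensorBundle d V).Fib b) :
    mulAt d (tensorAlgebra V).mul h u v = tensorMul h u v :=
  mulAt_tensorMulHom h u v

theorem isConcatenation_tensorAlgebra : (tensorAlgebra (d := d) V).IsConcatenation := by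
  refine ⟨fun k l p v x a b h hx ha hb => ?_, fun x c => rfl⟩
  rw [mulAt_tensorAlgebra, ofPower_word ha, ofPower_word hb, ofPower_word hx,
    tensorMul_listWord h (IsMultisplit.spells
      (z := fun i => (⟨p (Fin.castAdd l i), v (Fin.castAdd l i)⟩ : Letter V)) ha)]
  congr 1
  exact (List.ofFn_add (f := fun i => (⟨p i, v i⟩ : Letter V))).symm

end TensorSmooth

/-! ### The algebra of coinvariants -/

/-- Characters `ε` of the symmetric groups with value `e` on adjacent transpositions that are
compatible with block permutations. -/
structure IsCharacterFamily (ε : ∀ n, Equiv.Perm (Fin n) →* ℤˣ) (e : ℤˣ) : Prop where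
  swap : ∀ {n : ℕ} (i : Fin n), ε (n + 1) (Equiv.swap i.castSucc i.succ) = e
  sumCongr : ∀ (k l : ℕ) (σ : Equiv.Perm (Fin k)) (τ : Equiv.Perm (Fin l)),
    ε (k + l) (finSumFinEquiv.permCongr (Equiv.Perm.sumCongr σ τ)) = ε k σ * ε l τ

theorem isCharacterFamily_trivial : IsCharacterFamily trivialCharacter 1 :=
  ⟨fun _ => rfl, fun _ _ _ _ => rfl⟩

theorem isCharacterFamily_sign : IsCharacterFamily signCharacter (-1) := by
  refine ⟨fun i => Equiv.Perm.sign_swap i.castSucc_lt_succ.ne, fun k l σ τ => ?_⟩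
  simp only [signCharacter]
  rw [Equiv.Perm.sign_permCongr]
  exact Equiv.Perm.sign_sumCongr σ τ

theorem Fin.append_comp_permCongr {α : Type*} {k l : ℕ} (z : Fin k → α) (z' : Fin l → α)
    (σ : Equiv.Perm (Fin k)) (τ : Equiv.Perm (Fin l)) :
    Fin.append z z' ∘ finSumFinEquiv.permCongr (Equiv.Perm.sumCongr σ τ) =
      Fin.append (z ∘ σ) (z' ∘ τ) := by
  funext i
  refine Fin.addCases (fun i => ?_) (fun i => ?_) i
  · simp [Equiv.permCongr_apply]
  · simp [Equiv.permCongr_apply]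

theorem IsMultisplit.append {M : Type u} {k l : ℕ} {p : Fin k → UConf M} {q : Fin l → UConf M}
    {x a b : UConf M} (h : IsSplit x a b) (hp : IsMultisplit p a) (hq : IsMultisplit q b) :
    IsMultisplit (Fin.append p q) x := by
  refine ⟨fun i j => ?_, fun y => ?_⟩
  · have hd : ∀ i j, Disjoint (p i) (q j) := fun i j =>
      Finset.disjoint_of_subset_left (fun y hy => (hp.2 y).2 ⟨i, hy⟩)
        (Finset.disjoint_of_subset_right (fun y hy => (hq.2 y).2 ⟨j, hy⟩) h.1)
    refine Fin.addCases (fun i => ?_) (fun i => ?_) i <;>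
      refine Fin.addCases (fun j => ?_) (fun j => ?_) j <;>
      simp only [Fin.append_left, Fin.append_right]
    · exact fun hij => hp.1 fun e => hij (by rw [e])
    · exact fun _ => hd i j
    · exact fun _ => (hd j i).symm
    · exact fun hij => hq.1 fun e => hij (by rw [e])
  · rw [h.2, hp.2, hq.2]
    constructor
    · rintro (⟨i, hi⟩ | ⟨i, hi⟩)
      · exact ⟨Fin.castAdd l i, by rwa [Fin.append_left]⟩
      · exact ⟨Fin.natAdd k i, by rwa [Fin.append_right]⟩
    · rintro ⟨i, hi⟩
      revert hi
      refine Fin.addCases (fun i => ?_) (fun i => ?_) i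
      · rw [Fin.append_left]; exact fun hi => Or.inl ⟨i, hi⟩
      · rw [Fin.append_right]; exact fun hi => Or.inr ⟨i, hi⟩

theorem IsMultisplit.append_letters {𝕜 : Type u} [RCLike 𝕜] {M : Type u} {V : PreBundle 𝕜 M}
    {k l : ℕ} {z : Fin k → Letter V} {z' : Fin l → Letter V}
    {x a b : UConf M} (h : IsSplit x a b) (hz : IsMultisplit (fun i => (z i).1) a)
    (hz' : IsMultisplit (fun i => (z' i).1) b) :
    IsMultisplit (fun i => (Fin.append z z' i).1) x := by
  have := IsMultisplit.append h hz hz'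
  convert this using 1
  funext i
  refine Fin.addCases (fun i => ?_) (fun i => ?_) i
  · rw [Fin.append_left, Fin.append_left]
  · rw [Fin.append_right, Fin.append_right]

section Coinvariants

variable {𝕜 : Type u} [RCLike 𝕜] {d : ℕ} {M : Type u} [TopologicalSpace M]
  [ChartedSpace (EuclideanSpace ℝ (Fin d)) M] {V : PreBundle 𝕜 M}
  {ε : ∀ n, Equiv.Perm (Fin n) →* ℤˣ}

/-- The projection from tensors to coinvariants at a configuration. -/
abbrev coinvProj (ε : ∀ n, Equiv.Perm (Fin n) →* ℤˣ) (V : PreBundle 𝕜 M) (x : UConf M) :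
    (cauchyTensorBundle d V).Fib x →ₗ[𝕜] (cauchyCoinvariants d ε V).Fib x :=
  (toCoinvariants d ε V).toFun x

/-- The linear map on coinvariants induced by an invariant linear map on tensors. -/
def coinvLift {x : UConf M} {Z : Type*} [AddCommGroup Z] [Module 𝕜 Z]
    (f : (cauchyTensorBundle d V).Fib x →ₗ[𝕜] Z)
    (hf : ∀ n, ∀ r ∈ permRelations d (extendZero V) (ε n) x, f (ofPower d V n x r) = 0) :
    (cauchyCoinvariants d ε V).Fib x →ₗ[𝕜] Z :=
  DirectSum.toModule 𝕜 ℕ Z fun n =>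
    (permRelations d (extendZero V) (ε n) x).liftQ (f ∘ₗ ofPower d V n x) (hf n)

/-- The inclusion of the coinvariants of tensors of length `n`. -/
def ofCoinv (ε : ∀ n, Equiv.Perm (Fin n) →* ℤˣ) (V : PreBundle 𝕜 M) (n : ℕ) (x : UConf M) :
    ((cauchyPower d (extendZero V) n).Fib x ⧸ permRelations d (extendZero V) (ε n) x) →ₗ[𝕜]
      (cauchyCoinvariants d ε V).Fib x :=
  DirectSum.lof 𝕜 ℕ (fun n => (cauchyPower d (extendZero V) n).Fib x ⧸
    permRelations d (extendZero V) (ε n) x) n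

theorem coinvProj_ofPower {n : ℕ} {x : UConf M} (t : (cauchyPower d (extendZero V) n).Fib x) :
    coinvProj ε V x (ofPower d V n x t) = ofCoinv ε V n x (Submodule.Quotient.mk t) :=
  DirectSum.lmap_lof (R := 𝕜) (M := fun n => (cauchyPower d (extendZero V) n).Fib x) _ _ _

theorem coinvLift_proj {x : UConf M} {Z : Type*} [AddCommGroup Z] [Module 𝕜 Z]
    (f : (cauchyTensorBundle d V).Fib x →ₗ[𝕜] Z)
    (hf : ∀ n, ∀ r ∈ permRelations d (extendZero V) (ε n) x, f (ofPower d V n x r) = 0)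
    (t : (cauchyTensorBundle d V).Fib x) : coinvLift f hf (coinvProj ε V x t) = f t := by
  induction t using ofPower_induction with
  | zero => simp only [map_zero]
  | add s t hs ht => simp only [map_add, hs, ht]
  | ofPower n t =>
    rw [coinvProj_ofPower]
    exact DirectSum.toModule_lof (R := 𝕜) (M := fun n => (cauchyPower d (extendZero V) n).Fib x ⧸
      permRelations d (extendZero V) (ε n) x) _ _

theorem coinvProj_surjective (x : UConf M) : Function.Surjective (coinvProj (d := d) ε V x) := by
  intro q
  refine DirectSum.induction_on (motive := fun q => ∃ t, coinvProj (d := d) ε V x t = q) q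
    ⟨0, map_zero _⟩ (fun n q => ?_) ?_
  · obtain ⟨t, rfl⟩ := Submodule.Quotient.mk_surjective _ q
    exact ⟨ofPower d V n x t, coinvProj_ofPower t⟩
  · rintro _ _ ⟨s, rfl⟩ ⟨t, rfl⟩
    exact ⟨s + t, map_add _ _ _⟩

theorem coinvProj_relation {n : ℕ} {x : UConf M} {r : (cauchyPower d (extendZero V) n).Fib x}
    (hr : r ∈ permRelations d (extendZero V) (ε n) x) :
    coinvProj ε V x (ofPower d V n x r) = 0 := by
  rw [coinvProj_ofPower, (Submodule.Quotient.mk_eq_zero _).2 hr, map_zero]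

theorem ofPower_relation {n : ℕ} {p : Fin n → UConf M} {x : UConf M} (h : IsMultisplit p x)
    (v : ∀ i, (extendZero V).Fib (p i)) (σ : Equiv.Perm (Fin n)) :
    ofPower d V n x (word d h v - ((ε n σ : ℤˣ) : ℤ) • word d (h.perm σ) fun i => v (σ i)) =
      listWord d (List.ofFn fun i => (⟨p i, v i⟩ : Letter V)) x -
        ((ε n σ : ℤˣ) : ℤ) •
          listWord d (List.ofFn ((fun i => (⟨p i, v i⟩ : Letter V)) ∘ σ)) x := by
  rw [map_sub, map_zsmul, ofPower_word, ofPower_word]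
  rfl

theorem coinvProj_listWord_perm {n : ℕ} {z : Fin n → Letter V} {x : UConf M}
    (hz : IsMultisplit (fun i => (z i).1) x) (σ : Equiv.Perm (Fin n)) :
    coinvProj ε V x (listWord d (List.ofFn z) x) =
      ((ε n σ : ℤˣ) : ℤ) • coinvProj ε V x (listWord d (List.ofFn (z ∘ σ)) x) := by
  rw [← sub_eq_zero, ← map_zsmul, ← map_sub]
  have h := ofPower_relation (d := d) (ε := ε) hz (fun i => (z i).2) σ
  refine (congrArg _ h.symm).trans (coinvProj_relation (Submodule.subset_span
    ⟨_, hz, fun i => (z i).2, σ, rfl⟩))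

variable {e : ℤˣ}

theorem tensorMul_ofFn {k l : ℕ} {z : Fin k → Letter V} {z' : Fin l → Letter V}
    {x a b : UConf M} (h : IsSplit x a b) (hz : IsMultisplit (fun i => (z i).1) a) :
    tensorMul h (listWord d (List.ofFn z) a) (listWord d (List.ofFn z') b) =
      listWord d (List.ofFn (Fin.append z z')) x := by
  rw [tensorMul_listWord h hz.spells, List.ofFn_fin_append]

/-- Permuting the two factors separately is a block permutation of the concatenated word, whose
character is the product of the two characters. -/
theorem coinvProj_tensorMul_perm (hε : IsCharacterFamily ε e) {k l : ℕ} {z : Fin k → Letter V}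
    {z' : Fin l → Letter V} {x a b : UConf M} (h : IsSplit x a b)
    (hz : IsMultisplit (fun i => (z i).1) a) (hz' : IsMultisplit (fun i => (z' i).1) b)
    (σ : Equiv.Perm (Fin k)) (τ : Equiv.Perm (Fin l)) :
    coinvProj ε V x (tensorMul h (listWord d (List.ofFn z) a) (listWord d (List.ofFn z') b)) =
      ((ε k σ * ε l τ : ℤˣ) : ℤ) • coinvProj ε V x (tensorMul h
        (listWord d (List.ofFn (z ∘ σ)) a) (listWord d (List.ofFn (z' ∘ τ)) b)) := by
  rw [tensorMul_ofFn h hz, tensorMul_ofFn (z := z ∘ σ) h (hz.perm σ), ← Fin.append_comp_permCongr,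
    ← hε.sumCongr]
  exact coinvProj_listWord_perm (IsMultisplit.append_letters h hz hz') _

/-- With its mirror image, this says that the relations form a two-sided ideal. By linearity the
other factor may be taken to be a word, which is left unpermuted. -/
theorem coinvProj_mul_relation_left (hε : IsCharacterFamily ε e) {x a b : UConf M}
    (h : IsSplit x a b) {n : ℕ} {r : (cauchyPower d (extendZero V) n).Fib a}
    (hr : r ∈ permRelations d (extendZero V) (ε n) a) (t : (cauchyTensorBundle d V).Fib b) :
    coinvProj ε V x (tensorMul h (ofPower d V n a r) t) = 0 := by
  suffices permRelations d (extendZero V) (ε n) a ≤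
      LinearMap.ker (((coinvProj ε V x ∘ₗ (tensorMul h).flip t)) ∘ₗ ofPower d V n a) from this hr
  refine Submodule.span_le.2 ?_
  rintro _ ⟨p, hp, v, σ, rfl⟩
  suffices coinvProj ε V x ∘ₗ tensorMul h (ofPower d V n a (word d hp v -
      ((ε n σ : ℤˣ) : ℤ) • word d (hp.perm σ) fun i => v (σ i))) = 0 from
    LinearMap.congr_fun this t
  refine LinearMap.ext_on (listWord_span b) ?_
  rintro _ ⟨l, z, hz, rfl⟩
  have := coinvProj_tensorMul_perm (d := d) hε h (z := fun i => (⟨p i, v i⟩ : Letter V)) hp hz σ 1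
  rw [LinearMap.comp_apply, ofPower_relation, LinearMap.zero_apply]
  simp only [map_sub, map_zsmul, LinearMap.sub_apply, LinearMap.smul_apply]
  rw [this, map_one, mul_one]
  exact sub_self _

theorem coinvProj_mul_relation_right (hε : IsCharacterFamily ε e) {x a b : UConf M}
    (h : IsSplit x a b) {n : ℕ} {r : (cauchyPower d (extendZero V) n).Fib b}
    (hr : r ∈ permRelations d (extendZero V) (ε n) b) (t : (cauchyTensorBundle d V).Fib a) :
    coinvProj ε V x (tensorMul h t (ofPower d V n b r)) = 0 := by
  suffices permRelations d (extendZero V) (ε n) b ≤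
      LinearMap.ker (((coinvProj ε V x ∘ₗ tensorMul h t)) ∘ₗ ofPower d V n b) from this hr
  refine Submodule.span_le.2 ?_
  rintro _ ⟨p, hp, v, σ, rfl⟩
  suffices coinvProj ε V x ∘ₗ (tensorMul h).flip (ofPower d V n b (word d hp v -
      ((ε n σ : ℤˣ) : ℤ) • word d (hp.perm σ) fun i => v (σ i))) = 0 from
    LinearMap.congr_fun this t
  refine LinearMap.ext_on (listWord_span a) ?_
  rintro _ ⟨l, z, hz, rfl⟩
  have := coinvProj_tensorMul_perm (d := d) hε h (z' := fun i => (⟨p i, v i⟩ : Letter V)) hz hp 1 σ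
  rw [LinearMap.comp_apply, ofPower_relation, LinearMap.zero_apply, LinearMap.flip_apply]
  simp only [map_sub, map_zsmul]
  rw [this, map_one, one_mul]
  exact sub_self _

/-- The product of coinvariants. -/
def coinvMul (hε : IsCharacterFamily ε e) {x a b : UConf M} (h : IsSplit x a b) :
    (cauchyCoinvariants d ε V).Fib a →ₗ[𝕜] (cauchyCoinvariants d ε V).Fib b →ₗ[𝕜]
      (cauchyCoinvariants d ε V).Fib x :=
  -- The inner lift descends in the second factor, the outer one in the first.
  coinvLift
    { toFun := fun t => coinvLift (coinvProj ε V x ∘ₗ tensorMul h t)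
        fun _ _ hr => coinvProj_mul_relation_right hε h hr t
      map_add' := fun s t => LinearMap.ext fun q => by
        obtain ⟨v, rfl⟩ := coinvProj_surjective _ q
        simp only [coinvLift_proj, LinearMap.add_apply, map_add, LinearMap.comp_apply]
      map_smul' := fun c t => LinearMap.ext fun q => by
        obtain ⟨v, rfl⟩ := coinvProj_surjective _ q
        simp only [coinvLift_proj, LinearMap.smul_apply, map_smul, LinearMap.comp_apply,
          RingHom.id_apply] }
    fun _ _ hr => LinearMap.ext fun q => by
      obtain ⟨v, rfl⟩ := coinvProj_surjective _ q
      exact (coinvLift_proj _ _ _).trans (coinvProj_mul_relation_left hε h hr v)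

theorem coinvMul_proj (hε : IsCharacterFamily ε e) {x a b : UConf M} (h : IsSplit x a b)
    (s : (cauchyTensorBundle d V).Fib a) (t : (cauchyTensorBundle d V).Fib b) :
    coinvMul hε h (coinvProj ε V a s) (coinvProj ε V b t) = coinvProj ε V x (tensorMul h s t) := by
  rw [coinvMul, coinvLift_proj]
  exact coinvLift_proj _ _ _

/-- The component of length `n` of a coinvariant. -/
def coinvComp (ε : ∀ n, Equiv.Perm (Fin n) →* ℤˣ) (V : PreBundle 𝕜 M) (n : ℕ) (x : UConf M) :
    (cauchyCoinvariants d ε V).Fib x →ₗ[𝕜]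
      ((cauchyPower d (extendZero V) n).Fib x ⧸ permRelations d (extendZero V) (ε n) x) :=
  DirectSum.component 𝕜 ℕ (fun n => (cauchyPower d (extendZero V) n).Fib x ⧸
    permRelations d (extendZero V) (ε n) x) n

theorem coinvComp_same {n : ℕ} {x : UConf M}
    (q : (cauchyPower d (extendZero V) n).Fib x ⧸ permRelations d (extendZero V) (ε n) x) :
    coinvComp ε V n x (ofCoinv ε V n x q) = q :=
  DirectSum.component.lof_self (R := 𝕜) (M := fun n => (cauchyPower d (extendZero V) n).Fib x ⧸
    permRelations d (extendZero V) (ε n) x) n q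

theorem smoothAt_coinv_iff {s : ∀ y, (cauchyCoinvariants d ε V).Fib y} {x : UConf M} :
    (cauchyCoinvariants d ε V).SmoothAt s x ↔ ∀ n,
      ((cauchyPower d (extendZero V) n).quotient
        (permRelations d (extendZero V) (ε n))).SmoothAt (fun y => coinvComp ε V n y (s y)) x :=
  Iff.rfl

theorem eq_ofCoinv {n : ℕ} {x : UConf M} (h : x.card = n) (q : (cauchyCoinvariants d ε V).Fib x) :
    q = ofCoinv ε V n x (coinvComp ε V n x q) := by
  obtain ⟨t, rfl⟩ := coinvProj_surjective _ q
  rw [eq_ofPower h t, coinvProj_ofPower, coinvComp_same]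

variable [T2Space M]

theorem isSmoothModule_coinv : IsSmoothModule d (cauchyCoinvariants d ε V) :=
  isSmoothModule_dsum fun n => isSmoothModule_quotient (isSmoothModule_cauchyPower _ n) _

/-- Smoothness gives a lift for each length separately; near `x` the length `x.card` is the only one
that occurs, so one lift is enough. -/
theorem exists_lift {s : ∀ y, (cauchyCoinvariants d ε V).Fib y} {x : UConf M}
    (hs : (cauchyCoinvariants d ε V).SmoothAt s x) :
    ∃ t, (cauchyTensorBundle d V).SmoothAt t x ∧ ∀ᶠ y in 𝓝 x, s y = coinvProj ε V y (t y) := by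
  obtain ⟨t, ht, he⟩ := smoothAt_coinv_iff.1 hs x.card
  refine ⟨_, smoothAt_ofPower ht, ?_⟩
  filter_upwards [he, eventually_card_eq x] with y hy hc
  rw [eq_ofCoinv hc (s y), hy, coinvProj_ofPower]
  rfl

/-- The multiplication of coinvariants as a bundle map. -/
def coinvMulHom (hε : IsCharacterFamily ε e) (V : PreBundle 𝕜 M) :
    BundleHom (cauchy d (cauchyCoinvariants d ε V) (cauchyCoinvariants d ε V))
      (cauchyCoinvariants d ε V) where
  toFun x := cauchyLift d fun q => coinvMul hε q.2
  smooth s x hs := by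
    refine smoothAt_of_csec isSmoothModule_coinv _ (fun U v w hU hv hw => ?_) hs
    obtain ⟨v', hv', hev⟩ := exists_lift hv
    obtain ⟨w', hw', hew⟩ := exists_lift hw
    refine isSmoothModule_coinv.congr ((toCoinvariants d ε V).smooth _ x
      (smoothAt_tensorMul hU hv' hw')) ?_
    filter_upwards [eventually_restr hU hev, eventually_restr hU.compl hew] with y h1 h2
    rw [csec, cauchyLift_tmul, h1, h2, coinvMul_proj]

theorem mulAt_coinvMulHom (hε : IsCharacterFamily ε e) {x a b : UConf M} (h : IsSplit x a b)
    (s : (cauchyTensorBundle d V).Fib a) (t : (cauchyTensorBundle d V).Fib b) :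
    mulAt d (coinvMulHom hε V) h (coinvProj ε V a s) (coinvProj ε V b t) =
      coinvProj ε V x (tensorMul h s t) :=
  (cauchyLift_tmul _ _ _ _).trans (coinvMul_proj hε h s t)

/-- The algebra of coinvariants. -/
def coinvAlgebra (hε : IsCharacterFamily ε e) (V : PreBundle 𝕜 M) :
    CauchyAlgebra d (cauchyCoinvariants d ε V) where
  mul := coinvMulHom hε V
  one := (toCoinvariants d ε V).comp (tensorUnit V)
  assoc hab hx hbc hx' u v w := by
    obtain ⟨u, rfl⟩ := coinvProj_surjective _ u
    obtain ⟨v, rfl⟩ := coinvProj_surjective _ v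
    obtain ⟨w, rfl⟩ := coinvProj_surjective _ w
    simp only [mulAt_coinvMulHom, tensorMul_assoc hab hx hbc hx']
  one_mul u := by
    obtain ⟨u, rfl⟩ := coinvProj_surjective _ u
    exact (mulAt_coinvMulHom hε _ _ _).trans (congrArg _ (tensorMul_one_left u))
  mul_one u := by
    obtain ⟨u, rfl⟩ := coinvProj_surjective _ u
    exact (mulAt_coinvMulHom hε _ _ _).trans (congrArg _ (tensorMul_one_right u))

theorem mulAt_coinvAlgebra (hε : IsCharacterFamily ε e) {x a b : UConf M} (h : IsSplit x a b)
    (s : (cauchyTensorBundle d V).Fib a) (t : (cauchyTensorBundle d V).Fib b) :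
    mulAt d (coinvAlgebra hε V).mul h (coinvProj ε V a s) (coinvProj ε V b t) =
      coinvProj ε V x (tensorMul h s t) :=
  mulAt_coinvMulHom hε h s t

theorem isAlgebraHom_toCoinvariants (hε : IsCharacterFamily ε e) :
    IsAlgebraHom (tensorAlgebra V) (coinvAlgebra hε V) (toCoinvariants d ε V) := by
  refine ⟨fun h u v => ?_, rfl⟩
  rw [mulAt_tensorAlgebra]
  exact (mulAt_coinvAlgebra hε h u v).symm

end Coinvariants

/-! ### Signed permutations of products -/

section SignedProducts

variable {R : Type*} [Ring R] {e : ℤˣ}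

/-- Either the first two factors are exchanged, or the first factor is peeled off and the induction
hypothesis applies. -/
theorem prod_ofFn_swap {n : ℕ} (i : Fin n) (z : Fin (n + 1) → R)
    (hz : ∀ j k, z j * z k = (e : ℤ) • (z k * z j)) :
    (List.ofFn z).prod = (e : ℤ) • (List.ofFn (z ∘ Equiv.swap i.castSucc i.succ)).prod := by
  induction n with
  | zero => exact i.elim0
  | succ n ih =>
    refine Fin.cases ?_ (fun i => ?_) i
    · have h1 : (z ∘ Equiv.swap (Fin.castSucc (0 : Fin (n + 1))) (Fin.succ 0)) 0 = z 1 := by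
        simp
      have h2 : (z ∘ Equiv.swap (Fin.castSucc (0 : Fin (n + 1))) (Fin.succ 0)) (Fin.succ 0)
          = z 0 := by simp
      have h3 : ∀ k : Fin n, (z ∘ Equiv.swap (Fin.castSucc (0 : Fin (n + 1))) (Fin.succ 0))
          k.succ.succ = z k.succ.succ := fun k => by
        rw [Function.comp, Equiv.swap_apply_of_ne_of_ne]
        · exact Fin.succ_ne_zero _
        · exact fun h => Fin.succ_ne_zero _ (Fin.succ_injective _ h)
      rw [List.ofFn_succ, List.ofFn_succ, List.ofFn_succ (f := z ∘ _), List.ofFn_succ, h1, h2]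
      simp only [h3, List.prod_cons, ← mul_assoc]
      rw [show z (Fin.succ 0) = z 1 from rfl, hz 0 1, smul_mul_assoc]
    · have h1 : (z ∘ Equiv.swap i.succ.castSucc i.succ.succ) 0 = z 0 := by
        rw [Function.comp, Equiv.swap_apply_of_ne_of_ne]
        · exact (Fin.succ_ne_zero i.castSucc).symm
        · exact (Fin.succ_ne_zero _).symm
      have h2 : (fun k : Fin (n + 1) => (z ∘ Equiv.swap i.succ.castSucc i.succ.succ) k.succ) =
          (fun k => z k.succ) ∘ Equiv.swap i.castSucc i.succ := by
        funext k
        simp only [Function.comp]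
        rw [← Fin.succ_castSucc]
        congr 1
        simp only [Equiv.swap_apply_def, Fin.succ_inj]
        split_ifs <;> rfl
      rw [List.ofFn_succ, List.ofFn_succ (f := z ∘ _), h1, h2, List.prod_cons, List.prod_cons,
        ih i _ fun j k => hz j.succ k.succ, mul_smul_comm]

/-- The permutations with this property are closed under products, and adjacent transpositions
generate the symmetric group as a monoid. -/
theorem IsCharacterFamily.prod_ofFn_perm {ε : ∀ n, Equiv.Perm (Fin n) →* ℤˣ}
    (hε : IsCharacterFamily ε e) {n : ℕ} (z : Fin n → R)
    (hz : ∀ j k, z j * z k = (e : ℤ) • (z k * z j)) (σ : Equiv.Perm (Fin n)) :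
    (List.ofFn z).prod = ((ε n σ : ℤˣ) : ℤ) • (List.ofFn (z ∘ σ)).prod := by
  cases n with
  | zero =>
    obtain rfl : σ = 1 := Subsingleton.elim _ _
    simp
  | succ n =>
    have hσ : σ ∈ Submonoid.closure (Set.range fun i : Fin n => Equiv.swap i.castSucc i.succ) := by
      rw [Equiv.Perm.mclosure_swap_castSucc_succ]; exact Submonoid.mem_top σ
    induction hσ using Submonoid.closure_induction generalizing z with
    | mem σ h =>
      obtain ⟨i, rfl⟩ := h
      simp only [hε.swap i]
      exact prod_ofFn_swap i z hz
    | one => simp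
    | mul σ τ _ _ hσ hτ =>
      rw [hσ z hz, hτ (z ∘ σ) fun j k => hz _ _, smul_smul, map_mul, Units.val_mul]
      rfl

/-- Moving one factor past `L'` costs `e ^ L'.length`, and this is paid once for each element of
`L`. -/
theorem prod_map_mul_prod_map {ι : Type*} (o : ι → R)
    (ho : ∀ u v, o u * o v = (e : ℤ) • (o v * o u)) (L L' : List ι) :
    (L.map o).prod * (L'.map o).prod =
      ((e ^ (L.length * L'.length) : ℤˣ) : ℤ) • ((L'.map o).prod * (L.map o).prod) := by
  have key : ∀ u (L' : List ι), o u * (L'.map o).prod =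
      ((e ^ L'.length : ℤˣ) : ℤ) • ((L'.map o).prod * o u) := by
    intro u L'
    induction L' with
    | nil => simp
    | cons v L' ih =>
      rw [List.map_cons, List.prod_cons, ← mul_assoc, ho u v, smul_mul_assoc, mul_assoc, ih,
        mul_smul_comm, smul_smul, mul_assoc, List.length_cons, pow_succ', Units.val_mul]
  induction L with
  | nil => simp
  | cons u L ih =>
    rw [List.map_cons, List.prod_cons, mul_assoc, ih, mul_smul_comm, ← mul_assoc, key u L',
      smul_mul_assoc, smul_smul, mul_assoc, List.length_cons, ← Units.val_mul, ← pow_add]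
    congr 4
    ring

end SignedProducts

/-! ### The universal property -/

theorem isSplit_empty_right {M : Type u} (x : UConf M) : IsSplit x x ∅ := (IsSplit.left_empty x).symm

section Universal

variable {𝕜 : Type u} [RCLike 𝕜] {d : ℕ} {M : Type u} [TopologicalSpace M]
  [ChartedSpace (EuclideanSpace ℝ (Fin d)) M] {V : PreBundle 𝕜 M}
  {ε : ∀ n, Equiv.Perm (Fin n) →* ℤˣ} {e : ℤˣ}

theorem BundleHom.ext' {X : Type u} {A B : PreBundle 𝕜 X} {f g : BundleHom A B}
    (h : ∀ x v, f.toFun x v = g.toFun x v) : f = g := by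
  cases f; cases g
  congr
  funext x
  exact LinearMap.ext (h x)

/-- The bilinear map underlying `mulAt`. -/
def mulAtₗ {A : PreBundle 𝕜 (UConf M)} (m : BundleHom (cauchy d A A) A) {x a b : UConf M}
    (h : IsSplit x a b) : A.Fib a →ₗ[𝕜] A.Fib b →ₗ[𝕜] A.Fib x :=
  (cauchyTmulₗ d h).compr₂ (m.toFun x)

theorem mulAtₗ_apply {A : PreBundle 𝕜 (UConf M)} (m : BundleHom (cauchy d A A) A)
    {x a b : UConf M} (h : IsSplit x a b) (u : A.Fib a) (v : A.Fib b) :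
    mulAtₗ m h u v = mulAt d m h u v :=
  congrArg (m.toFun x) (cauchyTmulₗ_apply h u v)

/-! ### Multiplication operators on sections. -/

section Operators

variable {A : PreBundle 𝕜 (UConf M)} (mA : CauchyAlgebra d A)

open Classical in
/-- Left multiplication by an element as an operator on sections. -/
def leftMul {a : UConf M} (u : A.Fib a) : Module.End 𝕜 (∀ x, A.Fib x) :=
  LinearMap.pi fun x =>
    -- The value zero where `a` is not contained in `x` makes the partial product a total operator.
    if h : IsSplit x a (restr (↑a)ᶜ x) then mulAtₗ mA.mul h u ∘ₗ LinearMap.proj _ else 0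

theorem leftMul_apply {x a b : UConf M} (h : IsSplit x a b) (u : A.Fib a) (s : ∀ x, A.Fib x) :
    leftMul mA u s x = mulAt d mA.mul h u (s b) := by
  have h' := isSplit_compl h.left_subset
  obtain rfl := h.eq_of_left h'
  rw [leftMul, LinearMap.pi_apply, dif_pos h', ← mulAtₗ_apply]
  rfl

theorem leftMul_apply_of_not {x a : UConf M} (h : ¬ ∃ b, IsSplit x a b) (u : A.Fib a)
    (s : ∀ x, A.Fib x) : leftMul mA u s x = 0 := by
  rw [leftMul, LinearMap.pi_apply, dif_neg fun h' => h ⟨_, h'⟩]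
  rfl

theorem leftMul_leftMul_of_not {x a b : UConf M} (h : ¬ ∃ y c, IsSplit x a y ∧ IsSplit y b c)
    (u : A.Fib a) (v : A.Fib b) (s : ∀ x, A.Fib x) : leftMul mA u (leftMul mA v s) x = 0 := by
  by_cases hx : ∃ y, IsSplit x a y
  · obtain ⟨y, hy⟩ := hx
    rw [leftMul_apply mA hy, leftMul_apply_of_not mA fun ⟨c, hc⟩ => h ⟨y, c, hy, hc⟩,
      ← mulAtₗ_apply, map_zero]
  · exact leftMul_apply_of_not mA hx _ _

/-- Supplies the intermediate configurations for exchanging `a` and `b` in `x = a ⊔ b ⊔ c`. -/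
theorem IsSplit.exchange {M : Type u} {x y a b c : UConf M} (hx : IsSplit x a y)
    (hy : IsSplit y b c) : ∃ ab z, IsSplit ab a b ∧ IsSplit x ab c ∧ IsSplit x b z ∧
      IsSplit z a c := by
  have hc := (isSplit_compl (hy.symm.left_subset.trans hx.symm.left_subset)).symm
  have hb := isSplit_compl (hy.left_subset.trans hx.symm.left_subset)
  have hab := hx.assoc_left hy hc
  exact ⟨_, _, hab, hc, hb, hc.assoc_right hab.symm hb⟩

/-- Associativity reduces both sides to products over `a ⊔ b`; where `a` and `b` do not fit
disjointly into `x`, both sides vanish. The relation thus also covers overlapping `a` and `b`, as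
the pairs `j = k` in `IsCharacterFamily.prod_ofFn_perm` require. -/
theorem leftMul_mul_leftMul {a b : UConf M} {u : A.Fib a} {v : A.Fib b}
    (huv : ∀ x (h : IsSplit x a b),
      mulAt d mA.mul h u v = (e : ℤ) • mulAt d mA.mul h.symm v u) :
    leftMul mA u * leftMul mA v = (e : ℤ) • (leftMul mA v * leftMul mA u) := by
  refine LinearMap.ext fun s => funext fun x => ?_
  change leftMul mA u (leftMul mA v s) x = (e : ℤ) • leftMul mA v (leftMul mA u s) x
  by_cases h : ∃ y c, IsSplit x a y ∧ IsSplit y b c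
  · obtain ⟨y, c, hy, hc⟩ := h
    obtain ⟨ab, z, hab, hx, hz, hz'⟩ := hy.exchange hc
    rw [leftMul_apply mA hy, leftMul_apply mA hc, ← mA.assoc hab hx hc hy, huv ab hab,
      leftMul_apply mA hz, leftMul_apply mA hz', ← mA.assoc hab.symm hx hz' hz,
      ← mulAtₗ_apply _ hx, map_zsmul, LinearMap.smul_apply, mulAtₗ_apply]
  · rw [leftMul_leftMul_of_not mA h, leftMul_leftMul_of_not mA, smul_zero]
    rintro ⟨y, c, hy, hc⟩
    obtain ⟨ab, z, hab, hx, hz, hz'⟩ := hy.exchange hc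
    exact h ⟨z, c, hz, hz'⟩ |>.elim

end Operators

theorem generator_eq_lmul {a b : UConf M} (h : IsSplit a a b) (u : (extendZero V).Fib a) :
    generator d V a u = lmul h u (tensorOne V b) := by
  rw [tensorOne, lmul_ofPower, generator, word_succ]
  obtain rfl := h.eq_of_left (IsMultisplit.single a).head
  rfl

theorem tensorMul_generator {x a b : UConf M} (h : IsSplit x a b) (u : (extendZero V).Fib a)
    (t : (cauchyTensorBundle d V).Fib b) :
    tensorMul h (generator d V a u) t = lmul h u t := by
  rw [generator_eq_lmul (isSplit_empty_right a), tensorMul_lmul h (isSplit_empty_right a) h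
    (IsSplit.left_empty b), tensorMul_one_left]

theorem tensorOne_eq_zero {x : UConf M} (hx : x ≠ ∅) : tensorOne (d := d) V x = 0 := by
  rw [tensorOne, power_zero_eq_zero hx (powerOne _ x), map_zero]

/-! ### Extension of bundle maps to tensors and to coinvariants. -/

section Extension

variable {A : PreBundle 𝕜 (UConf M)} {mA : CauchyAlgebra d A}

/-- The operator of multiplication by the image of a letter. -/
abbrev letterOp (mA : CauchyAlgebra d A) (θ : BundleHom (cauchyTensorBundle d V) A)
    (u : Letter V) : Module.End 𝕜 (∀ x, A.Fib x) :=
  leftMul mA (θ.toFun u.1 (generator d V u.1 u.2))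

/-- The images of letters commute up to the sign `e`. -/
def LettersCommute (e : ℤˣ) (mA : CauchyAlgebra d A) (θ : BundleHom (cauchyTensorBundle d V) A) :
    Prop :=
  ∀ (a b : UConf M) (u : (extendZero V).Fib a) (v : (extendZero V).Fib b) (x : UConf M)
    (h : IsSplit x a b),
    mulAt d mA.mul h (θ.toFun a (generator d V a u)) (θ.toFun b (generator d V b v)) =
      (e : ℤ) • mulAt d mA.mul h.symm (θ.toFun b (generator d V b v))
        (θ.toFun a (generator d V a u))

theorem LettersCommute.letterOp {θ : BundleHom (cauchyTensorBundle d V) A}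
    (hc : LettersCommute e mA θ) (u v : Letter V) :
    letterOp mA θ u * letterOp mA θ v = (e : ℤ) • (letterOp mA θ v * letterOp mA θ u) :=
  leftMul_mul_leftMul mA fun x h => hc _ _ _ _ x h

variable [T2Space M]

/-- The unit of an algebra as a section. -/
def sectionOne (mA : CauchyAlgebra d A) (x : UConf M) : A.Fib x :=
  mA.one.toFun x (powerOne (cauchyUnit d) x)

theorem map_lmul {θ : BundleHom (cauchyTensorBundle d V) A}
    (hθ : IsAlgebraHom (tensorAlgebra V) mA θ) {x a b : UConf M} (h : IsSplit x a b)
    (u : (extendZero V).Fib a) (t : (cauchyTensorBundle d V).Fib b) :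
    θ.toFun x (lmul h u t) =
      mulAt d mA.mul h (θ.toFun a (generator d V a u)) (θ.toFun b t) := by
  rw [← hθ.1, mulAt_tensorAlgebra, tensorMul_generator]

theorem map_tensorOne {θ : BundleHom (cauchyTensorBundle d V) A}
    (hθ : IsAlgebraHom (tensorAlgebra V) mA θ) (x : UConf M) :
    θ.toFun x (tensorOne V x) = sectionOne mA x := by
  by_cases hx : x = ∅
  · subst hx; exact hθ.2
  · rw [tensorOne_eq_zero hx, map_zero, sectionOne,
      power_zero_eq_zero (W := cauchyUnit d) hx (powerOne _ x)]
    exact (map_zero _).symm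

/-- No splitting hypothesis is needed: where a letter does not fit, the default value zero is taken
on both sides. -/
theorem map_listWord {θ : BundleHom (cauchyTensorBundle d V) A}
    (hθ : IsAlgebraHom (tensorAlgebra V) mA θ) (L : List (Letter V)) (x : UConf M) :
    θ.toFun x (listWord d L x) = (L.map (letterOp mA θ)).prod
      (sectionOne mA) x := by
  induction L generalizing x with
  | nil => exact map_tensorOne hθ x
  | cons u L ih =>
    rw [List.map_cons, List.prod_cons]
    change _ = leftMul mA _ ((L.map (letterOp mA θ)).prod _) x
    by_cases h : ∃ b, IsSplit x u.1 b
    · obtain ⟨b, hb⟩ := h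
      rw [listWord_cons u L hb, map_lmul hθ, leftMul_apply mA hb, ih]
    · rw [leftMul_apply_of_not mA h, listWord, dif_neg fun h' => h ⟨_, h'⟩, map_zero]

/-- Through `map_listWord` a relation becomes the rule for permuting a product of operators that
commute up to `e`. -/
theorem map_relation (hε : IsCharacterFamily ε e) {θ : BundleHom (cauchyTensorBundle d V) A}
    (hθ : IsAlgebraHom (tensorAlgebra V) mA θ) (hc : LettersCommute e mA θ) {x : UConf M} (n : ℕ)
    (r : (cauchyPower d (extendZero V) n).Fib x)
    (hr : r ∈ permRelations d (extendZero V) (ε n) x) :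
    θ.toFun x (ofPower d V n x r) = 0 := by
  suffices permRelations d (extendZero V) (ε n) x ≤
      LinearMap.ker (θ.toFun x ∘ₗ ofPower d V n x) from this hr
  refine Submodule.span_le.2 ?_
  rintro _ ⟨p, hp, v, σ, rfl⟩
  change θ.toFun x (ofPower d V n x _) = 0
  rw [ofPower_relation, map_sub, map_zsmul, map_listWord hθ, map_listWord hθ, List.map_ofFn,
    List.map_ofFn, hε.prod_ofFn_perm (letterOp mA θ ∘ fun i => (⟨p i, v i⟩ : Letter V))
      (fun j k => hc.letterOp _ _) σ, sub_eq_zero]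
  rfl

/-- Stated for any algebra map out of tensors; its use is with the projection, where it gives the
commutativity of the coinvariants. -/
theorem map_mul_eq {θ : BundleHom (cauchyTensorBundle d V) A}
    (hθ : IsAlgebraHom (tensorAlgebra V) mA θ) (hc : LettersCommute e mA θ) {x a b : UConf M}
    (h : IsSplit x a b) {k l : ℕ} (s : (cauchyPower d (extendZero V) k).Fib a)
    (t : (cauchyPower d (extendZero V) l).Fib b) :
    mulAt d mA.mul h (θ.toFun a (ofPower d V k a s)) (θ.toFun b (ofPower d V l b t)) =
      ((e ^ (k * l) : ℤˣ) : ℤ) • mulAt d mA.mul h.symm (θ.toFun b (ofPower d V l b t))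
        (θ.toFun a (ofPower d V k a s)) := by
  rw [← hθ.1, ← hθ.1, mulAt_tensorAlgebra, mulAt_tensorAlgebra]
  have hspan := fun n (y : UConf M) => word_span (d := d) (W := extendZero V)
    (fun _ => Set.univ) (fun _ => Submodule.span_univ) n y
  suffices H : (((tensorMul h).compl₁₂ (ofPower d V k a) (ofPower d V l b)).compr₂ (θ.toFun x)) =
      ((e ^ (k * l) : ℤˣ) : ℤ) • (((tensorMul h.symm).compl₁₂ (ofPower d V l b)
        (ofPower d V k a)).compr₂ (θ.toFun x)).flip from
    LinearMap.congr_fun (LinearMap.congr_fun H s) t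
  refine LinearMap.ext_on (hspan k a) ?_
  rintro _ ⟨p, hp, v, -, rfl⟩
  refine LinearMap.ext_on (hspan l b) ?_
  rintro _ ⟨q, hq, w, -, rfl⟩
  change θ.toFun x (tensorMul h (ofPower d V k a _) (ofPower d V l b _)) =
    ((e ^ (k * l) : ℤˣ) : ℤ) • θ.toFun x
      (tensorMul h.symm (ofPower d V l b _) (ofPower d V k a _))
  rw [ofPower_word, ofPower_word,
    tensorMul_listWord h (IsMultisplit.spells (z := fun i => (⟨p i, v i⟩ : Letter V)) hp),
    tensorMul_listWord h.symm (IsMultisplit.spells (z := fun i => (⟨q i, w i⟩ : Letter V)) hq),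
    map_listWord hθ, map_listWord hθ, List.map_append, List.map_append, List.prod_append,
    List.prod_append, prod_map_mul_prod_map _ hc.letterOp, List.length_ofFn, List.length_ofFn]
  rfl

/-- The extension of a bundle map to the powers. -/
def powerHom (mA : CauchyAlgebra d A) (f : BundleHom (extendZero V) A) :
    ∀ n, BundleHom (cauchyPower d (extendZero V) n) A
  | 0 => mA.one
  | n + 1 => mA.mul.comp (cauchyMap f (powerHom mA f n))

theorem powerHom_cons (mA : CauchyAlgebra d A) (f : BundleHom (extendZero V) A) {n : ℕ}
    {x a b : UConf M} (h : IsSplit x a b) (u : (extendZero V).Fib a)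
    (t : (cauchyPower d (extendZero V) n).Fib b) :
    (powerHom mA f (n + 1)).toFun x (powerCons h u t) =
      mulAt d mA.mul h (f.toFun a u) ((powerHom mA f n).toFun b t) := by
  rw [powerCons_eq]
  exact congrArg _ (cauchyMap_tmul f (powerHom mA f n) h u t)

/-- The extension of a bundle map to tensors. -/
def tensorHom (hA : IsSmoothModule d A) (mA : CauchyAlgebra d A)
    (f : BundleHom (extendZero V) A) : BundleHom (cauchyTensorBundle d V) A where
  toFun x := tensorLift fun n => (powerHom mA f n).toFun x
  smooth s x hs := by
    -- Only the length `x.card` occurs near `x`.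
    refine hA.congr ((powerHom mA f x.card).smooth _ x (smoothAt_tensor_iff.1 hs x.card)) ?_
    filter_upwards [eventually_card_eq x] with y hy
    conv_lhs => rw [eq_ofPower hy (s y), tensorLift_ofPower]

variable (hA : IsSmoothModule d A)

theorem tensorHom_ofPower (f : BundleHom (extendZero V) A) {n : ℕ} {x : UConf M}
    (t : (cauchyPower d (extendZero V) n).Fib x) :
    (tensorHom hA mA f).toFun x (ofPower d V n x t) = (powerHom mA f n).toFun x t :=
  tensorLift_ofPower _ _

theorem tensorHom_lmul (f : BundleHom (extendZero V) A) {x a b : UConf M} (h : IsSplit x a b)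
    (u : (extendZero V).Fib a) (t : (cauchyTensorBundle d V).Fib b) :
    (tensorHom hA mA f).toFun x (lmul h u t) =
      mulAt d mA.mul h (f.toFun a u) ((tensorHom hA mA f).toFun b t) := by
  induction t using ofPower_induction with
  | zero => rw [map_zero, map_zero, map_zero, ← mulAtₗ_apply, map_zero]
  | add s t hs ht =>
    rw [map_add, map_add, hs, ht, map_add, ← mulAtₗ_apply, ← mulAtₗ_apply, ← mulAtₗ_apply,
      map_add]
  | ofPower n t =>
    rw [lmul_ofPower, tensorHom_ofPower, tensorHom_ofPower, powerHom_cons]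

theorem isAlgebraHom_tensorHom (f : BundleHom (extendZero V) A) :
    IsAlgebraHom (tensorAlgebra V) mA (tensorHom hA mA f) := by
  have hone : (tensorHom hA mA f).toFun ∅ (tensorOne V ∅) = oneAt d mA.one :=
    tensorHom_ofPower hA f _
  refine ⟨fun {x a b} h u v => ?_, hone⟩
  rw [mulAt_tensorAlgebra]
  induction u using tensor_induction generalizing x with
  | zero a => rw [map_zero, map_zero, LinearMap.zero_apply, map_zero, ← mulAtₗ_apply, map_zero,
      LinearMap.zero_apply]
  | add a s t hs ht =>
    rw [map_add, map_add, LinearMap.add_apply, map_add, hs h, ht h, ← mulAtₗ_apply,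
      ← mulAtₗ_apply, ← mulAtₗ_apply, map_add, LinearMap.add_apply]
  | smul a c t ht =>
    rw [map_smul, map_smul, LinearMap.smul_apply, map_smul, ht h, ← mulAtₗ_apply,
      ← mulAtₗ_apply, map_smul, LinearMap.smul_apply]
  | one =>
    obtain rfl := h.eq_of_empty
    rw [tensorMul_one_left, hone]
    exact (mA.one_mul _).symm
  | lmul a a₁ a₂ h₁ u t ih =>
    have hy := isSplit_compl (h₁.left_subset.trans h.left_subset)
    have h₂ := h.assoc_right h₁ hy
    rw [tensorMul_lmul h h₁ hy h₂, tensorHom_lmul, tensorHom_lmul, ih h₂, mA.assoc h₁ h h₂ hy]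

theorem tensorHom_generator (f : BundleHom (extendZero V) A) {a : UConf M}
    (u : (extendZero V).Fib a) :
    (tensorHom hA mA f).toFun a (generator d V a u) = f.toFun a u := by
  have hone : (tensorHom hA mA f).toFun ∅ (tensorOne V ∅) = oneAt d mA.one :=
    (isAlgebraHom_tensorHom hA f).2
  rw [generator_eq_lmul (isSplit_empty_right a), tensorHom_lmul, hone]
  exact mA.mul_one _

theorem lettersCommute_tensorHom {f : BundleHom (extendZero V) A}
    (hf : ∀ {x a b : UConf M} (h : IsSplit x a b) (u : (extendZero V).Fib a)
      (v : (extendZero V).Fib b), mulAt d mA.mul h (f.toFun a u) (f.toFun b v) =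
        (e : ℤ) • mulAt d mA.mul h.symm (f.toFun b v) (f.toFun a u)) :
    LettersCommute e mA (tensorHom hA mA f) := by
  intro a b u v x h
  rw [tensorHom_generator, tensorHom_generator]
  exact hf h u v

/-- The bundle map on coinvariants induced by an invariant bundle map on tensors. -/
def coinvHom (θ : BundleHom (cauchyTensorBundle d V) A)
    (hθ : ∀ x n, ∀ r ∈ permRelations d (extendZero V) (ε n) x,
      θ.toFun x (ofPower d V n x r) = 0) : BundleHom (cauchyCoinvariants d ε V) A where
  toFun x := coinvLift (θ.toFun x) (hθ x)
  smooth s x hs := by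
    obtain ⟨t, ht, he⟩ := exists_lift hs
    refine hA.congr (θ.smooth t x ht) ?_
    filter_upwards [he] with y hy
    rw [hy, coinvLift_proj]

theorem coinvHom_proj (θ : BundleHom (cauchyTensorBundle d V) A)
    (hθ : ∀ x n, ∀ r ∈ permRelations d (extendZero V) (ε n) x,
      θ.toFun x (ofPower d V n x r) = 0) {x : UConf M} (t : (cauchyTensorBundle d V).Fib x) :
    (coinvHom hA θ hθ).toFun x (coinvProj ε V x t) = θ.toFun x t :=
  coinvLift_proj _ _ _

theorem isAlgebraHom_coinvHom (hε : IsCharacterFamily ε e)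
    {θ : BundleHom (cauchyTensorBundle d V) A}
    (hθ : ∀ x n, ∀ r ∈ permRelations d (extendZero V) (ε n) x,
      θ.toFun x (ofPower d V n x r) = 0) (hm : IsAlgebraHom (tensorAlgebra V) mA θ) :
    IsAlgebraHom (coinvAlgebra hε V) mA (coinvHom hA θ hθ) := by
  refine ⟨fun {x a b} h u v => ?_, (coinvHom_proj hA θ hθ _).trans hm.2⟩
  obtain ⟨u, rfl⟩ := coinvProj_surjective _ u
  obtain ⟨v, rfl⟩ := coinvProj_surjective _ v
  rw [mulAt_coinvAlgebra, coinvHom_proj, coinvHom_proj, coinvHom_proj, ← hm.1,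
    mulAt_tensorAlgebra]

/-- The projection from tensors is onto, and tensors arise from the unit by multiplication with
letters. -/
theorem coinv_hom_ext (hε : IsCharacterFamily ε e)
    {φ ψ : BundleHom (cauchyCoinvariants d ε V) A}
    (hφ : IsAlgebraHom (coinvAlgebra hε V) mA φ) (hψ : IsAlgebraHom (coinvAlgebra hε V) mA ψ)
    (h : ∀ x v, φ.toFun x (coinvProj ε V x (generator d V x v)) =
      ψ.toFun x (coinvProj ε V x (generator d V x v))) : φ = ψ := by
  refine BundleHom.ext' fun x q => ?_
  obtain ⟨t, rfl⟩ := coinvProj_surjective _ q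
  induction t using tensor_induction with
  | zero => simp only [map_zero]
  | add x s t hs ht => simp only [map_add, hs, ht]
  | smul x c t ht => simp only [map_smul, ht]
  | one => exact hφ.2.trans hψ.2.symm
  | lmul x a b hs u t ih =>
    rw [← tensorMul_generator, ← mulAt_coinvAlgebra hε, hφ.1, hψ.1, h, ih]

end Extension

/-! ### Commutativity of the algebra of coinvariants -/

variable [T2Space M]

/-- This is the defining relation for a two-letter word and the transposition, whose character is
`e`. -/
theorem lettersCommute_coinv (hε : IsCharacterFamily ε e) :
    LettersCommute e (coinvAlgebra hε V) (toCoinvariants d ε V) := by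
  intro a b u v x h
  have h1 : ∀ {a b : UConf M} (h : IsSplit x a b) (u : (extendZero V).Fib a)
      (v : (extendZero V).Fib b), tensorMul h (generator d V a u) (generator d V b v) =
        listWord d [⟨a, u⟩, ⟨b, v⟩] x := fun {a b} h u v => by
    rw [tensorMul_generator, listWord_cons _ _ h, listWord_cons _ _ (isSplit_empty_right b),
      generator_eq_lmul (isSplit_empty_right b)]
    rfl
  refine (mulAt_coinvAlgebra hε h _ _).trans (Eq.trans ?_
    (congrArg _ (mulAt_coinvAlgebra hε h.symm _ _).symm))
  rw [h1, h1]
  have hz : IsMultisplit (fun i => ((![⟨a, u⟩, ⟨b, v⟩] : Fin 2 → Letter V) i).1) x := by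
    refine ⟨fun i j hij => ?_, fun y => ?_⟩
    · fin_cases i <;> fin_cases j
      · exact absurd rfl hij
      · exact h.1
      · exact h.1.symm
      · exact absurd rfl hij
    · rw [h.2, Fin.exists_fin_two]; rfl
  have h2 := coinvProj_listWord_perm (d := d) (ε := ε) hz (Equiv.swap (Fin.castSucc 0) (Fin.succ 0))
  rw [hε.swap (0 : Fin 1)] at h2
  exact h2

theorem mulAt_coinvAlgebra_comm (hε : IsCharacterFamily ε e) {x a b : UConf M}
    (h : IsSplit x a b) {k l : ℕ} (s : (cauchyPower d (extendZero V) k).Fib a)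
    (t : (cauchyPower d (extendZero V) l).Fib b) :
    mulAt d (coinvAlgebra hε V).mul h (coinvProj ε V a (ofPower d V k a s))
      (coinvProj ε V b (ofPower d V l b t)) = ((e ^ (k * l) : ℤˣ) : ℤ) •
        mulAt d (coinvAlgebra hε V).mul h.symm (coinvProj ε V b (ofPower d V l b t))
          (coinvProj ε V a (ofPower d V k a s)) :=
  map_mul_eq (isAlgebraHom_toCoinvariants hε) (lettersCommute_coinv hε) h s t

end Universal

/-! ### Coordinates on `i_* V` -/

section Coordinates

variable {𝕜 : Type u} [RCLike 𝕜] {M : Type u} {V : PreBundle 𝕜 M}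

open Classical in
/-- The coordinates on `i_* V` with respect to a frame of `V` over `U`, zero outside of `U`. -/
def coordFun {r : ℕ} (e : Fin r → ∀ z, V.Fib z) (U : Set M) (j : Fin r) (y : UConf M) :
    (extendZero V).Fib y →ₗ[𝕜] 𝕜 :=
  -- The frame property is part of the condition so that a basis is available to take coordinates
  -- in.
  if h : ∃ z ∈ U, y = {z} ∧ LinearIndependent 𝕜 (fun i => e i z) ∧
      ⊤ ≤ Submodule.span 𝕜 (Set.range fun i => e i z) then
    (Module.Basis.mk h.choose_spec.2.2.1 h.choose_spec.2.2.2).coord j ∘ₗ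
      LinearMap.proj (R := 𝕜) (φ := fun z : {z : M // y = {z}} => V.Fib z.1)
        ⟨h.choose, h.choose_spec.2.1⟩
  else 0

theorem coordFun_sum {r : ℕ} {e : Fin r → ∀ z, V.Fib z} {U : Set M} {j : Fin r} {z : M}
    (hz : z ∈ U) (hli : LinearIndependent 𝕜 (fun i => e i z))
    (hsp : Submodule.span 𝕜 (Set.range fun i => e i z) = ⊤) {c : Fin r → 𝕜}
    {u : (extendZero V).Fib {z}} (hu : u ⟨z, rfl⟩ = ∑ i, c i • e i z) :
    coordFun e U j {z} u = c j := by
  have h : ∃ z' ∈ U, ({z} : UConf M) = {z'} ∧ LinearIndependent 𝕜 (fun i => e i z') ∧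
      ⊤ ≤ Submodule.span 𝕜 (Set.range fun i => e i z') := ⟨z, hz, rfl, hli, hsp.ge⟩
  rw [coordFun, dif_pos h]
  -- The chosen point equals `z` only propositionally, hence the quantification over `z'`.
  have aux : ∀ (z' : M) (h1 : ({z} : UConf M) = {z'})
      (h2 : LinearIndependent 𝕜 (fun i => e i z'))
      (h3 : ⊤ ≤ Submodule.span 𝕜 (Set.range fun i => e i z')),
      (Module.Basis.mk h2 h3).coord j (u ⟨z', h1⟩) = c j := by
    intro z' h1 h2 h3
    obtain rfl : z = z' := Finset.singleton_injective h1
    rw [hu, map_sum, Finset.sum_eq_single j]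
    · rw [map_smul, Module.Basis.mk_coord_apply_eq, smul_eq_mul, mul_one]
    · intro i _ hij
      rw [map_smul, Module.Basis.mk_coord_apply_ne hij, smul_zero]
    · simp
  exact aux _ _ _ _

theorem coordFun_of_not {r : ℕ} {e : Fin r → ∀ z, V.Fib z} {U : Set M} {j : Fin r} {y : UConf M}
    (hy : ∀ z ∈ U, y ≠ {z}) : coordFun e U j y = 0 := by
  rw [coordFun, dif_neg]
  rintro ⟨z, hz, h, -⟩
  exact hy z hz h

end Coordinates

/-! ### Coefficient functionals -/

section Coefficients

variable {𝕜 : Type u} [RCLike 𝕜] {d : ℕ} {M : Type u} [TopologicalSpace M]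
  [ChartedSpace (EuclideanSpace ℝ (Fin d)) M]

open Classical in
/-- The linear functional on a power given by the product of functionals on the factors. -/
def powerCoef {W : PreBundle 𝕜 (UConf M)} : ∀ (n : ℕ) (_ : Fin n → ∀ y, W.Fib y →ₗ[𝕜] 𝕜)
    (x : UConf M), (cauchyPower d W n).Fib x →ₗ[𝕜] 𝕜
  | 0, _, x => if hx : x = ∅ then powerEval W hx else 0
  | n + 1, φ, _ => powerLift fun q =>
      (LinearMap.mul 𝕜 𝕜).compl₁₂ (φ 0 q.1.1) (powerCoef n (fun i => φ i.succ) q.1.2)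

section
variable {W : PreBundle 𝕜 (UConf M)}

theorem powerCoef_cons {n : ℕ} (φ : Fin (n + 1) → ∀ y, W.Fib y →ₗ[𝕜] 𝕜) {x a b : UConf M}
    (h : IsSplit x a b) (u : W.Fib a) (t : (cauchyPower d W n).Fib b) :
    powerCoef (n + 1) φ x (powerCons h u t) = φ 0 a u * powerCoef n (fun i => φ i.succ) b t := by
  rw [powerCoef, powerLift_cons]
  rfl

theorem powerCoef_word : ∀ {n : ℕ} (φ : Fin n → ∀ y, W.Fib y →ₗ[𝕜] 𝕜) {p : Fin n → UConf M}
    {x : UConf M} (h : IsMultisplit p x) (v : ∀ i, W.Fib (p i)),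
    powerCoef n φ x (word d h v) = ∏ i, φ i (p i) (v i)
  | 0, φ, p, x, h, v => by
    have hx : x = ∅ := by ext y; simp [h.2]
    rw [powerCoef, dif_pos hx, Fin.prod_univ_zero]
    exact powerEval_one (d := d) hx
  | n + 1, φ, p, x, h, v => by
    rw [word_succ, powerCoef_cons, powerCoef_word, Fin.prod_univ_succ]

/-- The functionals must be smooth at all subconfigurations of `x`, since the cuts of the recursion
evaluate them there. -/
theorem powerCoef_smoothAt [T2Space M] : ∀ {n : ℕ} {φ : Fin n → ∀ y, W.Fib y →ₗ[𝕜] 𝕜}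
    {x : UConf M} (_ : ∀ i, ∀ b ⊆ x, ∀ s, W.SmoothAt s b → USmoothAt d (fun y => φ i y (s y)) b)
    {s : ∀ y, (cauchyPower d W n).Fib y} (_ : (cauchyPower d W n).SmoothAt s x),
    USmoothAt d (fun y => powerCoef n φ y (s y)) x
  | 0, φ, x, hφ, s, ⟨g, hg, hs⟩ => by
    by_cases hx : x = ∅
    · refine hg.congr ?_
      filter_upwards [hs, eventually_card_eq x] with y hy hc
      rw [hx, Finset.card_empty, Finset.card_eq_zero] at hc
      rw [powerCoef, dif_pos hc, hy]
      rfl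
    · refine (USmoothAt.const 0 x).congr ?_
      filter_upwards [eventually_card_eq x] with y hc
      have hy : y ≠ ∅ := fun e => hx (by
        rw [e, Finset.card_empty] at hc
        exact Finset.card_eq_zero.1 hc.symm)
      rw [powerCoef, dif_neg hy]
      rfl
  | n + 1, φ, x, hφ, s, hs => by
    obtain ⟨ι, _, g, U, v, w, hj, he⟩ := exists_eq_sum_powerCons hs
    refine (USmoothAt.sum Finset.univ fun j _ => (hj j).1.mul
      ((USmoothAt.comp_restr (hj j).2.1 (hφ 0 _ (restr_subset _ _) _ (hj j).2.2.1)).mul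
      (USmoothAt.comp_restr (hj j).2.1.compl (powerCoef_smoothAt (φ := fun i => φ i.succ)
        (fun i b hb => hφ i.succ b (hb.trans (restr_subset _ _))) (hj j).2.2.2)))).congr ?_
    filter_upwards [he] with y hy
    rw [hy, map_sum]
    refine Finset.sum_congr rfl fun j _ => ?_
    rw [map_smul, powerCoef_cons, smul_eq_mul]

/-- The functional `v₁ ⊗ ⋯ ⊗ vₙ ↦ ∑ σ, ε(σ) ∏ i, φ_{σ(i)}(vᵢ)`. -/
def twistedCoef (ε : ∀ n, Equiv.Perm (Fin n) →* ℤˣ) {n : ℕ}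
    (φ : Fin n → ∀ y, W.Fib y →ₗ[𝕜] 𝕜) (x : UConf M) : (cauchyPower d W n).Fib x →ₗ[𝕜] 𝕜 :=
  ∑ σ : Equiv.Perm (Fin n), ((ε n σ : ℤˣ) : ℤ) • powerCoef n (fun i => φ (σ i)) x

variable {ε : ∀ n, Equiv.Perm (Fin n) →* ℤˣ}

theorem twistedCoef_word {n : ℕ} (φ : Fin n → ∀ y, W.Fib y →ₗ[𝕜] 𝕜) {p : Fin n → UConf M}
    {x : UConf M} (h : IsMultisplit p x) (v : ∀ i, W.Fib (p i)) :
    twistedCoef ε φ x (word d h v) =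
      ∑ σ : Equiv.Perm (Fin n), ((ε n σ : ℤˣ) : ℤ) • ∏ i, φ (σ i) (p i) (v i) := by
  rw [twistedCoef, LinearMap.sum_apply]
  exact Finset.sum_congr rfl fun σ _ => by rw [LinearMap.smul_apply, powerCoef_word]

/-- Reindexing the sum by right multiplication with `τ` produces a second factor `ε(τ)`, and `ε(τ)²
= 1`. -/
theorem twistedCoef_relation {n : ℕ} (φ : Fin n → ∀ y, W.Fib y →ₗ[𝕜] 𝕜) {x : UConf M}
    (r : (cauchyPower d W n).Fib x) (hr : r ∈ permRelations d W (ε n) x) :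
    twistedCoef ε φ x r = 0 := by
  suffices permRelations d W (ε n) x ≤ LinearMap.ker (twistedCoef ε φ x) from this hr
  refine Submodule.span_le.2 ?_
  rintro _ ⟨p, h, v, τ, rfl⟩
  change twistedCoef ε φ x _ = 0
  rw [map_sub, map_zsmul, twistedCoef_word, twistedCoef_word, sub_eq_zero, Finset.smul_sum]
  refine Fintype.sum_equiv (Equiv.mulRight τ) _ _ fun σ => ?_
  rw [smul_smul, Equiv.coe_mulRight, map_mul, Units.val_mul, mul_left_comm,
    ← Units.val_mul (ε n τ), Int.units_mul_self, Units.val_one, mul_one]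
  congr 1
  exact (Fintype.prod_equiv τ (fun i => φ (σ (τ i)) (p (τ i)) (v (τ i)))
    (fun i => φ (σ i) (p i) (v i)) fun i => rfl).symm

theorem twistedCoef_smoothAt [T2Space M] {n : ℕ} {φ : Fin n → ∀ y, W.Fib y →ₗ[𝕜] 𝕜}
    {x : UConf M} (hφ : ∀ i, ∀ b ⊆ x, ∀ s, W.SmoothAt s b → USmoothAt d (fun y => φ i y (s y)) b)
    {s : ∀ y, (cauchyPower d W n).Fib y} (hs : (cauchyPower d W n).SmoothAt s x) :
    USmoothAt d (fun y => twistedCoef ε φ y (s y)) x := by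
  have h := USmoothAt.sum Finset.univ fun (σ : Equiv.Perm (Fin n)) _ =>
    (USmoothAt.const (d := d) (((ε n σ : ℤˣ) : ℤ) : 𝕜) x).mul
      (powerCoef_smoothAt (fun i => hφ (σ i)) hs)
  refine h.congr (Filter.Eventually.of_forall fun y => ?_)
  rw [twistedCoef, LinearMap.sum_apply]
  exact Finset.sum_congr rfl fun σ _ => by rw [LinearMap.smul_apply, zsmul_eq_mul]

/-! ### Sections given by words -/

/-- The word with letters `sᵢ(y ∩ Uᵢ)`. -/
def wordSec : ∀ (n : ℕ) (_ : Fin n → Set M) (_ : Fin n → ∀ y, W.Fib y) (y : UConf M),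
    (cauchyPower d W n).Fib y
  | 0, _, _, y => powerOne W y
  | n + 1, U, s, y => powerCons (isSplit_restr (U 0) y) (s 0 (restr (U 0) y))
      (wordSec n (fun i => U i.succ) (fun i => s i.succ) (restr (U 0)ᶜ y))

theorem wordSec_smoothAt [T2Space M] : ∀ {n : ℕ} {U : Fin n → Set M} {s : Fin n → ∀ y, W.Fib y}
    {x : UConf M} (_ : ∀ i, CleanAt (U i) x)
    (_ : ∀ i, ∀ b ⊆ restr (U i) x, W.SmoothAt (s i) b),
    (cauchyPower d W n).SmoothAt (wordSec n U s) x
  | 0, _, _, x, _, _ => ⟨fun _ => 1, USmoothAt.const 1 x, Filter.Eventually.of_forall fun _ => rfl⟩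
  | n + 1, U, s, x, hU, hs => by
    refine smoothAt_powerCons (hU 0) (hs 0 _ (Finset.Subset.refl _))
      (wordSec_smoothAt (fun i => (hU i.succ).mono (restr_subset _ _)) fun i b hb =>
        hs i.succ b (hb.trans fun z hz => ?_))
    obtain ⟨h1, h2⟩ := mem_restr.1 hz
    exact mem_restr.2 ⟨restr_subset _ _ h1, h2⟩

theorem wordSec_eq_word : ∀ {n : ℕ} {U : Fin n → Set M} {s : Fin n → ∀ y, W.Fib y}
    {p : Fin n → UConf M} {y : UConf M} (h : IsMultisplit p y) (_ : ∀ i, p i = restr (U i) y),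
    wordSec n U s y = word d h fun i => s i (p i)
  | 0, _, _, _, _, _, _ => rfl
  | n + 1, U, s, p, y, h, hp => by
    rw [word_succ, wordSec]
    have aux : ∀ {a b : UConf M} (hs : IsSplit y a b), a = p 0 →
        powerCons hs (s 0 a) (wordSec n (fun i => U i.succ) (fun i => s i.succ) b) =
        powerCons h.head (s 0 (p 0)) (wordSec (d := d) n (fun i => U i.succ)
          (fun i => s i.succ) (unionOf fun i => p i.succ)) := by
      rintro a b hs rfl
      obtain rfl := hs.eq_of_left h.head
      rfl
    rw [aux _ (hp 0).symm, wordSec_eq_word h.tail]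
    intro i
    ext z
    have h1 := hp i.succ
    rw [mem_restr]
    constructor
    · intro hz
      refine ⟨(h.tail.2 z).2 ⟨i, hz⟩, ?_⟩
      rw [h1] at hz
      exact (mem_restr.1 hz).2
    · rintro ⟨hz, hzU⟩
      rw [h1]
      exact mem_restr.2 ⟨h.head.symm.left_subset hz, hzU⟩

end

/-! ### Local frames of `i_* V` -/

section Frames

variable {V : PreBundle 𝕜 M}

/-- The section of `i_* V` given by a section of `V`. -/
def extSec (s : ∀ z, V.Fib z) (y : UConf M) : (extendZero V).Fib y := fun z => s z.1

/-- `e` is a smooth frame of `V` over `U`. -/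
def IsFrameOn (d : ℕ) {M : Type u} [TopologicalSpace M] [ChartedSpace (EuclideanSpace ℝ (Fin d)) M]
    {V : PreBundle 𝕜 M} {r : ℕ} (e : Fin r → ∀ z, V.Fib z) (U : Set M) : Prop :=
  ∀ z ∈ U, (LinearIndependent 𝕜 (fun i => e i z) ∧
    Submodule.span 𝕜 (Set.range fun i => e i z) = ⊤) ∧
    ∀ s, V.SmoothAt s z ↔ ∃ c : Fin r → M → 𝕜, (∀ i, MSmoothAt d (c i) z) ∧
      ∀ᶠ z' in 𝓝 z, s z' = ∑ i, c i z' • e i z'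

theorem IsFrameOn.smoothAt {r : ℕ} {e : Fin r → ∀ z, V.Fib z} {U : Set M}
    (he : IsFrameOn d e U) (j : Fin r) {z : M} (hz : z ∈ U) : V.SmoothAt (e j) z := by
  refine ((he z hz).2 _).2 ⟨fun i _ => if i = j then 1 else 0, fun i => contMDiffAt_const,
    Filter.Eventually.of_forall fun z' => ?_⟩
  simp

theorem IsFrameOn.smoothAt_extSec {r : ℕ} {e : Fin r → ∀ z, V.Fib z} {U : Set M}
    (he : IsFrameOn d e U) (j : Fin r) {y : UConf M} (hy : ∀ z ∈ y, z ∈ U) :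
    (extendZero V).SmoothAt (extSec (e j)) y := by
  rintro z rfl
  exact he.smoothAt j (hy z (Finset.mem_singleton_self z))

theorem IsFrameOn.coordFun_extSec {r : ℕ} {e : Fin r → ∀ z, V.Fib z} {U : Set M}
    (he : IsFrameOn d e U) (j k : Fin r) {z : M} (hz : z ∈ U) :
    coordFun e U j {z} (extSec (e k) {z}) = if k = j then 1 else 0 :=
  coordFun_sum (c := fun i => if k = i then 1 else 0) hz (he z hz).1.1 (he z hz).1.2 (by
    simp [extSec])

/-- Cleanness of `U` excludes the frontier, where the extension by zero could jump. Inside `U` the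
coordinates are the coefficients in the frame; outside, or when `y` is not a single point, the
functional vanishes nearby. -/
theorem IsFrameOn.coordFun_smoothAt [T2Space M] {r : ℕ} {e : Fin r → ∀ z, V.Fib z} {U : Set M}
    (he : IsFrameOn d e U) (j : Fin r) {y : UConf M} (hy : CleanAt U y)
    {s : ∀ y, (extendZero V).Fib y} (hs : (extendZero V).SmoothAt s y) :
    USmoothAt d (fun y => coordFun e U j y (s y)) y := by
  by_cases h1 : ∃ z, y = {z}
  · obtain ⟨z, rfl⟩ := h1
    rcases hy z (Finset.mem_singleton_self z) with h | h
    · obtain ⟨c, hc, hce⟩ := ((he z (mem_of_mem_nhds h)).2 _).1 (hs z rfl)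
      refine USmoothAt.of_singleton (hc j) ?_
      filter_upwards [h, hce] with z' h1 h2
      exact coordFun_sum (c := fun i => c i z') h1 (he z' h1).1.1 (he z' h1).1.2 h2
    · refine (USmoothAt.const 0 _).congr ?_
      filter_upwards [eventually_forall_mem (x := {z}) (U := Uᶜ) fun a ha => by
        rwa [Finset.mem_singleton.1 ha]] with y' hy'
      rw [coordFun_of_not]
      · rfl
      · rintro z' hz' rfl
        exact hy' z' (Finset.mem_singleton_self z') hz'
  · refine (USmoothAt.const 0 _).congr ?_
    filter_upwards [eventually_card_eq y] with y' hy'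
    rw [coordFun_of_not]
    · rfl
    · rintro z' hz' rfl
      rw [Finset.card_singleton] at hy'
      exact h1 (Finset.card_eq_one.1 hy'.symm)

theorem IsFrameOn.span_extSec {r : ℕ} {e : Fin r → ∀ z, V.Fib z} {U : Set M}
    (he : IsFrameOn d e U) {z : M} (hz : z ∈ U) :
    Submodule.span 𝕜 (Set.range fun j => extSec (e j) {z}) = ⊤ := by
  let ev : (extendZero V).Fib {z} →ₗ[𝕜] V.Fib z :=
    LinearMap.proj (R := 𝕜) (φ := fun z' : {z' : M // ({z} : UConf M) = {z'}} => V.Fib z'.1) ⟨z, rfl⟩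
  have hinj : Function.Injective ev := by
    intro u v huv
    funext ⟨z', hz'⟩
    obtain rfl : z = z' := Finset.singleton_injective hz'
    exact huv
  refine eq_top_iff.2 fun u _ => ?_
  have h : ev u ∈ Submodule.map ev (Submodule.span 𝕜 (Set.range fun j => extSec (e j) {z})) := by
    rw [Submodule.map_span, ← Set.range_comp]
    have h' : ev u ∈ Submodule.span 𝕜 (Set.range fun i => e i z) := by
      rw [(he z hz).1.2]; exact Submodule.mem_top
    exact h'
  obtain ⟨u', hu', h⟩ := h
  rwa [hinj h] at hu'

end Frames

end Coefficients

/-! ### Local frames of the bundle of coinvariants -/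

section Selection

variable {M : Type u} {n : ℕ} {U : Fin n → Set M} {z : Fin n → M}

theorem injective_of_mem_disjoint (hd : Pairwise fun i j => Disjoint (U i) (U j))
    (hz : ∀ i, z i ∈ U i) : Function.Injective z := by
  intro i j hij
  by_contra h
  exact Set.disjoint_left.1 (hd h) (hz i) (hij ▸ hz j)

theorem restr_unorder_eq (hd : Pairwise fun i j => Disjoint (U i) (U j))
    (hz : ∀ i, z i ∈ U i) (i : Fin n) : restr (U i) (unorder z) = {z i} := by
  ext y
  rw [mem_restr, mem_unorder, Finset.mem_singleton]
  constructor
  · rintro ⟨⟨j, rfl⟩, hj⟩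
    by_contra h
    exact Set.disjoint_left.1 (hd fun e => h (by rw [e])) (hz j) hj
  · rintro rfl
    exact ⟨⟨i, rfl⟩, hz i⟩

theorem isMultisplit_singletons (hz : Function.Injective z) :
    IsMultisplit (fun i => ({z i} : UConf M)) (unorder z) := by
  refine ⟨fun i j hij => ?_, fun y => ?_⟩
  · exact Finset.disjoint_singleton.2 fun h => hij (hz h)
  · simp only [mem_unorder, Finset.mem_singleton, eq_comm]

theorem cleanAt_unorder [TopologicalSpace M] (hd : Pairwise fun i j => Disjoint (U i) (U j))
    (hU : ∀ i, IsOpen (U i)) (hz : ∀ i, z i ∈ U i) (i : Fin n) :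
    CleanAt (U i) (unorder z) := by
  intro a ha
  obtain ⟨j, rfl⟩ := mem_unorder.1 ha
  have hj := (hU j).mem_nhds (hz j)
  by_cases h : j = i
  · subst h; exact Or.inl hj
  · exact Or.inr (Filter.mem_of_superset hj fun y hy hy' => Set.disjoint_left.1 (hd h) hy hy')

end Selection

section CoinvFrame

variable {𝕜 : Type u} [RCLike 𝕜] {d : ℕ} {M : Type u} [TopologicalSpace M]
  [ChartedSpace (EuclideanSpace ℝ (Fin d)) M] {V : PreBundle 𝕜 M}
  {ε : ∀ n, Equiv.Perm (Fin n) →* ℤˣ} {n : ℕ} {U : Fin n → Set M} {r : Fin n → ℕ}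
  {e : ∀ i, Fin (r i) → ∀ z, V.Fib z}

/-- The frame of the bundle of coinvariants given by frames `eᵢ` of `V` over the sets `Uᵢ`. -/
def coinvFrame (d : ℕ) {M : Type u} [TopologicalSpace M]
    [ChartedSpace (EuclideanSpace ℝ (Fin d)) M] {V : PreBundle 𝕜 M}
    (ε : ∀ n, Equiv.Perm (Fin n) →* ℤˣ) {n : ℕ} (U : Fin n → Set M) {r : Fin n → ℕ}
    (e : ∀ i, Fin (r i) → ∀ z, V.Fib z) (J : ∀ i, Fin (r i)) (y : UConf M) :
    (cauchyCoinvariants d ε V).Fib y :=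
  coinvProj ε V y (ofPower d V n y (wordSec n U (fun i => extSec (e i (J i))) y))

/-- The coordinates with respect to `coinvFrame`. -/
def coinvCoord (d : ℕ) {M : Type u} [TopologicalSpace M]
    [ChartedSpace (EuclideanSpace ℝ (Fin d)) M] {V : PreBundle 𝕜 M}
    (ε : ∀ n, Equiv.Perm (Fin n) →* ℤˣ) {n : ℕ} (U : Fin n → Set M) {r : Fin n → ℕ}
    (e : ∀ i, Fin (r i) → ∀ z, V.Fib z) (J : ∀ i, Fin (r i)) (y : UConf M) :
    (cauchyCoinvariants d ε V).Fib y →ₗ[𝕜] 𝕜 :=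
  coinvLift (twistedCoef ε (fun i => coordFun (e i) (U i) (J i)) y ∘ₗ tensorComp V n y)
    fun m w hw => by
      rw [LinearMap.comp_apply]
      by_cases h : m = n
      · subst h
        rw [tensorComp_same, twistedCoef_relation _ _ hw]
      · rw [tensorComp_ne h, map_zero]

theorem coinvFrame_eq {z : Fin n → M} (hd : Pairwise fun i j => Disjoint (U i) (U j))
    (hz : ∀ i, z i ∈ U i) (J : ∀ i, Fin (r i)) :
    coinvFrame d ε U e J (unorder z) = coinvProj ε V _ (ofPower d V n _
      (word d (isMultisplit_singletons (injective_of_mem_disjoint hd hz))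
        fun i => extSec (e i (J i)) {z i})) := by
  rw [coinvFrame, wordSec_eq_word _ fun i => (restr_unorder_eq hd hz i).symm]

/-- Only the identity contributes: if `σ i ≠ i`, the coordinate over `U (σ i)` is evaluated at the
point `z i` of the disjoint set `U i`. So the character plays no role, and no division by `n!`
occurs. -/
theorem coinvCoord_frame {z : Fin n → M} (hd : Pairwise fun i j => Disjoint (U i) (U j))
    (hz : ∀ i, z i ∈ U i) (he : ∀ i, IsFrameOn d (e i) (U i)) (J K : ∀ i, Fin (r i)) :
    coinvCoord d ε U e J (unorder z) (coinvFrame d ε U e K (unorder z)) =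
      if K = J then 1 else 0 := by
  rw [coinvFrame_eq hd hz, coinvCoord, coinvLift_proj, LinearMap.comp_apply, tensorComp_same,
    twistedCoef_word, Finset.sum_eq_single 1]
  · rw [map_one, Units.val_one, one_smul]
    simp only [Equiv.Perm.coe_one, id, fun i => (he i).coordFun_extSec (J i) (K i) (hz i)]
    rw [Finset.prod_ite_zero]
    simp [funext_iff]
  · intro σ _ hσ
    have : ∃ i, σ i ≠ i := by
      by_contra! h
      exact hσ (Equiv.ext h)
    obtain ⟨i, hi⟩ := this
    rw [Finset.prod_eq_zero (Finset.mem_univ i), smul_zero]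
    rw [coordFun_of_not, LinearMap.zero_apply]
    intro z' hz' h
    obtain rfl := Finset.singleton_injective h
    exact Set.disjoint_left.1 (hd hi) hz' (hz i)
  · simp

/-- Words in frame vectors span, and their letters sit at the points `z i` in some order; the
relations restore the order of the `U i` up to sign. -/
theorem coinvFrame_span {z : Fin n → M} (hd : Pairwise fun i j => Disjoint (U i) (U j))
    (hz : ∀ i, z i ∈ U i) (he : ∀ i, IsFrameOn d (e i) (U i)) :
    Submodule.span 𝕜 (Set.range fun J => coinvFrame d ε U e J (unorder z)) = ⊤ := by
  have hinj := injective_of_mem_disjoint hd hz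
  -- At points off `z` all vectors are admitted: they never occur in a word over `unorder z`.
  let B : ∀ a, Set ((extendZero V).Fib a) := fun a =>
    {u | (∃ i j, a = {z i} ∧ u = extSec (e i j) a) ∨ ∃ z', a = {z'} ∧ ∀ i, z' ≠ z i}
  have hB : ∀ a, Submodule.span 𝕜 (B a) = ⊤ := by
    intro a
    by_cases h : ∃ z', a = {z'}
    · obtain ⟨z', rfl⟩ := h
      by_cases h' : ∃ i, z' = z i
      · obtain ⟨i, rfl⟩ := h'
        refine eq_top_iff.2 (((he i).span_extSec (hz i)).ge.trans (Submodule.span_mono ?_))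
        rintro _ ⟨j, rfl⟩
        exact Or.inl ⟨i, j, rfl, rfl⟩
      · push Not at h'
        have : B {z'} = Set.univ := Set.eq_univ_of_forall fun u => Or.inr ⟨z', rfl, h'⟩
        rw [this, Submodule.span_univ]
    · push Not at h
      refine eq_top_iff.2 fun u _ => ?_
      rw [extendZero_eq_zero h u]
      exact Submodule.zero_mem _
  refine eq_top_iff.2 fun q _ => ?_
  obtain ⟨t, rfl⟩ := coinvProj_surjective _ q
  rw [eq_ofPower (card_unorder hinj) t]
  generalize tensorComp V n (unorder z) t = t'
  suffices H : Submodule.map (coinvProj ε V (unorder z) ∘ₗ ofPower d V n (unorder z)) ⊤ ≤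
      Submodule.span 𝕜 (Set.range fun J => coinvFrame d ε U e J (unorder z)) from
    H ⟨t', Submodule.mem_top, rfl⟩
  rw [← word_span B hB n (unorder z), Submodule.map_span, Submodule.span_le]
  rintro _ ⟨_, ⟨p, hp, v, hv, rfl⟩, rfl⟩
  have hmem : ∀ i, ∃ k, p i = {z k} ∧ ∃ j, v i = extSec (e k j) (p i) := by
    intro i
    rcases hv i with ⟨k, j, h1, h2⟩ | ⟨z', h1, h2⟩
    · exact ⟨k, h1, j, h2⟩
    · have : z' ∈ unorder z := (hp.2 z').2 ⟨i, by rw [h1]; exact Finset.mem_singleton_self _⟩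
      obtain ⟨k, hk⟩ := mem_unorder.1 this
      exact absurd hk.symm (h2 k)
  choose k hk hj using hmem
  have hkinj : Function.Injective k := by
    intro i i' h
    by_contra hne
    have h1 : Disjoint (p i) (p i') := hp.1 hne
    rw [hk, hk, h, Finset.disjoint_singleton] at h1
    exact h1 rfl
  let σ : Equiv.Perm (Fin n) := Equiv.ofBijective k (Finite.injective_iff_bijective.1 hkinj)
  have hσ : ∀ i, k (σ.symm i) = i := fun i => σ.apply_symm_apply i
  have hJ : ∀ i, ∃ j, v (σ.symm i) = extSec (e i j) (p (σ.symm i)) := by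
    intro i
    have h := hj (σ.symm i)
    rwa [hσ i] at h
  choose J hJ using hJ
  have hz1 : IsMultisplit (fun i => ((fun i => (⟨p i, v i⟩ : Letter V)) i).1) (unorder z) := hp
  change coinvProj ε V _ (ofPower d V n _ (word d hp v)) ∈ _
  rw [ofPower_word, coinvProj_listWord_perm hz1 σ.symm]
  have hw : ((fun i => (⟨p i, v i⟩ : Letter V)) ∘ σ.symm) =
      fun i => (⟨{z i}, extSec (e i (J i)) {z i}⟩ : Letter V) := by
    funext i
    have h1 : p (σ.symm i) = {z i} := by rw [hk, hσ]
    simp only [Function.comp, hJ i]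
    rw [h1]
  rw [hw]
  have hm : coinvProj ε V (unorder z) (listWord d (List.ofFn fun i =>
      (⟨{z i}, extSec (e i (J i)) {z i}⟩ : Letter V)) (unorder z)) ∈
      Submodule.span 𝕜 (Set.range fun J => coinvFrame d ε U e J (unorder z)) :=
    Submodule.subset_span ⟨J, by simp only [coinvFrame_eq hd hz, ofPower_word]⟩
  exact zsmul_mem hm _

theorem eq_sum_coinvCoord {z : Fin n → M} (hd : Pairwise fun i j => Disjoint (U i) (U j))
    (hz : ∀ i, z i ∈ U i) (he : ∀ i, IsFrameOn d (e i) (U i))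
    (q : (cauchyCoinvariants d ε V).Fib (unorder z)) :
    q = ∑ J, coinvCoord d ε U e J (unorder z) q • coinvFrame d ε U e J (unorder z) := by
  suffices H : LinearMap.id = ∑ J, (coinvCoord d ε U e J (unorder z)).smulRight
      (coinvFrame d ε U e J (unorder z)) by
    have := LinearMap.congr_fun H q
    rwa [LinearMap.sum_apply] at this
  refine LinearMap.ext_on (coinvFrame_span hd hz he) ?_
  rintro _ ⟨K, rfl⟩
  rw [LinearMap.sum_apply, Finset.sum_eq_single K]
  · rw [LinearMap.smulRight_apply, coinvCoord_frame hd hz he, if_pos rfl, one_smul]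
    rfl
  · intro J _ hJ
    rw [LinearMap.smulRight_apply, coinvCoord_frame hd hz he, if_neg hJ.symm, zero_smul]
  · simp

variable [T2Space M]

theorem coinvFrame_smoothAt {z : Fin n → M} (hd : Pairwise fun i j => Disjoint (U i) (U j))
    (hU : ∀ i, IsOpen (U i)) (hz : ∀ i, z i ∈ U i) (he : ∀ i, IsFrameOn d (e i) (U i))
    (J : ∀ i, Fin (r i)) :
    (cauchyCoinvariants d ε V).SmoothAt (coinvFrame d ε U e J) (unorder z) :=
  (toCoinvariants d ε V).smooth _ _ (smoothAt_ofPower (wordSec_smoothAt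
    (fun i => cleanAt_unorder hd hU hz i) fun i _ hb =>
      (he i).smoothAt_extSec (J i) fun _ hy => (mem_restr.1 (hb hy)).2))

theorem coinvCoord_smoothAt {z : Fin n → M} (hd : Pairwise fun i j => Disjoint (U i) (U j))
    (hU : ∀ i, IsOpen (U i)) (hz : ∀ i, z i ∈ U i) (he : ∀ i, IsFrameOn d (e i) (U i))
    (J : ∀ i, Fin (r i)) {s : ∀ y, (cauchyCoinvariants d ε V).Fib y}
    (hs : (cauchyCoinvariants d ε V).SmoothAt s (unorder z)) :
    USmoothAt d (fun y => coinvCoord d ε U e J y (s y)) (unorder z) := by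
  obtain ⟨t, ht, hst⟩ := exists_lift hs
  refine (twistedCoef_smoothAt (ε := ε) (φ := fun i => coordFun (e i) (U i) (J i))
    (fun i b hb s hs => (he i).coordFun_smoothAt (J i)
      ((cleanAt_unorder hd hU hz i).mono hb) hs) (smoothAt_tensor_iff.1 ht n)).congr ?_
  filter_upwards [hst] with y hy
  rw [hy, coinvCoord, coinvLift_proj]
  rfl

/-- The bundle of coinvariants is a smooth vector bundle. -/
theorem isVectorBundle_coinv (hV : V.IsVectorBundle (MSmoothAt d)) :
    (cauchyCoinvariants d ε V).IsVectorBundle (USmoothAt d) := by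
  intro x
  obtain ⟨w, hw, hx⟩ := exists_unorder_eq x
  obtain ⟨O, hO, hOd⟩ := exists_separating x
  choose r e he using hV
  have hN : ∀ a, ∃ N : Set M, IsOpen N ∧ a ∈ N ∧ IsFrameOn d (e a) N := fun a => by
    obtain ⟨N, hN, hNo, ha⟩ := mem_nhds_iff.1 (he a)
    exact ⟨N, hNo, ha, fun z hz => hN hz⟩
  choose N hNo hNa hNf using hN
  have hwx : ∀ i, w i ∈ x := fun i => by rw [← hx, mem_unorder]; exact ⟨i, rfl⟩
  -- Small enough to separate the points of `x` and to carry a frame of `V`.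
  let U : Fin x.card → Set M := fun i => O (w i) ∩ N (w i)
  have hU : ∀ i, IsOpen (U i) := fun i => (hO _).2.inter (hNo _)
  have hwU : ∀ i, w i ∈ U i := fun i => ⟨(hO _).1, hNa _⟩
  have hd : Pairwise fun i j => Disjoint (U i) (U j) := fun i j hij =>
    (hOd _ (hwx i) _ (hwx j) fun h => hij (hw h)).mono Set.inter_subset_left Set.inter_subset_left
  have hf : ∀ i, IsFrameOn d (e (w i)) (U i) := fun i z hz => hNf _ z hz.2
  have hgood : ∀ᶠ y in 𝓝 x, ∃ z : Fin x.card → M, (∀ i, z i ∈ U i) ∧ unorder z = y := by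
    suffices h : ∀ᶠ y in 𝓝 (unorder w),
        ∃ z : Fin x.card → M, (∀ i, z i ∈ U i) ∧ unorder z = y by rwa [hx] at h
    rw [nhds_unorder hw, Filter.eventually_map]
    filter_upwards [Filter.eventually_all.2 fun i =>
      (continuous_apply i).continuousAt ((hU i).mem_nhds (hwU i))] with z hz
    exact ⟨z, hz, rfl⟩
  -- A multi-index picks one frame vector at each point, so the rank is the product of the ranks of
  -- `V` at the points.
  let J := ∀ i, Fin (r (w i))
  let eq : Fin (Fintype.card J) ≃ J := (Fintype.equivFin J).symm
  refine ⟨Fintype.card J, fun k => coinvFrame d ε U (fun i => e (w i)) (eq k), ?_⟩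
  filter_upwards [hgood, hgood.eventually_nhds] with y ⟨z, hz, hy⟩ hnear
  subst hy
  have hspan := coinvFrame_span (ε := ε) hd hz hf
  refine ⟨⟨?_, ?_⟩, fun s => ⟨fun hs => ?_, ?_⟩⟩
  · rw [Fintype.linearIndependent_iff]
    intro c hc k
    have h := congrArg (coinvCoord d ε U (fun i => e (w i)) (eq k) (unorder z)) hc
    rw [map_sum, map_zero, Finset.sum_eq_single k] at h
    · rwa [map_smul, coinvCoord_frame hd hz hf, if_pos rfl, smul_eq_mul, mul_one] at h
    · intro l _ hl
      rw [map_smul, coinvCoord_frame hd hz hf, if_neg fun h => hl (eq.injective h), smul_zero]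
    · simp
  · rw [← hspan]
    congr 1
    exact eq.surjective.range_comp (fun K => coinvFrame d ε U (fun i => e (w i)) K (unorder z))
  · refine ⟨fun k y => coinvCoord d ε U (fun i => e (w i)) (eq k) y (s y),
      fun k => coinvCoord_smoothAt hd hU hz hf (eq k) hs, ?_⟩
    filter_upwards [hnear] with y ⟨z', hz', hy⟩
    subst hy
    rw [Equiv.sum_comp eq fun K => coinvCoord d ε U (fun i => e (w i)) K (unorder z')
      (s (unorder z')) • coinvFrame d ε U (fun i => e (w i)) K (unorder z')]
    exact eq_sum_coinvCoord hd hz' hf _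
  · rintro ⟨c, hc, hs⟩
    exact isSmoothModule_coinv.congr (isSmoothModule_coinv.sum Finset.univ fun k _ =>
      isSmoothModule_coinv.smul (hc k) (coinvFrame_smoothAt hd hU hz hf (eq k))) hs

end CoinvFrame

/-! ### Gradings and universal properties -/

/-- Each fibre of the coinvariants sits in the single degree `x.card`. -/
theorem DirectSum.isInternal_of_eq_top {R N ι : Type*} [Ring R] [AddCommGroup N] [Module R N]
    [DecidableEq ι] {p : ι → Submodule R N} (i : ι) (hi : p i = ⊤) (h : ∀ j, j ≠ i → p j = ⊥) :
    DirectSum.IsInternal p := by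
  rw [DirectSum.isInternal_submodule_iff_iSupIndep_and_iSup_eq_top]
  refine ⟨fun j => ?_, top_unique (hi ▸ le_iSup p i)⟩
  by_cases hj : j = i
  · subst hj
    have : ⨆ k, ⨆ (_ : k ≠ j), p k = ⊥ := by
      simp only [iSup_eq_bot]
      exact h
    rw [this]
    exact disjoint_bot_right
  · rw [h j hj]
    exact disjoint_bot_left

section Free

variable {𝕜 : Type u} [RCLike 𝕜] {d : ℕ} {M : Type u} [TopologicalSpace M]
  [ChartedSpace (EuclideanSpace ℝ (Fin d)) M] {V : PreBundle 𝕜 M}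
  {ε : ∀ n, Equiv.Perm (Fin n) →* ℤˣ} {e : ℤˣ}

/-- The image of the tensors of length `n` in the coinvariants. -/
def coinvPart (ε : ∀ n, Equiv.Perm (Fin n) →* ℤˣ) (V : PreBundle 𝕜 M) (n : ℤ) (x : UConf M) :
    Submodule 𝕜 ((cauchyCoinvariants d ε V).Fib x) :=
  -- For negative `n` the supremum is empty, hence zero.
  ⨆ (k : ℕ) (_ : (k : ℤ) = n), LinearMap.range (coinvProj ε V x ∘ₗ ofPower d V k x)

theorem coinvPart_card (x : UConf M) : coinvPart (d := d) ε V x.card x = ⊤ := by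
  refine top_unique fun q _ => ?_
  obtain ⟨t, rfl⟩ := coinvProj_surjective _ q
  refine Submodule.mem_iSup_of_mem x.card (Submodule.mem_iSup_of_mem rfl ?_)
  rw [eq_ofPower rfl t]
  exact ⟨_, rfl⟩

theorem coinvPart_of_ne {n : ℤ} {x : UConf M} (h : n ≠ x.card) :
    coinvPart (d := d) ε V n x = ⊥ := by
  simp only [coinvPart, iSup_eq_bot]
  rintro k rfl
  refine LinearMap.range_eq_bot.2 (LinearMap.ext fun t => ?_)
  rw [power_eq_zero (fun hx => h (congrArg _ hx.symm)) t, map_zero, map_zero]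

theorem mem_coinvPart_iff {n : ℤ} {x : UConf M} {q : (cauchyCoinvariants d ε V).Fib x} :
    q ∈ coinvPart ε V n x ↔ n = x.card ∨ q = 0 := by
  by_cases h : n = x.card
  · subst h
    simp [coinvPart_card]
  · simp [coinvPart_of_ne h, h]

variable [T2Space M]

/-- The grading of the bundle of coinvariants by the length of tensors. -/
def coinvGrading (ε : ∀ n, Equiv.Perm (Fin n) →* ℤˣ) (V : PreBundle 𝕜 M) :
    BundleGrading (cauchyCoinvariants d ε V) where
  part := coinvPart ε V
  isInternal x := DirectSum.isInternal_of_eq_top (x.card : ℤ) (coinvPart_card x)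
    fun _ h => coinvPart_of_ne h
  smooth n s x hs := by
    -- The degree is the locally constant number of points, so near `x` the projection is the
    -- identity or zero.
    by_cases hn : n = x.card
    · refine isSmoothModule_coinv.congr hs ?_
      filter_upwards [eventually_card_eq x] with y hy
      rw [DirectSum.IsInternal.ofBijective_coeLinearMap_of_mem
        (A := fun n => coinvPart (d := d) ε V n y) _
        (mem_coinvPart_iff.2 (Or.inl (by rw [hn, hy])))]
    · refine isSmoothModule_coinv.congr (isSmoothModule_coinv.zero x) ?_
      filter_upwards [eventually_card_eq x] with y hy
      rw [DirectSum.IsInternal.ofBijective_coeLinearMap_of_mem_ne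
        (A := fun n => coinvPart (d := d) ε V n y) _ (i := (y.card : ℤ))
        (by rw [hy]; exact Ne.symm hn) (mem_coinvPart_iff.2 (Or.inl rfl))]
      rfl

theorem smoothAt_generator {s : ∀ y, (extendZero V).Fib y} {x : UConf M}
    (hs : (extendZero V).SmoothAt s x) :
    (cauchyTensorBundle d V).SmoothAt (fun y => generator d V y (s y)) x := by
  -- Cutting along `Set.univ` gives all of `y` to the letter and leaves the vacuum for the unit.
  have hU : CleanAt Set.univ x := fun _ _ => Or.inl Filter.univ_mem
  have hr : ∀ y : UConf M, restr Set.univ y = y := fun y => by ext; simp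
  have h1 := smoothAt_ofPower (smoothAt_powerCons (d := d) (n := 0) (W := extendZero V) (v := s)
    (t := powerOne _) hU (by rwa [hr]) ⟨fun _ => 1, USmoothAt.const 1 _, .of_forall fun _ => rfl⟩)
  refine isSmoothModule_tensor.congr h1 (.of_forall fun y => ?_)
  have h2 : ∀ {a b : UConf M} (h : IsSplit y a b), a = y →
      generator d V y (s y) = ofPower d V 1 y (powerCons h (s a) (powerOne _ b)) := by
    rintro a b h rfl
    rw [generator_eq_lmul h]
    exact lmul_ofPower h (s a) (powerOne _ b)
  exact h2 _ (hr y)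

/-- The canonical map of `i_* V` to the coinvariants. -/
def coinvIota (ε : ∀ n, Equiv.Perm (Fin n) →* ℤˣ) (V : PreBundle 𝕜 M) :
    BundleHom (extendZero V) (cauchyCoinvariants d ε V) where
  toFun x := coinvProj ε V x ∘ₗ (lmul (isSplit_empty_right x)).flip (tensorOne V ∅)
  smooth s _ hs := isSmoothModule_coinv.congr
    ((toCoinvariants d ε V).smooth _ _ (smoothAt_generator hs)) (.of_forall fun y =>
      congrArg (coinvProj ε V y) (generator_eq_lmul (isSplit_empty_right y) (s y)).symm)

theorem coinvIota_apply (x : UConf M) (v : (extendZero V).Fib x) :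
    (coinvIota ε V).toFun x v = coinvProj ε V x (generator d V x v) :=
  congrArg (coinvProj ε V x) (generator_eq_lmul (isSplit_empty_right x) v).symm

/-- Every element over `a` is homogeneous of degree `a.card`, so no homogeneity has to be assumed.
-/
theorem mulAt_coinvAlgebra_swap (hε : IsCharacterFamily ε e) {x a b : UConf M}
    (h : IsSplit x a b) (q : (cauchyCoinvariants d ε V).Fib a)
    (r : (cauchyCoinvariants d ε V).Fib b) :
    mulAt d (coinvAlgebra hε V).mul h q r =
      ((e ^ (a.card * b.card) : ℤˣ) : ℤ) • mulAt d (coinvAlgebra hε V).mul h.symm r q := by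
  obtain ⟨s, rfl⟩ := coinvProj_surjective _ q
  obtain ⟨t, rfl⟩ := coinvProj_surjective _ r
  rw [eq_ofPower rfl s, eq_ofPower rfl t]
  exact mulAt_coinvAlgebra_comm hε h _ _

/-- The common core of both universal properties, used with `e = 1` and `e = -1`. -/
theorem existsUnique_coinvHom (hε : IsCharacterFamily ε e) {A : PreBundle 𝕜 (UConf M)}
    (mA : CauchyAlgebra d A) (hA : IsSmoothModule d A) (f : BundleHom (extendZero V) A)
    (hf : ∀ {x a b : UConf M} (h : IsSplit x a b) (u : (extendZero V).Fib a)
      (v : (extendZero V).Fib b), mulAt d mA.mul h (f.toFun a u) (f.toFun b v) =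
        (e : ℤ) • mulAt d mA.mul h.symm (f.toFun b v) (f.toFun a u)) :
    ∃! φ : BundleHom (cauchyCoinvariants d ε V) A, IsAlgebraHom (coinvAlgebra hε V) mA φ ∧
      ∀ (x : UConf M) (v : (extendZero V).Fib x),
        φ.toFun x ((coinvIota ε V).toFun x v) = f.toFun x v := by
  have hθ := isAlgebraHom_tensorHom (mA := mA) hA f
  have hr := fun x => map_relation (x := x) hε hθ (lettersCommute_tensorHom hA hf)
  have hg : ∀ (x : UConf M) (v : (extendZero V).Fib x),
      (coinvHom hA (tensorHom hA mA f) hr).toFun x ((coinvIota ε V).toFun x v) =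
        f.toFun x v := fun x v => by
    rw [coinvIota_apply, coinvHom_proj, tensorHom_generator]
  refine ⟨_, ⟨isAlgebraHom_coinvHom hA hε hr hθ, hg⟩, ?_⟩
  rintro ψ ⟨hψ, hv⟩
  refine coinv_hom_ext hε hψ (isAlgebraHom_coinvHom hA hε hr hθ) fun x v => ?_
  rw [← coinvIota_apply, hv, hg]

theorem isComm_coinvAlgebra (hε : IsCharacterFamily ε 1) : (coinvAlgebra (d := d) hε V).IsComm :=
  fun h q r => (mulAt_coinvAlgebra_swap hε h q r).trans (by simp)

theorem isFreeComm_coinvAlgebra (hε : IsCharacterFamily ε 1) :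
    IsFreeComm (coinvAlgebra (d := d) hε V) (coinvIota ε V) :=
  ⟨isComm_coinvAlgebra hε, fun _ mA hA hc f =>
    existsUnique_coinvHom hε mA hA.isSmoothModule f fun h _ _ => (hc h _ _).trans (by simp)⟩

theorem isGradedComm_coinvAlgebra (hε : IsCharacterFamily ε (-1)) :
    (coinvAlgebra (d := d) hε V).IsGradedComm (coinvGrading ε V) := by
  refine ⟨⟨mem_coinvPart_iff.2 (Or.inl rfl), fun {x a b} h i j q r hq hr => ?_⟩,
    fun {x a b} h i j q r hq hr => ?_⟩
  · rcases mem_coinvPart_iff.1 hq with rfl | rfl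
    · rcases mem_coinvPart_iff.1 hr with rfl | rfl
      · exact mem_coinvPart_iff.2 (Or.inl (by rw [h.card_eq, Nat.cast_add]))
      · rw [← mulAtₗ_apply, map_zero]
        exact zero_mem _
    · rw [← mulAtₗ_apply, map_zero]
      exact zero_mem _
  · rcases mem_coinvPart_iff.1 hq with rfl | rfl
    · rcases mem_coinvPart_iff.1 hr with rfl | rfl
      · rw [mulAt_coinvAlgebra_swap hε h, ← Nat.cast_mul]
        rfl
      · rw [← mulAtₗ_apply, ← mulAtₗ_apply, map_zero, map_zero, LinearMap.zero_apply, smul_zero]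
    · rw [← mulAtₗ_apply, ← mulAtₗ_apply, map_zero, map_zero, LinearMap.zero_apply, smul_zero]

theorem coinvIota_mem (x : UConf M) (v : (extendZero V).Fib x) :
    (coinvIota (d := d) ε V).toFun x v ∈ (coinvGrading ε V).part 1 x := by
  refine mem_coinvPart_iff.2 ?_
  by_cases h : ∃ y, x = {y}
  · obtain ⟨y, rfl⟩ := h
    exact Or.inl (by simp)
  · exact Or.inr (by rw [extendZero_eq_zero (fun y hy => h ⟨y, hy⟩) v, map_zero])

/-- The unit has degree zero over no points, and each nonzero letter adds one point and one degree.
-/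
theorem map_mem_part {A : PreBundle 𝕜 (UConf M)} {mA : CauchyAlgebra d A}
    {GA : BundleGrading A} (hG : mA.IsGraded GA) {θ : BundleHom (cauchyTensorBundle d V) A}
    (hθ : IsAlgebraHom (tensorAlgebra V) mA θ)
    (h1 : ∀ (x : UConf M) (v : (extendZero V).Fib x),
      θ.toFun x (generator d V x v) ∈ GA.part 1 x) {x : UConf M}
    (t : (cauchyTensorBundle d V).Fib x) : θ.toFun x t ∈ GA.part x.card x := by
  induction t using tensor_induction with
  | zero x => rw [map_zero]; exact zero_mem _
  | add x s t hs ht => rw [map_add]; exact add_mem hs ht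
  | smul x c t ht => rw [map_smul]; exact Submodule.smul_mem _ _ ht
  | one =>
    rw [map_tensorOne hθ]
    exact hG.1
  | lmul x a b h u t ht =>
    by_cases ha : ∃ y, a = {y}
    · obtain ⟨y, rfl⟩ := ha
      rw [map_lmul hθ, h.card_eq, Finset.card_singleton, Nat.cast_add, Nat.cast_one]
      exact hG.2 h _ _ _ _ (h1 _ _) ht
    · rw [extendZero_eq_zero (fun y hy => ha ⟨y, hy⟩) u, map_zero, LinearMap.zero_apply, map_zero]
      exact zero_mem _

theorem isFreeGradedComm_coinvAlgebra (hε : IsCharacterFamily ε (-1)) :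
    IsFreeGradedComm (coinvAlgebra (d := d) hε V) (coinvGrading ε V) (coinvIota ε V) := by
  refine ⟨isGradedComm_coinvAlgebra hε, coinvIota_mem, fun A mA GA hA hc f hf => ?_⟩
  -- Letters have degree one, so the sign is `(-1) ^ (1 * 1)`. Uniqueness holds without reference to
  -- degrees, and an algebra map that sends letters to degree one preserves degrees automatically.
  obtain ⟨φ, ⟨hφ, hv⟩, hu⟩ := existsUnique_coinvHom hε mA hA.isSmoothModule f
    fun h u v => (hc.2 h 1 1 _ _ (hf _ _) (hf _ _)).trans (by simp)
  refine ⟨φ, ⟨hφ, fun n x q hq => ?_, hv⟩, fun ψ hψ => hu ψ ⟨hψ.1, hψ.2.2⟩⟩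
  rcases mem_coinvPart_iff.1 hq with rfl | rfl
  · obtain ⟨t, rfl⟩ := coinvProj_surjective _ q
    refine map_mem_part (θ := φ.comp (toCoinvariants d ε V)) hc.1 ?_ (fun x v => ?_) t
    · have hp := isAlgebraHom_toCoinvariants (d := d) (V := V) hε
      exact ⟨fun h s t => (congrArg _ (hp.1 h s t)).trans (hφ.1 h _ _),
        (congrArg _ hp.2).trans hφ.2⟩
    · change φ.toFun x (coinvProj ε V x (generator d V x v)) ∈ _
      rw [← coinvIota_apply, hv]
      exact hf x v
  · rw [map_zero]
    exact zero_mem _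

end Free

end

theorem mainTheorem5 {𝕜 : Type u} [RCLike 𝕜] {d : ℕ} {M : Type u} [TopologicalSpace M] [T2Space M]
    [ChartedSpace (EuclideanSpace ℝ (Fin d)) M] [IsManifold (𝓡 d) ∞ M]
    (V : PreBundle 𝕜 M) (hV : V.IsVectorBundle (MSmoothAt d)) :
    ∃ mT : CauchyAlgebra d (cauchyTensorBundle d V), mT.IsConcatenation ∧
      ((cauchySymmetricBundle d V).IsVectorBundle (USmoothAt d) ∧
        ∃ (mS : CauchyAlgebra d (cauchySymmetricBundle d V))
          (ι : BundleHom (extendZero V) (cauchySymmetricBundle d V)),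
          IsAlgebraHom mT mS (toCoinvariants d trivialCharacter V) ∧
          (∀ x v, ι.toFun x v =
            (toCoinvariants d trivialCharacter V).toFun x (generator d V x v)) ∧
          mS.IsComm ∧ IsFreeComm mS ι) ∧
      ((cauchyExteriorBundle d V).IsVectorBundle (USmoothAt d) ∧
        ∃ (mL : CauchyAlgebra d (cauchyExteriorBundle d V))
          (G : BundleGrading (cauchyExteriorBundle d V))
          (ι : BundleHom (extendZero V) (cauchyExteriorBundle d V)),
          IsAlgebraHom mT mL (toCoinvariants d signCharacter V) ∧
          (∀ (n : ℤ) (x : UConf M), G.part n x = ⨆ (k : ℕ) (_ : (k : ℤ) = n),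
            LinearMap.range ((toCoinvariants d signCharacter V).toFun x ∘ₗ ofPower d V k x)) ∧
          (∀ x v, ι.toFun x v =
            (toCoinvariants d signCharacter V).toFun x (generator d V x v)) ∧
          mL.IsGradedComm G ∧ IsFreeGradedComm mL G ι) :=
  ⟨tensorAlgebra V, isConcatenation_tensorAlgebra,
    ⟨isVectorBundle_coinv hV, coinvAlgebra isCharacterFamily_trivial V, coinvIota _ V,
      isAlgebraHom_toCoinvariants _, coinvIota_apply, isComm_coinvAlgebra _,
      isFreeComm_coinvAlgebra _⟩,
    ⟨isVectorBundle_coinv hV, coinvAlgebra isCharacterFamily_sign V, coinvGrading _ V,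
      coinvIota _ V, isAlgebraHom_toCoinvariants _, fun _ _ => rfl, coinvIota_apply,
      isGradedComm_coinvAlgebra _, isFreeGradedComm_coinvAlgebra _⟩⟩
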